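/- **Proposition 4.1.** Let $n,m\ge 1$ and consider the Cauchy problem $$A^0 w_t+\sum_{j=1}^n A^j w_{x_j}+Lw=0,\qquad w|_{t=0}=w_0,\qquad w(t,x)\in\mathbb R^m,\ x\in\mathbb R^n,\ t>0,$$ where $A^0,\dots,A^n,L$ are real constant $m\times m$ matrices. For a real matrix $X$ write $X_1=\frac12(X+X^{\top})$, $X_2=\frac12(X-X^{\top})$, and put $A(\omega)=\sum_j\omega_jA^j$ for $\omega\in S^{n-1}$; kernels and (semi-)definiteness refer to $\mathbb C^m$. Assume: - (A) $A^0,\dots,A^n$ are symmetric, $A^0$ is positive definite, $L$ (not necessarily symmetric) is nonnegative definite, i.e. $L_1\ge 0$, and $\operatorname{Ker}L\ne\{0\}$; - (K) there is a real matrix-valued $K\in C^\infty(S^{n-1})$ with $K(-\omega)=-K(\omega)$, $(K(\omega)A^0)^{\top}=-K(\omega)A^0$ and $(K(\omega)A(\omega))_1>0$ on $\operatorname{Ker}L$ for every $\omega\in S^{n-1}$; - (S) there is a real $m\times m$ matrix $S$ with $(SA^0)^{\top}=SA^0$, $(SL)_1+L_1\ge0$ on $\mathbb C^m$ and $\operatorname{Ker}((SL)_1+L_1)=\operatorname{Ker}L$;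 - (S)$_1$ for this $S$, $i(SA(\omega))_2\ge 0$ on $\operatorname{Ker}L_1$ for every $\omega\in S^{n-1}$. Let $1\le q,r\le 2\le p\le\infty$ and let $k,\ell\ge0$ be integers with $\ell>n\left(\frac1r-\frac1p\right)$ (when $p=r=2$, every $\ell\ge0$ is allowed). Put $\gamma_2(q,p)=\frac n2\left(\frac1q-\frac1p\right)$. Then there is a constant $C>0$, independent of $l$, $w_0$ and $t$, such that for every integer $l\ge k+\ell$ and every $w_0\in W^{l,r}(\mathbb R^n)\cap L^q(\mathbb R^n)$ with values in $\mathbb R^m$, the Cauchy problem has a unique solution $w\in C([0,\infty);L^2(\mathbb R^n))$ (the equation being understood in the sense of distributions), and for all $t\ge0$ $$\|\partial_x^k w(t)\|_{L^p}\le C(1+t)^{-\gamma_2(q,p)-\frac k2}\|w_0\|_{L^q}+C(1+t)^{-\frac{\ell}{2}+\gamma_2(r,p)}\|\partial_x^{k+\ell}w_0\|_{L^r}.$$ Here $\|\partial_x^k f\|_{L^p}$ is the sum of the $L^p$ norms of all weak partial derivatives of $f$ of order $k$ (in particular, these exist). -/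

import Mathlib

open MeasureTheory Filter Topology Matrix
open scoped ENNReal NNReal ContDiff

noncomputable section

namespace HypSys

/-- The space `ℝⁿ` with its Euclidean norm. -/
abbrev Rn (n : ℕ) := EuclideanSpace ℝ (Fin n)

/-! ### Weak derivatives and Sobolev classes -/

/-- `e_{α 0}, …, e_{α (k-1)}`: the coordinate directions of the partial derivative
`∂_{α 0} ⋯ ∂_{α (k-1)}` of order `k`. -/
def dirs {n k : ℕ} (α : Fin k → Fin n) : Fin k → Rn n :=
  fun i => EuclideanSpace.single (α i) (1 : ℝ)

/-- `g` is the weak partial derivative `∂_{α 0} ⋯ ∂_{α (k-1)} f`; both functions are required to be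
locally integrable, so that all the integrals are genuine. -/
def IsWeakPartial {n m k : ℕ} (α : Fin k → Fin n) (f g : Rn n → Rn m) : Prop :=
  LocallyIntegrable f volume ∧ LocallyIntegrable g volume ∧
    ∀ φ : Rn n → ℝ, ContDiff ℝ ∞ φ → HasCompactSupport φ →
      ∫ x, (iteratedFDeriv ℝ k φ x (dirs α)) • f x = (-1 : ℝ) ^ k • ∫ x, φ x • g x

/-- `f ∈ W^{l,r}(ℝⁿ)`: all weak partial derivatives of order at most `l` exist and are in `L^r`. -/
def MemW {n m : ℕ} (l : ℕ) (r : ℝ≥0∞) (f : Rn n → Rn m) : Prop :=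
  ∀ j ≤ l, ∀ α : Fin j → Fin n, ∃ g : Rn n → Rn m, IsWeakPartial α f g ∧ MemLp g r volume

/-- `‖∂_{α 0} ⋯ ∂_{α (k-1)} f‖_{L^p}` in the weak sense. A weak derivative is unique almost
everywhere, so the infimum is over at most one class of functions; it is `∞` if there is no weak
derivative. -/
def partialNorm {n m k : ℕ} (α : Fin k → Fin n) (p : ℝ≥0∞) (f : Rn n → Rn m) : ℝ≥0∞ :=
  ⨅ (g : Rn n → Rn m) (_ : IsWeakPartial α f g), eLpNorm g p volume

/-- `‖∂ᵏ f‖_{L^p}`: the sum of the `L^p` norms of all partial derivatives of order `k`. -/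
def derivNorm {n m : ℕ} (k : ℕ) (p : ℝ≥0∞) (f : Rn n → Rn m) : ℝ≥0∞ :=
  ∑ α : Fin k → Fin n, partialNorm α p f

/-- `γ₂(q,p) = (n/2) (1/q - 1/p)`, with `1/∞ = 0`. -/
def gamma2 (n : ℕ) (q p : ℝ≥0∞) : ℝ :=
  (n : ℝ) / 2 * ((q⁻¹).toReal - (p⁻¹).toReal)

/-! ### Matrices -/

/-- Symmetric part `X₁`. -/
def symPart {m : ℕ} (X : Matrix (Fin m) (Fin m) ℝ) : Matrix (Fin m) (Fin m) ℝ :=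
  (1 / 2 : ℝ) • (X + Xᵀ)

/-- Skew-symmetric part `X₂`. -/
def skewPart {m : ℕ} (X : Matrix (Fin m) (Fin m) ℝ) : Matrix (Fin m) (Fin m) ℝ :=
  (1 / 2 : ℝ) • (X - Xᵀ)

/-- A real matrix as a complex one. -/
def toC {m : ℕ} (X : Matrix (Fin m) (Fin m) ℝ) : Matrix (Fin m) (Fin m) ℂ :=
  X.map Complex.ofReal

/-- The kernel in `ℂᵐ` of a real matrix. -/
def kerC {m : ℕ} (X : Matrix (Fin m) (Fin m) ℝ) : Submodule ℂ (Fin m → ℂ) :=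
  LinearMap.ker (toC X).mulVecLin

/-- The number `⟨Hφ, φ⟩`, which is real if `H` is Hermitian. -/
def form {m : ℕ} (H : Matrix (Fin m) (Fin m) ℂ) (φ : Fin m → ℂ) : ℝ :=
  (star φ ⬝ᵥ (H *ᵥ φ)).re

/-- `H ≥ 0` on the subspace `V` of `ℂᵐ`. -/
def NonnegOn {m : ℕ} (H : Matrix (Fin m) (Fin m) ℂ) (V : Submodule ℂ (Fin m → ℂ)) : Prop :=
  ∀ φ ∈ V, 0 ≤ form H φ

/-- `H > 0` on the subspace `V` of `ℂᵐ`. -/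
def PosOn {m : ℕ} (H : Matrix (Fin m) (Fin m) ℂ) (V : Submodule ℂ (Fin m → ℂ)) : Prop :=
  ∀ φ ∈ V, φ ≠ 0 → 0 < form H φ

/-! ### The system `A⁰ w_t + ∑ⱼ Aʲ w_{xⱼ} + L w = 0` and its structural conditions -/

/-- The real constant coefficient matrices of the system. -/
structure Coeffs (n m : ℕ) where
  /-- `A⁰` -/
  A0 : Matrix (Fin m) (Fin m) ℝ
  /-- `A¹, …, Aⁿ` -/
  A : Fin n → Matrix (Fin m) (Fin m) ℝ
  /-- the dissipation matrix -/
  L : Matrix (Fin m) (Fin m) ℝ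

variable {n m : ℕ}

/-- `A(ν) = ∑ⱼ νⱼ Aʲ`. -/
def Coeffs.symbol (c : Coeffs n m) (ν : Rn n) : Matrix (Fin m) (Fin m) ℝ :=
  ∑ j, ν j • c.A j

/-- Condition (A): `A⁰` is symmetric and positive definite, the `Aʲ` are symmetric, and `L`
(not necessarily symmetric) is nonnegative definite with a nontrivial kernel. -/
structure Coeffs.CondA (c : Coeffs n m) : Prop where
  A0_symm : c.A0ᵀ = c.A0
  A0_pos : PosOn (toC c.A0) ⊤
  A_symm : ∀ j, (c.A j)ᵀ = c.A j
  L_nonneg : NonnegOn (toC (symPart c.L)) ⊤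
  L_ker : kerC c.L ≠ ⊥

/-- Condition (K): there is a real compensating matrix `K(ν)`, smooth on the unit sphere (that is,
its extension to `ℝⁿ ∖ {0}` as a function of `ξ/|ξ|` is smooth), with `K(-ν) = -K(ν)`,
`(K(ν)A⁰)ᵀ = -K(ν)A⁰` and `(K(ν)A(ν))₁ > 0` on `Ker L`. -/
def Coeffs.CondK (c : Coeffs n m) : Prop :=
  ∃ K : Rn n → Matrix (Fin m) (Fin m) ℝ,
    (∀ a b, ContDiffOn ℝ ∞ (fun ξ : Rn n => K (‖ξ‖⁻¹ • ξ) a b) {0}ᶜ) ∧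
    ∀ ν : Rn n, ‖ν‖ = 1 →
      K (-ν) = -K ν ∧ (K ν * c.A0)ᵀ = -(K ν * c.A0) ∧
        PosOn (toC (symPart (K ν * c.symbol ν))) (kerC c.L)

/-- The requirements of condition (S) on the real matrix `S`: `(SA⁰)ᵀ = SA⁰`,
`(SL)₁ + L₁ ≥ 0` on `ℂᵐ` and `Ker((SL)₁ + L₁) = Ker L`. -/
structure Coeffs.CondS (c : Coeffs n m) (S : Matrix (Fin m) (Fin m) ℝ) : Prop where
  symm : (S * c.A0)ᵀ = S * c.A0
  nonneg : NonnegOn (toC (symPart (S * c.L) + symPart c.L)) ⊤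
  ker_eq : kerC (symPart (S * c.L) + symPart c.L) = kerC c.L

/-- Condition (S)₁ for the matrix `S` of condition (S): `i (SA(ν))₂ ≥ 0` on `Ker L₁` for every
unit vector `ν`. -/
def Coeffs.CondS1 (c : Coeffs n m) (S : Matrix (Fin m) (Fin m) ℝ) : Prop :=
  ∀ ν : Rn n, ‖ν‖ = 1 →
    NonnegOn (Complex.I • toC (skewPart (S * c.symbol ν))) (kerC (symPart c.L))

/-- Conditions (A), (K), (S) and (S)₁ together. -/
def Coeffs.Dissipative (c : Coeffs n m) : Prop :=
  c.CondA ∧ c.CondK ∧ ∃ S, c.CondS S ∧ c.CondS1 S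

/-- `w` is a solution of `A⁰ w_t + ∑ⱼ Aʲ w_{xⱼ} + L w = 0`, `w|_{t=0} = w₀`: it is a continuous
function of `t ≥ 0` with values in `L²(ℝⁿ; ℝᵐ)`, it takes the initial value `w₀`, and the equation
holds for `t > 0` in the sense of distributions in `x`. -/
structure Coeffs.IsSolution (c : Coeffs n m) (w₀ : Rn n → Rn m) (w : ℝ → Rn n → Rn m) : Prop where
  memLp : ∀ t, 0 ≤ t → MemLp (w t) 2 volume
  continuous : ∀ t, 0 ≤ t →
    Tendsto (fun s => eLpNorm (w s - w t) 2 volume) (𝓝[Set.Ici 0] t) (𝓝 0)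
  initial : w 0 =ᵐ[volume] w₀
  equation : ∀ φ : Rn n → ℝ, ContDiff ℝ ∞ φ → HasCompactSupport φ → ∀ t, 0 < t →
    HasDerivAt (fun s => ∫ x, φ x • Matrix.toEuclideanLin c.A0 (w s x))
      ((∑ j, ∫ x, (fderiv ℝ φ x (EuclideanSpace.single j (1 : ℝ))) •
          Matrix.toEuclideanLin (c.A j) (w t x))
        - ∫ x, φ x • Matrix.toEuclideanLin c.L (w t x)) t

end HypSys

end

noncomputable section

namespace HypSys

/-! ### Pointwise decay of the symbol of the evolution operator -/

/-! The Fourier transform turns the system into a family of linear ODEs indexed by ξ, with flow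
`c.flow t ξ` and no loss of information in `L²`. Everything rests on a pointwise bound of this flow
by a multiple of exp(-δ ρ(ξ) t), where ρ(ξ) = |ξ|²/(1+|ξ|²)² (`exists_norm_flow_le`). It comes from
a Lyapunov functional, namely the energy of A⁰ plus small frequency-dependent multiples of S A⁰ and
of -i K A⁰ (`exists_decay_of_symmetrizers`). Differentiating the energy yields only L₁; the S term
upgrades this to control of the distance to Ker L, and the K term supplies coercivity on Ker L
itself. The structural conditions are assumed on kernels only; `exists_ker_decomposition` extends
them to all vectors up to errors that the dissipation controls. Since (S)₁ fixes a sign only on Ker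
L₁, the weights must decay in |ξ|, and this is what makes ρ vanish at infinity.

The rate ρ behaves like |ξ|² for small ξ and like |ξ|⁻² for large ξ. Cut each half of frequency
space into shells: inside the unit ball |ξ| ~ 2⁻ʲ, outside |ξ| ~ 2ʲ. In both cases ρ is at least a
multiple of 4⁻ʲ there. On one shell Ω, passing from `L^q` data to an `L^p` solution costs
|Ω|^(1/q-1/p): `exists_fourierPair` bounds the transform in `L²(Ω)`, and the Bernstein inequality
`eLpNorm_invFourier_le_of_support` returns from `L²` to `L^p`. This route uses duality, Plancherel
and an interpolation between `L²` and `L^∞` only.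

Summing over shells leads to Σⱼ 2^(-εj) exp(-δt4⁻ʲ), which is O((1+t)^(-ε/2)) for ε > 0
(`exists_dyadic_sum_le`). At low frequency ε = k + n(1/q-1/p), which is the heat-like rate. At high
frequency the ℓ extra derivatives give ε = ℓ - n(1/r-1/p): decay is bought with regularity, and the
assumption on ℓ is exactly ε > 0. If ε = 0 with both Lebesgue exponents equal to 2, no summation is
needed and Plancherel suffices.

The same high-frequency estimate at t = 0 shows that the data and the required derivatives are in
`L²`, so the solution can be defined by the inverse transform. For uniqueness, the difference of two
solutions is integrated in time; on each ball of frequencies the generator is bounded, and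
Grönwall's inequality forces zero (`eq_zero_of_weak`). -/

/-- The scalar inequality behind the Lyapunov functional: with weights `b / (1 + s²)` and
`κ b s / (1 + s²)²` the three dissipation terms control `s² N² / (1 + s²)²`. -/
lemma weighted_dissipation_le {C c κ b s N X Y f g h : ℝ} (hC : 0 < C) (hc : 0 < c) (hκ : 0 < κ)
    (hκ' : κ * (C + C ^ 2 / c) ≤ 1) (hb : 0 < b) (hb2 : b ≤ 1 / 2) (hb' : b * C ^ 2 ≤ κ * c / 4)
    (hs : 0 ≤ s)
    (hf : -(C * N * X) ≤ f) (hg : c * N ^ 2 - C * Y ^ 2 ≤ g) (hh : h ≤ C * N * Y) :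
    κ * b * c / 2 * (s ^ 2 / (1 + s ^ 2) ^ 2) * N ^ 2 ≤
      X ^ 2 + b / (1 + s ^ 2) * (s * f) + b / (1 + s ^ 2) * (Y ^ 2 - X ^ 2) +
        κ * b * s / (1 + s ^ 2) ^ 2 * (s * g - h) := by
  have hD : (0 : ℝ) < 1 + s ^ 2 := by positivity
  set D := 1 + s ^ 2 with hDdef
  have hD1 : 1 ≤ D := by nlinarith [sq_nonneg s]
  set i := 1 / D with hi
  have hi0 : 0 < i := by positivity
  have hi1 : i ≤ 1 := by rw [hi, div_le_one hD]; exact hD1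
  have hsi : s ^ 2 * i ≤ 1 := by
    rw [hi, mul_one_div, div_le_one hD]; linarith
  have hii : i ^ 2 ≤ i := by rw [sq]; exact mul_le_of_le_one_left hi0.le hi1
  have e1 : b / D = b * i := by rw [hi]; ring
  have e2 : κ * b * s / D ^ 2 = κ * b * s * i ^ 2 := by rw [hi]; field_simp
  have e3 : s ^ 2 / D ^ 2 = s ^ 2 * i ^ 2 := by rw [hi]; field_simp
  rw [e1, e2, e3]
  -- The target is a multiple of r². Budget: the K term earns κbc r²; a quarter of this pays for the
  -- KL cross term (`T3`) and a quarter for the S cross term (`T1`, `T5`), so half remains. X² loses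
  -- a quarter to `T1` and at most a half to `T6`; all Y² losses fit into b i Y² by `hκ'` (`T4`).
  set r := s * i * N with hr
  have T1 : -(X ^ 2 / 4 + b ^ 2 * C ^ 2 * r ^ 2) ≤ b * i * (s * f) := by
    have h1 : b * i * s * (-(C * N * X)) ≤ b * i * s * f :=
      mul_le_mul_of_nonneg_left hf (by positivity)
    have h2 : b * i * s * (-(C * N * X)) = -(b * C * r * X) := by rw [hr]; ring
    have h3 := sq_nonneg (X / 2 - b * C * r)
    have h4 : (X / 2 - b * C * r) ^ 2 = X ^ 2 / 4 + b ^ 2 * C ^ 2 * r ^ 2 - b * C * r * X := by ring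
    have h5 : b * i * (s * f) = b * i * s * f := by ring
    linarith
  have T2 : κ * b * (c * r ^ 2 - C * (i * Y ^ 2)) ≤ κ * b * s * i ^ 2 * (s * g) := by
    have h1 : κ * b * (s ^ 2 * i ^ 2) * (c * N ^ 2 - C * Y ^ 2) ≤ κ * b * (s ^ 2 * i ^ 2) * g :=
      mul_le_mul_of_nonneg_left hg (by positivity)
    have h2 : s ^ 2 * i ^ 2 * Y ^ 2 ≤ i * Y ^ 2 := by
      have : s ^ 2 * i ^ 2 ≤ i := by
        calc s ^ 2 * i ^ 2 = s ^ 2 * i * i := by ring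
          _ ≤ 1 * i := mul_le_mul_of_nonneg_right hsi hi0.le
          _ = i := one_mul i
      exact mul_le_mul_of_nonneg_right this (sq_nonneg _)
    have h3 : κ * b * C * (s ^ 2 * i ^ 2 * Y ^ 2) ≤ κ * b * C * (i * Y ^ 2) :=
      mul_le_mul_of_nonneg_left h2 (by positivity)
    have h4 : κ * b * (s ^ 2 * i ^ 2) * (c * N ^ 2 - C * Y ^ 2) =
      κ * b * (c * r ^ 2) - κ * b * C * (s ^ 2 * i ^ 2 * Y ^ 2) := by rw [hr]; ring
    have h5 : κ * b * s * i ^ 2 * (s * g) = κ * b * (s ^ 2 * i ^ 2) * g := by ring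
    rw [h5]
    refine le_trans ?_ h1
    rw [h4]
    linarith
  have T3 : κ * b * s * i ^ 2 * h ≤ κ * b * (c / 4 * r ^ 2 + C ^ 2 / c * (i * Y ^ 2)) := by
    have h1 : κ * b * s * i ^ 2 * h ≤ κ * b * s * i ^ 2 * (C * N * Y) :=
      mul_le_mul_of_nonneg_left hh (by positivity)
    have h2 : κ * b * s * i ^ 2 * (C * N * Y) = κ * b * (C * r * (i * Y)) := by rw [hr]; ring
    have h3 : C * r * (i * Y) ≤ c / 4 * r ^ 2 + C ^ 2 / c * (i * Y) ^ 2 := by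
      have : c / 4 * r ^ 2 + C ^ 2 / c * (i * Y) ^ 2 - C * r * (i * Y) =
          (c * r / 2 - C * (i * Y)) ^ 2 / c := by field_simp; ring
      have h0 : 0 ≤ (c * r / 2 - C * (i * Y)) ^ 2 / c := by positivity
      linarith
    have h4 : (i * Y) ^ 2 ≤ i * Y ^ 2 := by
      rw [mul_pow]
      exact mul_le_mul_of_nonneg_right hii (sq_nonneg _)
    have h5 : C ^ 2 / c * (i * Y) ^ 2 ≤ C ^ 2 / c * (i * Y ^ 2) :=
      mul_le_mul_of_nonneg_left h4 (by positivity)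
    rw [h2] at h1
    exact h1.trans (mul_le_mul_of_nonneg_left (by linarith) (by positivity))
  have T4 : 0 ≤ b * (i * Y ^ 2) * (1 - κ * (C + C ^ 2 / c)) :=
    mul_nonneg (by positivity) (by linarith)
  have T5 : b ^ 2 * C ^ 2 * r ^ 2 ≤ κ * b * c / 4 * r ^ 2 := by
    have : b ^ 2 * C ^ 2 ≤ κ * b * c / 4 := by
      calc b ^ 2 * C ^ 2 = b * (b * C ^ 2) := by ring
        _ ≤ b * (κ * c / 4) := mul_le_mul_of_nonneg_left hb' hb.le
        _ = _ := by ring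
    exact mul_le_mul_of_nonneg_right this (sq_nonneg _)
  have T6 : b * i * X ^ 2 ≤ 1 / 2 * X ^ 2 := by
    have : b * i ≤ 1 / 2 := (mul_le_of_le_one_right hb.le hi1).trans hb2
    exact mul_le_mul_of_nonneg_right this (sq_nonneg _)
  have e4 : κ * b * c / 2 * (s ^ 2 * i ^ 2) * N ^ 2 = κ * b * c / 2 * r ^ 2 := by rw [hr]; ring
  rw [e4]
  have := sq_nonneg X
  linear_combination T1 + T2 + T3 + T4 + T5 + T6 + this / 4

/-! ### Lyapunov functionals and exponential decay -/

section Lyapunov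

variable {E : Type*} [NormedAddCommGroup E] [InnerProductSpace ℂ E]

/-- `Re ⟨x, T x⟩`. -/
def qf (T : E →L[ℂ] E) (x : E) : ℝ := (inner ℂ x (T x)).re

lemma qf_add (S T : E →L[ℂ] E) (x : E) : qf (S + T) x = qf S x + qf T x := by
  simp [qf]

lemma qf_sub (S T : E →L[ℂ] E) (x : E) : qf (S - T) x = qf S x - qf T x := by
  simp [qf]

lemma qf_neg (T : E →L[ℂ] E) (x : E) : qf (-T) x = -qf T x := by
  simp [qf, inner_neg_right]

lemma qf_smul (r : ℝ) (T : E →L[ℂ] E) (x : E) : qf ((r : ℂ) • T) x = r * qf T x := by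
  simp [qf]

lemma abs_qf_le (T : E →L[ℂ] E) (x : E) : |qf T x| ≤ ‖T‖ * ‖x‖ ^ 2 := by
  have h1 : |qf T x| ≤ ‖inner ℂ x (T x)‖ := Complex.abs_re_le_norm _
  have h2 : ‖inner ℂ x (T x)‖ ≤ ‖x‖ * ‖T x‖ := norm_inner_le_norm _ _
  have h3 : ‖T x‖ ≤ ‖T‖ * ‖x‖ := T.le_opNorm x
  nlinarith [norm_nonneg x, mul_le_mul_of_nonneg_left h3 (norm_nonneg x)]

lemma hasDerivAt_qf {H : E →L[ℂ] E} (hH : ∀ x y, inner ℂ (H x) y = inner ℂ x (H y))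
    {v : ℝ → E} {v' : E} {t : ℝ} (hv : HasDerivAt v v' t) :
    HasDerivAt (fun s => qf H (v s)) (2 * (inner ℂ (v t) (H v')).re) t := by
  have h1 : HasDerivAt (fun s => H (v s)) (H v') t :=
    (H.restrictScalars ℝ).hasFDerivAt.comp_hasDerivAt t hv
  have h2 := (hv.inner ℂ h1)
  have h3 := (Complex.reCLM.hasFDerivAt.comp_hasDerivAt t h2)
  refine h3.congr_deriv ?_
  have : inner ℂ v' (H (v t)) = starRingEnd ℂ (inner ℂ (v t) (H v')) := by
    rw [← hH, inner_conj_symm]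
  simp only [Complex.reCLM_apply, Complex.add_re, this, Complex.conj_re]
  ring

/-- Exponential decay of the flow of `Φ` from a Lyapunov functional. -/
lemma norm_le_of_lyapunov {H Φ : E →L[ℂ] E} (hH : ∀ x y, inner ℂ (H x) y = inner ℂ x (H y))
    {a B δ : ℝ} (ha : 0 < a) (hlow : ∀ x, a * ‖x‖ ^ 2 ≤ qf H x) (hup : ∀ x, qf H x ≤ B * ‖x‖ ^ 2)
    (hB : 0 < B) (hδ : 0 ≤ δ) (hdis : ∀ x, qf (H ∘L Φ) x ≤ -(δ * ‖x‖ ^ 2))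
    {v : ℝ → E} (hv : ∀ t, HasDerivAt v (Φ (v t)) t) {t : ℝ} (ht : 0 ≤ t) :
    ‖v t‖ ≤ √(B / a) * Real.exp (-(δ / B * t)) * ‖v 0‖ := by
  have hder : ∀ s, HasDerivAt (fun s => Real.exp (2 * (δ / B) * s) * qf H (v s))
      (Real.exp (2 * (δ / B) * s) * (2 * (δ / B)) * qf H (v s) +
        Real.exp (2 * (δ / B) * s) * (2 * (inner ℂ (v s) (H (Φ (v s)))).re)) s := by
    intro s
    have h1 : HasDerivAt (fun s : ℝ => Real.exp (2 * (δ / B) * s))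
        (Real.exp (2 * (δ / B) * s) * (2 * (δ / B))) s := by
      simpa using ((hasDerivAt_id s).const_mul (2 * (δ / B))).exp
    exact h1.mul (hasDerivAt_qf hH (hv s))
  -- The upper bound on H turns the dissipation δ‖x‖² into at least (δ/B) times the functional,
  -- which fixes the exponential weight.
  have hanti : Antitone (fun s => Real.exp (2 * (δ / B) * s) * qf H (v s)) := by
    apply antitone_of_deriv_nonpos
    · exact fun s => (hder s).differentiableAt
    · intro s
      rw [(hder s).deriv]
      have h1 := hdis (v s)
      have h2 := hup (v s)
      have h3 : (inner ℂ (v s) (H (Φ (v s)))).re = qf (H ∘L Φ) (v s) := rfl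
      rw [h3]
      have h4 : δ / B * qf H (v s) ≤ δ * ‖v s‖ ^ 2 := by
        calc δ / B * qf H (v s) ≤ δ / B * (B * ‖v s‖ ^ 2) :=
              mul_le_mul_of_nonneg_left h2 (by positivity)
          _ = δ * ‖v s‖ ^ 2 := by field_simp
      have h5 := Real.exp_pos (2 * (δ / B) * s)
      have h6 : Real.exp (2 * (δ / B) * s) * (2 * (δ / B)) * qf H (v s) +
          Real.exp (2 * (δ / B) * s) * (2 * qf (H ∘L Φ) (v s)) =
          2 * Real.exp (2 * (δ / B) * s) * (δ / B * qf H (v s) + qf (H ∘L Φ) (v s)) := by ring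
      rw [h6]
      exact mul_nonpos_of_nonneg_of_nonpos (by positivity) (by linarith)
  have h0 := hanti ht
  simp only [mul_zero, Real.exp_zero, one_mul] at h0
  have h1 : Real.exp (2 * (δ / B) * t) * (a * ‖v t‖ ^ 2) ≤ B * ‖v 0‖ ^ 2 :=
    (mul_le_mul_of_nonneg_left (hlow _) (Real.exp_pos _).le).trans (h0.trans (hup _))
  have h2 : ‖v t‖ ^ 2 ≤ (√(B / a) * Real.exp (-(δ / B * t)) * ‖v 0‖) ^ 2 := by
    rw [mul_pow, mul_pow, Real.sq_sqrt (by positivity)]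
    have h3 : Real.exp (-(δ / B * t)) ^ 2 * Real.exp (2 * (δ / B) * t) = 1 := by
      rw [← Real.exp_nat_mul, ← Real.exp_add]
      convert Real.exp_zero using 2
      push_cast; ring
    have h4 : ‖v t‖ ^ 2 = Real.exp (-(δ / B * t)) ^ 2 / a *
        (Real.exp (2 * (δ / B) * t) * (a * ‖v t‖ ^ 2)) := by
      have : Real.exp (-(δ / B * t)) ^ 2 / a * (Real.exp (2 * (δ / B) * t) * (a * ‖v t‖ ^ 2)) =
        (Real.exp (-(δ / B * t)) ^ 2 * Real.exp (2 * (δ / B) * t)) * ‖v t‖ ^ 2 := by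
        field_simp
      rw [this, h3, one_mul]
    rw [h4]
    calc _ ≤ Real.exp (-(δ / B * t)) ^ 2 / a * (B * ‖v 0‖ ^ 2) :=
          mul_le_mul_of_nonneg_left h1 (by positivity)
      _ = _ := by ring
  exact (le_abs_self _).trans (abs_le_of_sq_le_sq h2 (by positivity))

/-- Uniform decay for a family of systems `A0 v' = -(i s A + L) v` admitting symmetrizers
`S` and `K`. -/
lemma exists_decay_of_symmetrizers {ι : Type*} (A0 L S : E →L[ℂ] E) (A K : ι → E →L[ℂ] E)
    {a B C c : ℝ} (ha : 0 < a) (hC : 0 < C) (hc : 0 < c)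
    (hA0 : ∀ x y, inner ℂ (A0 x) y = inner ℂ x (A0 y))
    (hA0pos : ∀ x, a * ‖x‖ ^ 2 ≤ qf A0 x)
    (hS : ∀ x y, inner ℂ (S (A0 x)) y = inner ℂ x (S (A0 y)))
    (hK : ∀ ν x y, inner ℂ (K ν (A0 x)) y = -inner ℂ x (K ν (A0 y)))
    (hKB : ∀ ν, ‖K ν ∘L A0‖ ≤ B)
    (hA : ∀ ν x, qf (Complex.I • A ν) x = 0)
    (hL : ∀ x, 0 ≤ qf L x) (hSL : ∀ x, 0 ≤ qf (S ∘L L) x + qf L x)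
    (hSA : ∀ ν x, -(C * ‖x‖ * √(qf L x)) ≤ qf (Complex.I • (S ∘L A ν)) x)
    (hKA : ∀ ν x, c * ‖x‖ ^ 2 - C * (qf (S ∘L L) x + qf L x) ≤ qf (K ν ∘L A ν) x)
    (hKL : ∀ ν x, qf (Complex.I • (K ν ∘L L)) x ≤ C * ‖x‖ * √(qf (S ∘L L) x + qf L x)) :
    ∃ δ > 0, ∃ M > 0, ∀ (ν : ι) (s : ℝ), 0 ≤ s → ∀ Φ : E →L[ℂ] E,
      A0 ∘L Φ = -(((s : ℂ) * Complex.I) • A ν + L) → ∀ v : ℝ → E,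
      (∀ t, HasDerivAt v (Φ (v t)) t) → ∀ t, 0 ≤ t →
        ‖v t‖ ≤ M * Real.exp (-(δ * (s ^ 2 / (1 + s ^ 2) ^ 2) * t)) * ‖v 0‖ := by
  obtain ⟨B', hB', hB1, hB2, hB3⟩ : ∃ B' > 0, B ≤ B' ∧ ‖S ∘L A0‖ ≤ B' ∧ ‖A0‖ ≤ B' := by
    refine ⟨1 + |B| + ‖S ∘L A0‖ + ‖A0‖, by positivity, ?_, ?_, ?_⟩ <;>
    linarith [le_abs_self B, abs_nonneg B, norm_nonneg (S ∘L A0), norm_nonneg A0]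
  -- κ balances K against S, while b makes both small against A⁰. The three bounds on b serve to
  -- absorb X², to absorb the S cross term, and to keep H within (a/2)‖x‖² of A⁰.
  set κ := min 1 (1 / (C + C ^ 2 / c)) with hκdef
  have hκ : 0 < κ := lt_min one_pos (by positivity)
  have hκ1 : κ ≤ 1 := min_le_left _ _
  have hκ' : κ * (C + C ^ 2 / c) ≤ 1 := by
    calc κ * (C + C ^ 2 / c) ≤ 1 / (C + C ^ 2 / c) * (C + C ^ 2 / c) :=
          mul_le_mul_of_nonneg_right (min_le_right _ _) (by positivity)
      _ = 1 := by field_simp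
  set b := min (1 / 2) (min (κ * c / 4 / C ^ 2) (a / (4 * B'))) with hbdef
  have hb : 0 < b := lt_min (by norm_num) (lt_min (by positivity) (by positivity))
  have hb2 : b ≤ 1 / 2 := min_le_left _ _
  have hb' : b * C ^ 2 ≤ κ * c / 4 := by
    rw [← le_div_iff₀ (by positivity)]
    exact (min_le_right _ _).trans (min_le_left _ _)
  have hba : b * B' ≤ a / 4 := by
    have : b ≤ a / 4 / B' := ((min_le_right _ _).trans (min_le_right _ _)).trans_eq (by field_simp)
    rwa [le_div_iff₀ hB'] at this
  have hBB : 0 < B' + a := by positivity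
  refine ⟨κ * b * c / 2 / (B' + a), by positivity, √((B' + a) / (a / 2)), by positivity, ?_⟩
  intro ν s hs Φ hΦ v hv t ht
  have hD : (1 : ℝ) ≤ 1 + s ^ 2 := by nlinarith [sq_nonneg s]
  set b1 := b / (1 + s ^ 2) with hb1
  set b2 := κ * b * s / (1 + s ^ 2) ^ 2 with hb2'
  have hb1n : 0 ≤ b1 := by positivity
  have hb2n : 0 ≤ b2 := by positivity
  have hb1b : b1 ≤ b := div_le_self hb.le hD
  have hb2b : b2 ≤ b := by
    rw [hb2', div_le_iff₀ (by positivity)]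
    have h1 : s ≤ (1 + s ^ 2) ^ 2 := by nlinarith [sq_nonneg (s - 1), sq_nonneg s]
    have h2 : κ * b ≤ b := by nlinarith
    have := mul_le_mul h2 h1 hs hb.le
    linarith
  -- K A⁰ is skew-adjoint, so the factor i makes it symmetric. Paired with the i s A of the
  -- generator it produces the real coercive term s K A.
  set H : E →L[ℂ] E := A0 + (b1 : ℂ) • (S ∘L A0) - (b2 : ℂ) • (Complex.I • (K ν ∘L A0)) with hHdef
  have hH : ∀ x y, inner ℂ (H x) y = inner ℂ x (H y) := by
    intro x y
    simp only [hHdef, _root_.sub_apply, _root_.add_apply,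
      _root_.smul_apply, ContinuousLinearMap.comp_apply, inner_add_left,
      inner_add_right, inner_sub_left, inner_sub_right, inner_smul_left, inner_smul_right, hA0,
      hS, hK, Complex.conj_ofReal, Complex.conj_I]
    ring
  have hqH : ∀ x, |qf H x - qf A0 x| ≤ a / 2 * ‖x‖ ^ 2 := by
    intro x
    have h1 := abs_qf_le (S ∘L A0) x
    have h2 := abs_qf_le (Complex.I • (K ν ∘L A0)) x
    rw [norm_smul, Complex.norm_I, one_mul] at h2
    have hx := sq_nonneg ‖x‖
    have h3 : |qf (S ∘L A0) x| ≤ B' * ‖x‖ ^ 2 := h1.trans (mul_le_mul_of_nonneg_right hB2 hx)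
    have h4 : |qf (Complex.I • (K ν ∘L A0)) x| ≤ B' * ‖x‖ ^ 2 :=
      h2.trans (mul_le_mul_of_nonneg_right ((hKB ν).trans hB1) hx)
    have h5 : qf H x - qf A0 x =
        b1 * qf (S ∘L A0) x - b2 * qf (Complex.I • (K ν ∘L A0)) x := by
      rw [hHdef, qf_sub, qf_add, qf_smul, qf_smul]; ring
    rw [h5]
    have h6 : |b1 * qf (S ∘L A0) x| ≤ b * (B' * ‖x‖ ^ 2) := by
      rw [abs_mul, abs_of_nonneg hb1n]
      exact mul_le_mul hb1b h3 (abs_nonneg _) hb.le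
    have h7 : |b2 * qf (Complex.I • (K ν ∘L A0)) x| ≤ b * (B' * ‖x‖ ^ 2) := by
      rw [abs_mul, abs_of_nonneg hb2n]
      exact mul_le_mul hb2b h4 (abs_nonneg _) hb.le
    have h8 := abs_sub (b1 * qf (S ∘L A0) x) (b2 * qf (Complex.I • (K ν ∘L A0)) x)
    nlinarith
  have hlow : ∀ x, a / 2 * ‖x‖ ^ 2 ≤ qf H x := fun x => by
    have := (abs_le.1 (hqH x)).1
    linarith [hA0pos x]
  have hup : ∀ x, qf H x ≤ (B' + a) * ‖x‖ ^ 2 := fun x => by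
    have h1 := (abs_le.1 (hqH x)).2
    have h2 := (abs_le.1 (abs_qf_le A0 x)).2
    have h3 := mul_le_mul_of_nonneg_right hB3 (sq_nonneg ‖x‖)
    nlinarith [mul_nonneg ha.le (sq_nonneg ‖x‖)]
  have hdis : ∀ x, qf (H ∘L Φ) x ≤
      -(κ * b * c / 2 * (s ^ 2 / (1 + s ^ 2) ^ 2) * ‖x‖ ^ 2) := by
    intro x
    have e1 : H ∘L Φ = A0 ∘L Φ + (b1 : ℂ) • (S ∘L (A0 ∘L Φ)) -
        (b2 : ℂ) • (Complex.I • (K ν ∘L (A0 ∘L Φ))) := by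
      ext y; simp [hHdef]
    have e2 : H ∘L Φ = -(((s : ℂ)) • (Complex.I • A ν) + L
        + (b1 : ℂ) • ((s : ℂ) • (Complex.I • (S ∘L A ν)) + S ∘L L)
        + (b2 : ℂ) • ((s : ℂ) • (K ν ∘L A ν) - Complex.I • (K ν ∘L L))) := by
      rw [e1, hΦ]
      ext y
      simp only [_root_.sub_apply, _root_.add_apply,
        _root_.smul_apply, ContinuousLinearMap.comp_apply,
        _root_.neg_apply, map_add, map_neg, map_smul]
      simp only [smul_add, smul_sub, smul_neg, smul_smul]
      have : (b2 : ℂ) * (Complex.I * (s * Complex.I)) = -(b2 * s) := by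
        linear_combination (b2 * s : ℂ) * Complex.I_mul_I
      rw [this]
      simp only [neg_smul]
      module
    rw [e2, qf_neg, qf_add, qf_add, qf_add, qf_smul, qf_smul, qf_smul, qf_add, qf_sub, qf_smul,
      qf_smul, hA, neg_le_neg_iff]
    have h1 := hSA ν x
    have h2 := hKA ν x
    have h3 := hKL ν x
    have hX := Real.sq_sqrt (hL x)
    have hY := Real.sq_sqrt (hSL x)
    rw [← hY] at h2
    have := weighted_dissipation_le (f := qf (Complex.I • (S ∘L A ν)) x)
      (g := qf (K ν ∘L A ν) x) (h := qf (Complex.I • (K ν ∘L L)) x) hC hc hκ hκ' hb hb2 hb' hs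
      h1 h2 h3
    rw [hX, hY] at this
    refine this.trans_eq ?_
    rw [← hb1, ← hb2']
    ring
  have := norm_le_of_lyapunov hH (by positivity) hlow hup hBB (by positivity) hdis hv ht
  convert this using 4
  field_simp

end Lyapunov

end HypSys

namespace HypSys

/-! ### Quadratic forms that are positive on a subspace or off a kernel -/

section QuadraticForms

variable {E : Type*} [NormedAddCommGroup E] [InnerProductSpace ℂ E]

/-- The form attains a positive minimum over the compact set of parameters and unit vectors of W;
homogeneity does the rest. -/
lemma exists_pos_le_qf [FiniteDimensional ℂ E] {X : Type*} [TopologicalSpace X] {s : Set X}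
    (hs : IsCompact s) {T : X → E →L[ℂ] E} (hT : ContinuousOn T s) (W : Submodule ℂ E)
    (h : ∀ ν ∈ s, ∀ x ∈ W, x ≠ 0 → 0 < qf (T ν) x) :
    ∃ c > 0, ∀ ν ∈ s, ∀ x ∈ W, c * ‖x‖ ^ 2 ≤ qf (T ν) x := by
  have : ProperSpace E := FiniteDimensional.proper ℂ E
  set D : Set (X × E) := s ×ˢ (Metric.sphere (0 : E) 1 ∩ (W : Set E)) with hD
  have hDc : IsCompact D :=
    hs.prod ((isCompact_sphere 0 1).inter_right (Submodule.closed_of_finiteDimensional W))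
  have hcont : ContinuousOn (fun p : X × E => qf (T p.1) p.2) D := by
    have h1 : ContinuousOn (fun p : X × E => T p.1) D :=
      hT.comp continuousOn_fst fun p hp => hp.1
    have h2 : ContinuousOn (fun p : X × E => (T p.1) p.2) D := h1.clm_apply continuousOn_snd
    exact Complex.continuous_re.comp_continuousOn (continuousOn_snd.inner (𝕜 := ℂ) h2)
  have key : ∃ c > 0, ∀ p ∈ D, c ≤ qf (T p.1) p.2 := by
    rcases D.eq_empty_or_nonempty with hE | hN
    · exact ⟨1, one_pos, fun p hp => by simp [hE] at hp⟩
    · obtain ⟨p, hp, hmin⟩ := hDc.exists_isMinOn hN hcont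
      refine ⟨qf (T p.1) p.2, h p.1 hp.1 p.2 hp.2.2 ?_, fun q hq => hmin hq⟩
      intro h0
      have := hp.2.1
      simp [h0] at this
  obtain ⟨c, hc, hcD⟩ := key
  refine ⟨c, hc, fun ν hν x hx => ?_⟩
  rcases eq_or_ne x 0 with rfl | hx0
  · simp [qf]
  have hn : 0 < ‖x‖ := norm_pos_iff.2 hx0
  have h1 : c ≤ qf (T ν) (((‖x‖⁻¹ : ℝ) : ℂ) • x) := by
    refine hcD (ν, _) ⟨hν, ?_, W.smul_mem _ hx⟩
    simp [norm_smul, hn.ne']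
  have h2 : qf (T ν) (((‖x‖⁻¹ : ℝ) : ℂ) • x) = ‖x‖⁻¹ ^ 2 * qf (T ν) x := by
    rw [qf, map_smul, inner_smul_left, inner_smul_right, Complex.conj_ofReal, ← mul_assoc,
      ← Complex.ofReal_mul, Complex.re_ofReal_mul, qf]
    ring
  rw [h2] at h1
  calc c * ‖x‖ ^ 2 ≤ ‖x‖⁻¹ ^ 2 * qf (T ν) x * ‖x‖ ^ 2 :=
        mul_le_mul_of_nonneg_right h1 (sq_nonneg _)
    _ = qf (T ν) x := by field_simp

/-- A zero of a nonnegative form is a minimum. Moving from x in the direction -T x changes the form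
at first order by -2t‖T x‖², so T x must vanish. -/
lemma eq_zero_of_qf_eq_zero {T : E →L[ℂ] E} (hT : ∀ x y, inner ℂ (T x) y = inner ℂ x (T y))
    (hpos : ∀ x, 0 ≤ qf T x) {x : E} (hx : qf T x = 0) : T x = 0 := by
  set N := ‖T x‖ ^ 2 with hN
  set q := qf T (T x) with hq
  have key : ∀ t : ℝ, 0 ≤ -(2 * t * N) + t ^ 2 * q := by
    intro t
    have h1 := hpos (x - (t : ℂ) • T x)
    have h2 : qf T (x - (t : ℂ) • T x) = qf T x - 2 * t * N + t ^ 2 * q := by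
      have e : (inner ℂ (T x) (T x)).re = N := by
        rw [inner_self_eq_norm_sq_to_K]; norm_cast
      have e1 : (inner ℂ x (T (T x))).re = N := by rw [← hT, e]
      simp only [qf, map_sub, map_smul, inner_sub_left, inner_sub_right, inner_smul_left,
        inner_smul_right, Complex.conj_ofReal, Complex.sub_re, Complex.re_ofReal_mul, e, e1, hq]
      ring
    rw [h2, hx] at h1
    linarith
  have hq0 : 0 ≤ q := hpos _
  have hN0 : 0 ≤ N := sq_nonneg _
  -- The denominator q + 1 instead of q avoids a separate case q = 0.
  have h1 := key (N / (q + 1))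
  have h2 : -(2 * (N / (q + 1)) * N) + (N / (q + 1)) ^ 2 * q =
      -(N ^ 2 * (q + 2) / (q + 1) ^ 2) := by field_simp; ring
  rw [h2] at h1
  have h3 : N ^ 2 * (q + 2) / (q + 1) ^ 2 ≤ 0 := by linarith
  have h4 : N = 0 := by
    by_contra hne
    have : 0 < N ^ 2 * (q + 2) / (q + 1) ^ 2 := by positivity
    linarith
  simpa [hN] using h4

/-- On the orthogonal complement of the kernel the form is definite, hence coercive by compactness;
so its square root controls the distance to the kernel. With y the orthogonal projection, hypotheses
known only on a kernel can be used at y and transferred to x. -/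
lemma exists_ker_decomposition [FiniteDimensional ℂ E] {T : E →L[ℂ] E}
    (hT : ∀ x y, inner ℂ (T x) y = inner ℂ x (T y)) (hpos : ∀ x, 0 ≤ qf T x) :
    ∃ C > 0, ∀ x, ∃ y, T y = 0 ∧ ‖y‖ ≤ ‖x‖ ∧ ‖x‖ ^ 2 = ‖y‖ ^ 2 + ‖x - y‖ ^ 2 ∧
      ‖x - y‖ ≤ C * √(qf T x) := by
  set W : Submodule ℂ E := LinearMap.ker T.toLinearMap with hW
  obtain ⟨c, hc, hcW⟩ := exists_pos_le_qf (X := Unit) (s := Set.univ) isCompact_univ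
    (T := fun _ => T) continuousOn_const Wᗮ (by
      intro _ _ x hx hx0
      refine lt_of_le_of_ne (hpos x) fun h => hx0 ?_
      have h1 : x ∈ W := by
        rw [hW, LinearMap.mem_ker]; exact eq_zero_of_qf_eq_zero hT hpos h.symm
      exact inner_self_eq_zero.1 (Submodule.inner_right_of_mem_orthogonal h1 hx))
  refine ⟨1 / √c, by positivity, fun x => ?_⟩
  obtain ⟨y, hy, z, hz, rfl⟩ := W.exists_add_mem_mem_orthogonal x
  have hTy : T y = 0 := hy
  have hyz : inner ℂ y z = 0 := Submodule.inner_right_of_mem_orthogonal hy hz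
  have hnorm : ‖y + z‖ ^ 2 = ‖y‖ ^ 2 + ‖z‖ ^ 2 := by
    have := norm_add_sq_eq_norm_sq_add_norm_sq_of_inner_eq_zero y z hyz
    nlinarith
  refine ⟨y, hTy, ?_, by simpa using hnorm, ?_⟩
  · refine le_of_sq_le_sq ?_ (norm_nonneg _) |>.trans le_rfl
    rw [hnorm]; nlinarith [sq_nonneg ‖z‖]
  · have h1 : qf T (y + z) = qf T z := by
      simp only [qf, map_add, hTy, zero_add, inner_add_left]
      rw [← hT, hTy]; simp
    have h2 := hcW () trivial z hz
    rw [h1, add_sub_cancel_left]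
    have h3 : √c * ‖z‖ ≤ √(qf T z) := by
      rw [Real.le_sqrt (by positivity) (hpos z), mul_pow, Real.sq_sqrt hc.le]
      exact h2
    rw [div_mul_eq_mul_div, one_mul, le_div_iff₀ (by positivity)]
    linarith

lemma abs_qf_sub_qf_le (T : E →L[ℂ] E) {x y : E} (hxy : ‖y‖ ≤ ‖x‖) :
    |qf T x - qf T y| ≤ 2 * ‖T‖ * ‖x‖ * ‖x - y‖ := by
  have h1 : qf T x - qf T y = (inner ℂ (x - y) (T x)).re + (inner ℂ y (T (x - y))).re := by
    simp [qf]
  rw [h1]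
  have h2 : |(inner ℂ (x - y) (T x)).re| ≤ ‖x - y‖ * (‖T‖ * ‖x‖) :=
    (Complex.abs_re_le_norm _).trans ((norm_inner_le_norm _ _).trans
      (mul_le_mul_of_nonneg_left (T.le_opNorm x) (norm_nonneg _)))
  have h3 : |(inner ℂ y (T (x - y))).re| ≤ ‖x‖ * (‖T‖ * ‖x - y‖) :=
    (Complex.abs_re_le_norm _).trans ((norm_inner_le_norm _ _).trans
      (mul_le_mul hxy (T.le_opNorm _) (norm_nonneg _) (norm_nonneg _)))
  calc _ ≤ _ := abs_add_le _ _
    _ ≤ ‖x - y‖ * (‖T‖ * ‖x‖) + ‖x‖ * (‖T‖ * ‖x - y‖) := add_le_add h2 h3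
    _ = _ := by ring

end QuadraticForms

/-! ### The matrices as operators on `ℂᵐ` -/

variable {n m : ℕ}

/-- `ℂᵐ` with its Hermitian norm. -/
abbrev Cm (m : ℕ) := EuclideanSpace ℂ (Fin m)

/-- The operator on `ℂᵐ` given by a real matrix. -/
def op (X : Matrix (Fin m) (Fin m) ℝ) : Cm m →L[ℂ] Cm m :=
  Matrix.toEuclideanCLM (𝕜 := ℂ) (n := Fin m) (toC X)

lemma toC_mul (X Y : Matrix (Fin m) (Fin m) ℝ) : toC (X * Y) = toC X * toC Y :=
  Matrix.map_mul (f := Complex.ofRealHom)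

lemma op_mul (X Y : Matrix (Fin m) (Fin m) ℝ) : op (X * Y) = op X ∘L op Y := by
  rw [op, toC_mul, map_mul]; rfl

lemma op_one : op (1 : Matrix (Fin m) (Fin m) ℝ) = ContinuousLinearMap.id ℂ _ := by
  have : toC (1 : Matrix (Fin m) (Fin m) ℝ) = 1 := by
    ext i j; by_cases h : i = j <;> simp [toC, Matrix.one_apply, h]
  rw [op, this, map_one]; rfl

lemma op_add (X Y : Matrix (Fin m) (Fin m) ℝ) : op (X + Y) = op X + op Y := by
  have : toC (X + Y) = toC X + toC Y := by ext; simp [toC]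
  rw [op, this, map_add]; rfl

lemma op_smul (r : ℝ) (X : Matrix (Fin m) (Fin m) ℝ) : op (r • X) = (r : ℂ) • op X := by
  have : toC (r • X) = (r : ℂ) • toC X := by ext; simp [toC]
  rw [op, this, map_smul]; rfl

lemma op_neg (X : Matrix (Fin m) (Fin m) ℝ) : op (-X) = -op X := by
  have : toC (-X) = -toC X := by ext; simp [toC]
  rw [op, this, map_neg]; rfl

lemma op_sub (X Y : Matrix (Fin m) (Fin m) ℝ) : op (X - Y) = op X - op Y := by
  rw [sub_eq_add_neg, op_add, op_neg, sub_eq_add_neg]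

lemma op_sum {ι : Type*} (s : Finset ι) (X : ι → Matrix (Fin m) (Fin m) ℝ) :
    op (∑ j ∈ s, X j) = ∑ j ∈ s, op (X j) := by
  classical
  induction s using Finset.induction_on with
  | empty =>
    have : toC (0 : Matrix (Fin m) (Fin m) ℝ) = 0 := by ext; simp [toC]
    simp [op, this]
  | insert a s ha ih => rw [Finset.sum_insert ha, Finset.sum_insert ha, op_add, ih]

lemma op_apply (X : Matrix (Fin m) (Fin m) ℝ) (x : Cm m) :
    op X x = WithLp.toLp 2 (toC X *ᵥ WithLp.ofLp x) := rfl

lemma inner_op_left (X : Matrix (Fin m) (Fin m) ℝ) (x y : Cm m) :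
    inner ℂ (op X x) y = inner ℂ x (op Xᵀ y) := by
  have h : op Xᵀ = ContinuousLinearMap.adjoint (op X) := by
    rw [← ContinuousLinearMap.star_eq_adjoint, op, op, ← map_star]
    congr 1
    ext i j
    simp [toC, Matrix.star_apply]
  rw [h, ContinuousLinearMap.adjoint_inner_right]

lemma continuousOn_op {X : Type*} [TopologicalSpace X] {s : Set X}
    {M : X → Matrix (Fin m) (Fin m) ℝ} (h : ∀ a b, ContinuousOn (fun x => M x a b) s) :
    ContinuousOn (fun x => op (M x)) s := by
  have h1 : Continuous (fun N : Matrix (Fin m) (Fin m) ℂ =>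
      (Matrix.toEuclideanCLM (𝕜 := ℂ) (n := Fin m) N : Cm m →L[ℂ] Cm m)) :=
    LinearMap.continuous_of_finiteDimensional
      ((Matrix.toEuclideanCLM (𝕜 := ℂ) (n := Fin m)).toAlgEquiv.toLinearMap)
  refine h1.comp_continuousOn ?_
  refine continuousOn_pi.2 fun a => continuousOn_pi.2 fun b => ?_
  exact Complex.continuous_ofReal.comp_continuousOn (h a b)

lemma form_ofLp (H : Matrix (Fin m) (Fin m) ℂ) (x : Cm m) :
    form H (WithLp.ofLp x) = qf (Matrix.toEuclideanCLM (𝕜 := ℂ) (n := Fin m) H) x := by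
  rw [form, qf, EuclideanSpace.inner_eq_star_dotProduct, dotProduct_comm]
  rfl

lemma form_toC (X : Matrix (Fin m) (Fin m) ℝ) (x : Cm m) :
    form (toC X) (WithLp.ofLp x) = qf (op X) x := form_ofLp _ _

lemma op_apply_eq_zero_iff (X : Matrix (Fin m) (Fin m) ℝ) (x : Cm m) :
    op X x = 0 ↔ WithLp.ofLp x ∈ kerC X := by
  rw [op_apply, kerC, LinearMap.mem_ker, Matrix.mulVecLin_apply]
  constructor
  · intro h
    simpa using congrArg WithLp.ofLp h
  · intro h
    rw [h]; rfl

lemma qf_op_transpose (X : Matrix (Fin m) (Fin m) ℝ) (x : Cm m) :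
    qf (op Xᵀ) x = qf (op X) x := by
  rw [qf, qf, ← inner_op_left, ← inner_conj_symm, Complex.conj_re]

lemma qf_op_symPart (X : Matrix (Fin m) (Fin m) ℝ) (x : Cm m) :
    qf (op (symPart X)) x = qf (op X) x := by
  rw [symPart, op_smul, qf_smul, op_add, qf_add, qf_op_transpose]
  ring

lemma qf_I_smul_op_transpose (X : Matrix (Fin m) (Fin m) ℝ) (x : Cm m) :
    qf (Complex.I • op Xᵀ) x = -qf (Complex.I • op X) x := by
  simp only [qf, _root_.smul_apply, inner_smul_right, ← inner_op_left]
  have := congrArg Complex.im (inner_conj_symm x (op X x))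
  simp only [Complex.conj_im] at this
  simp only [Complex.mul_re, Complex.I_re, Complex.I_im]
  linarith

/-- The symmetric part multiplied by i is skew-Hermitian, so it does not contribute to the real part
of the form. -/
lemma qf_I_smul_op_skewPart (X : Matrix (Fin m) (Fin m) ℝ) (x : Cm m) :
    qf (Complex.I • op (skewPart X)) x = qf (Complex.I • op X) x := by
  rw [skewPart, op_smul, smul_comm, qf_smul, op_sub, smul_sub, qf_sub, qf_I_smul_op_transpose]
  ring

lemma transpose_symPart (X : Matrix (Fin m) (Fin m) ℝ) : (symPart X)ᵀ = symPart X := by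
  rw [symPart, transpose_smul, transpose_add, transpose_transpose, add_comm]

/-! ### The generator on the Fourier side and the decay of its flow -/

/-- The generator `-(A⁰)⁻¹ (2πi A(ξ) + L)` of the system on the Fourier side. -/
def Coeffs.gen (c : Coeffs n m) (ξ : Rn n) : Cm m →L[ℂ] Cm m :=
  -(op c.A0⁻¹ ∘L (((2 * Real.pi : ℝ) * Complex.I : ℂ) • op (c.symbol ξ) + op c.L))

lemma Coeffs.symbol_smul (c : Coeffs n m) (r : ℝ) (ξ : Rn n) :
    c.symbol (r • ξ) = r • c.symbol ξ := by
  simp [Coeffs.symbol, Finset.smul_sum, smul_smul]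

lemma Coeffs.op_symbol (c : Coeffs n m) (ξ : Rn n) :
    op (c.symbol ξ) = ∑ j, ((ξ j : ℝ) : ℂ) • op (c.A j) := by
  simp [Coeffs.symbol, op_sum, op_smul]

lemma Coeffs.continuous_op_symbol (c : Coeffs n m) : Continuous fun ξ => op (c.symbol ξ) := by
  simp only [Coeffs.op_symbol]
  fun_prop

lemma Coeffs.continuous_gen (c : Coeffs n m) : Continuous c.gen := by
  unfold Coeffs.gen
  have := c.continuous_op_symbol
  fun_prop

lemma Coeffs.symbol_transpose {c : Coeffs n m} (h : c.CondA) (ξ : Rn n) :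
    (c.symbol ξ)ᵀ = c.symbol ξ := by
  simp [Coeffs.symbol, transpose_sum, h.A_symm]

/-- The symbol is linear in ξ. This growth is mild enough to be absorbed by Schwartz functions, and
it bounds the generator on balls of frequencies for the Grönwall argument. -/
lemma Coeffs.exists_norm_gen_le (c : Coeffs n m) :
    ∃ C > 0, ∀ ξ, ‖c.gen ξ‖ ≤ C * (1 + ‖ξ‖) := by
  refine ⟨‖op c.A0⁻¹‖ * (2 * Real.pi * ∑ j, ‖op (c.A j)‖ + ‖op c.L‖) + 1, by positivity,
    fun ξ => ?_⟩
  have h1 : ‖op (c.symbol ξ)‖ ≤ (∑ j, ‖op (c.A j)‖) * ‖ξ‖ := by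
    rw [c.op_symbol, Finset.sum_mul]
    refine (norm_sum_le _ _).trans (Finset.sum_le_sum fun j _ => ?_)
    rw [norm_smul, mul_comm]
    refine mul_le_mul_of_nonneg_left ?_ (norm_nonneg _)
    rw [Complex.norm_real]
    exact PiLp.norm_apply_le ξ j
  have h2 : ‖((2 * Real.pi : ℝ) * Complex.I : ℂ) • op (c.symbol ξ) + op c.L‖ ≤
      (2 * Real.pi * ∑ j, ‖op (c.A j)‖) * ‖ξ‖ + ‖op c.L‖ := by
    refine (norm_add_le _ _).trans (add_le_add ?_ le_rfl)
    rw [norm_smul, norm_mul, Complex.norm_I, Complex.norm_real, Real.norm_of_nonneg (by positivity)]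
    have := mul_le_mul_of_nonneg_left h1 (by positivity : (0:ℝ) ≤ 2 * Real.pi)
    linarith
  rw [Coeffs.gen, norm_neg]
  refine (ContinuousLinearMap.opNorm_comp_le _ _).trans ?_
  have h3 := mul_le_mul_of_nonneg_left h2 (norm_nonneg (op c.A0⁻¹))
  have h4 : 0 ≤ ‖op c.A0⁻¹‖ * (2 * Real.pi * ∑ j, ‖op (c.A j)‖) := by positivity
  have h5 : 0 ≤ ‖op c.A0⁻¹‖ * ‖op c.L‖ * ‖ξ‖ := by positivity
  nlinarith [norm_nonneg ξ]

lemma Coeffs.CondA.exists_coercive {c : Coeffs n m} (h : c.CondA) :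
    ∃ a > 0, ∀ x, a * ‖x‖ ^ 2 ≤ qf (op c.A0) x := by
  obtain ⟨a, ha, h1⟩ := exists_pos_le_qf (X := Unit) (s := Set.univ) isCompact_univ
    (T := fun _ => op c.A0) continuousOn_const ⊤ (by
      intro _ _ x _ hx
      rw [← form_toC]
      exact h.A0_pos _ trivial (by simpa using hx))
  exact ⟨a, ha, fun x => h1 () trivial x trivial⟩

lemma Coeffs.CondA.A0_mul_inv {c : Coeffs n m} (h : c.CondA) : c.A0 * c.A0⁻¹ = 1 := by
  refine Matrix.mul_nonsing_inv _ ?_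
  rw [isUnit_iff_ne_zero]
  intro h0
  obtain ⟨v, hv, hv0⟩ := Matrix.exists_mulVec_eq_zero_iff.2 h0
  have h1 := h.A0_pos (fun i => (v i : ℂ)) trivial (by
    intro h2; apply hv; ext i; simpa using congrFun h2 i)
  have h2 : toC c.A0 *ᵥ (fun i => (v i : ℂ)) = 0 := by
    ext i
    have := congrFun hv0 i
    simp only [toC, mulVec, dotProduct, Matrix.map_apply, Pi.zero_apply] at this ⊢
    exact_mod_cast this
  simp [form, h2] at h1

lemma Coeffs.CondA.op_A0_comp_gen {c : Coeffs n m} (h : c.CondA) (ξ : Rn n) :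
    op c.A0 ∘L c.gen ξ = -(((2 * Real.pi : ℝ) * Complex.I : ℂ) • op (c.symbol ξ) + op c.L) := by
  rw [Coeffs.gen, ContinuousLinearMap.comp_neg, ← ContinuousLinearMap.comp_assoc, ← op_mul,
    h.A0_mul_inv, op_one, ContinuousLinearMap.id_comp]

/-- The structural conditions imply the hypotheses of `exists_decay_of_symmetrizers`, with constants
uniform over directions because the unit sphere is compact and K and the symbol are continuous on
it. Each condition assumed on a kernel is extended through the projection onto that kernel. -/
lemma Coeffs.Dissipative.exists_symbol_decay {c : Coeffs n m} (hc : c.Dissipative) :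
    ∃ δ > 0, ∃ M > 0, ∀ (ν : Metric.sphere (0 : Rn n) 1) (s : ℝ), 0 ≤ s →
      ∀ Φ : Cm m →L[ℂ] Cm m,
      op c.A0 ∘L Φ = -(((s : ℂ) * Complex.I) • op (c.symbol ν) + op c.L) → ∀ v : ℝ → Cm m,
      (∀ t, HasDerivAt v (Φ (v t)) t) → ∀ t, 0 ≤ t →
        ‖v t‖ ≤ M * Real.exp (-(δ * (s ^ 2 / (1 + s ^ 2) ^ 2) * t)) * ‖v 0‖ := by
  obtain ⟨hA, ⟨K, hKsmooth, hK⟩, S, hS, hS1⟩ := hc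
  have hsph : ∀ ν : Metric.sphere (0 : Rn n) 1, ‖(ν : Rn n)‖ = 1 := fun ν => by simp
  have hcompact : IsCompact (Metric.sphere (0 : Rn n) 1) := isCompact_sphere 0 1
  have hKcont : ContinuousOn (fun ν : Rn n => op (K ν)) (Metric.sphere (0 : Rn n) 1) := by
    refine continuousOn_op fun a b => ?_
    have h1 : ContinuousOn (fun ξ : Rn n => K (‖ξ‖⁻¹ • ξ) a b) (Metric.sphere (0 : Rn n) 1) :=
      (hKsmooth a b).continuousOn.mono fun x hx => by
        rintro rfl; simp at hx
    refine h1.congr fun x hx => ?_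
    have : ‖x‖ = 1 := by simpa using hx
    simp [this]
  obtain ⟨BK, hBK⟩ := hcompact.exists_bound_of_continuousOn hKcont
  obtain ⟨BA, hBA⟩ := hcompact.exists_bound_of_continuousOn c.continuous_op_symbol.continuousOn
  have hBK' : ∀ ν : Metric.sphere (0 : Rn n) 1, ‖op (K ν)‖ ≤ |BK| :=
    fun ν => (hBK ν ν.2).trans (le_abs_self _)
  have hBA' : ∀ ν : Metric.sphere (0 : Rn n) 1, ‖op (c.symbol ν)‖ ≤ |BA| :=
    fun ν => (hBA ν ν.2).trans (le_abs_self _)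
  obtain ⟨a, ha, hpos⟩ := hA.exists_coercive
  have hLq : ∀ x, 0 ≤ qf (op c.L) x := fun x => by
    rw [← qf_op_symPart, ← form_toC]; exact hA.L_nonneg _ trivial
  have hSLq : ∀ x, qf (op (symPart (S * c.L) + symPart c.L)) x =
      qf (op S ∘L op c.L) x + qf (op c.L) x := fun x => by
    rw [op_add, qf_add, qf_op_symPart, qf_op_symPart, op_mul]
  have hSL0 : ∀ x, 0 ≤ qf (op S ∘L op c.L) x + qf (op c.L) x := fun x => by
    rw [← hSLq, ← form_toC]; exact hS.nonneg _ trivial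
  obtain ⟨C1, hC1, hker1⟩ := exists_ker_decomposition (T := op (symPart c.L))
    (fun x y => by rw [inner_op_left, transpose_symPart])
    (fun x => by rw [qf_op_symPart]; exact hLq x)
  obtain ⟨C2, hC2, hker2⟩ := exists_ker_decomposition
    (T := op (symPart (S * c.L) + symPart c.L))
    (fun x y => by rw [inner_op_left, transpose_add, transpose_symPart, transpose_symPart])
    (fun x => by rw [hSLq]; exact hSL0 x)
  obtain ⟨k0, hk0, hKpos⟩ := exists_pos_le_qf hcompact
    (T := fun ν => op (K ν) ∘L op (c.symbol ν))
    (hKcont.clm_comp c.continuous_op_symbol.continuousOn) (LinearMap.ker (op c.L).toLinearMap) (by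
      intro ν hν x hx hx0
      have h1 := (hK ν (by simpa using hν)).2.2 (WithLp.ofLp x)
        ((op_apply_eq_zero_iff _ _).1 hx) (by simpa using hx0)
      rwa [form_toC, qf_op_symPart, op_mul] at h1)
  set P := |BK| * |BA| with hP
  have hP0 : 0 ≤ P := by positivity
  -- One constant for three estimates: the summands with C1, C2² and C2 serve S A, K A and K L
  -- respectively, and the 1 makes it positive.
  set C := 1 + 2 * (‖op S‖ * |BA|) * C1 + (k0 + 2 * P ^ 2 / k0) * C2 ^ 2 +
    |BK| * ‖op c.L‖ * C2 with hCdef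
  have t1 : 0 ≤ 2 * (‖op S‖ * |BA|) * C1 := by positivity
  have t2 : 0 ≤ (k0 + 2 * P ^ 2 / k0) * C2 ^ 2 := by positivity
  have t3 : 0 ≤ |BK| * ‖op c.L‖ * C2 := by positivity
  refine exists_decay_of_symmetrizers (op c.A0) (op c.L) (op S)
    (fun ν : Metric.sphere (0 : Rn n) 1 => op (c.symbol ν)) (fun ν => op (K ν)) (B := |BK| * ‖op c.A0‖) (C := C)
    (c := k0 / 2) ha (by linarith) (by positivity) ?_ hpos ?_ ?_ ?_ ?_ hLq hSL0 ?_ ?_ ?_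
  · intro x y
    rw [inner_op_left, hA.A0_symm]
  · intro x y
    rw [← ContinuousLinearMap.comp_apply, ← op_mul, inner_op_left, hS.symm, op_mul,
      ContinuousLinearMap.comp_apply]
  · intro ν x y
    rw [← ContinuousLinearMap.comp_apply, ← op_mul, inner_op_left, (hK ν (hsph ν)).2.1, op_neg,
      _root_.neg_apply, inner_neg_right, op_mul, ContinuousLinearMap.comp_apply]
  · intro ν
    exact (ContinuousLinearMap.opNorm_comp_le _ _).trans
      (mul_le_mul_of_nonneg_right (hBK' ν) (norm_nonneg _))
  · intro ν x
    have h1 := qf_I_smul_op_transpose (c.symbol ν) x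
    rw [c.symbol_transpose hA] at h1
    linarith
  · intro ν x
    -- Condition (S)₁ gives the sign at y in Ker L₁. Replacing x by y costs a multiple of ‖x‖‖x -
    -- y‖, and ‖x - y‖ is controlled by the square root of the form of L.
    obtain ⟨y, hy0, hyx, -, hxy⟩ := hker1 x
    rw [qf_op_symPart] at hxy
    have h1 : 0 ≤ qf (Complex.I • (op S ∘L op (c.symbol ν))) y := by
      have h2 := hS1 ν (hsph ν) (WithLp.ofLp y) ((op_apply_eq_zero_iff _ _).1 hy0)
      rw [form_ofLp, map_smul] at h2
      rw [← op_mul, ← qf_I_smul_op_skewPart]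
      exact h2
    have h2 := (abs_le.1 (abs_qf_sub_qf_le (Complex.I • (op S ∘L op (c.symbol ν))) hyx)).1
    have h3 : ‖Complex.I • (op S ∘L op (c.symbol ν))‖ ≤ ‖op S‖ * |BA| := by
      rw [norm_smul, Complex.norm_I, one_mul]
      exact (ContinuousLinearMap.opNorm_comp_le _ _).trans
        (mul_le_mul_of_nonneg_left (hBA' ν) (norm_nonneg _))
    have h4 : 2 * ‖Complex.I • (op S ∘L op (c.symbol ν))‖ * ‖x‖ * ‖x - y‖ ≤
        2 * (‖op S‖ * |BA|) * ‖x‖ * (C1 * √(qf (op c.L) x)) := by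
      gcongr
    have h5 : 2 * (‖op S‖ * |BA|) * ‖x‖ * (C1 * √(qf (op c.L) x)) ≤
        C * ‖x‖ * √(qf (op c.L) x) := by
      have : 2 * (‖op S‖ * |BA|) * C1 ≤ C := by linarith
      calc _ = 2 * (‖op S‖ * |BA|) * C1 * (‖x‖ * √(qf (op c.L) x)) := by ring
        _ ≤ C * (‖x‖ * √(qf (op c.L) x)) := mul_le_mul_of_nonneg_right this (by positivity)
        _ = _ := by ring
    linarith
  · intro ν x
    -- By (S) the vector y lies in Ker L, where K is coercive with constant k0. Pythagoras trades
    -- ‖y‖² for ‖x‖² - ‖x - y‖², and Young's inequality spends half of k0 on the cross term, which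
    -- leaves k0 / 2.
    obtain ⟨y, hy0, hyx, hsum, hxy⟩ := hker2 x
    rw [hSLq] at hxy
    have hLy : op c.L y = 0 := by
      rw [op_apply_eq_zero_iff, ← hS.ker_eq, ← op_apply_eq_zero_iff]; exact hy0
    have h1 : k0 * ‖y‖ ^ 2 ≤ qf (op (K ν) ∘L op (c.symbol ν)) y := hKpos ν ν.2 y hLy
    have h2 := (abs_le.1 (abs_qf_sub_qf_le (op (K ν) ∘L op (c.symbol ν)) hyx)).1
    have h3 : ‖op (K ν) ∘L op (c.symbol ν)‖ ≤ P :=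
      (ContinuousLinearMap.opNorm_comp_le _ _).trans
        (mul_le_mul (hBK' ν) (hBA' ν) (norm_nonneg _) (abs_nonneg _))
    have h4 : 2 * ‖op (K ν) ∘L op (c.symbol ν)‖ * ‖x‖ * ‖x - y‖ ≤ 2 * P * ‖x‖ * ‖x - y‖ := by
      gcongr
    have h5 : 2 * P * ‖x‖ * ‖x - y‖ ≤ k0 / 2 * ‖x‖ ^ 2 + 2 * P ^ 2 / k0 * ‖x - y‖ ^ 2 := by
      have : k0 / 2 * ‖x‖ ^ 2 + 2 * P ^ 2 / k0 * ‖x - y‖ ^ 2 - 2 * P * ‖x‖ * ‖x - y‖ =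
        (k0 * ‖x‖ - 2 * P * ‖x - y‖) ^ 2 / (2 * k0) := by field_simp; ring
      have h6 : 0 ≤ (k0 * ‖x‖ - 2 * P * ‖x - y‖) ^ 2 / (2 * k0) := by positivity
      linarith
    have h6 : ‖x - y‖ ^ 2 ≤ C2 ^ 2 * (qf (op S ∘L op c.L) x + qf (op c.L) x) := by
      have := pow_le_pow_left₀ (norm_nonneg _) hxy 2
      rwa [mul_pow, Real.sq_sqrt (hSL0 x)] at this
    have h7 : (k0 + 2 * P ^ 2 / k0) * ‖x - y‖ ^ 2 ≤
        C * (qf (op S ∘L op c.L) x + qf (op c.L) x) := by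
      calc _ ≤ (k0 + 2 * P ^ 2 / k0) * (C2 ^ 2 * (qf (op S ∘L op c.L) x + qf (op c.L) x)) :=
            mul_le_mul_of_nonneg_left h6 (by positivity)
        _ = (k0 + 2 * P ^ 2 / k0) * C2 ^ 2 * (qf (op S ∘L op c.L) x + qf (op c.L) x) := by ring
        _ ≤ _ := mul_le_mul_of_nonneg_right (by linarith) (hSL0 x)
    nlinarith
  · intro ν x
    -- L annihilates y, so only x - y, which the dissipation controls, contributes.
    obtain ⟨y, hy0, hyx, hsum, hxy⟩ := hker2 x
    rw [hSLq] at hxy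
    have hLy : op c.L y = 0 := by
      rw [op_apply_eq_zero_iff, ← hS.ker_eq, ← op_apply_eq_zero_iff]; exact hy0
    have h1 : qf (Complex.I • (op (K ν) ∘L op c.L)) x =
        (inner ℂ x (Complex.I • (op (K ν) (op c.L (x - y))))).re := by
      simp [qf, hLy]
    rw [h1]
    calc _ ≤ ‖inner ℂ x (Complex.I • (op (K ν) (op c.L (x - y))))‖ := Complex.re_le_norm _
      _ ≤ ‖x‖ * ‖Complex.I • (op (K ν) (op c.L (x - y)))‖ := norm_inner_le_norm _ _
      _ ≤ ‖x‖ * (|BK| * (‖op c.L‖ * (C2 * √(qf (op S ∘L op c.L) x + qf (op c.L) x)))) := by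
          refine mul_le_mul_of_nonneg_left ?_ (norm_nonneg _)
          rw [norm_smul, Complex.norm_I, one_mul]
          refine ((op (K ν)).le_opNorm _).trans (mul_le_mul (hBK' ν) ?_ (norm_nonneg _)
            (abs_nonneg _))
          exact ((op c.L).le_opNorm _).trans (mul_le_mul_of_nonneg_left hxy (norm_nonneg _))
      _ = |BK| * ‖op c.L‖ * C2 * (‖x‖ * √(qf (op S ∘L op c.L) x + qf (op c.L) x)) := by ring
      _ ≤ C * (‖x‖ * √(qf (op S ∘L op c.L) x + qf (op c.L) x)) :=
          mul_le_mul_of_nonneg_right (by linarith) (by positivity)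
      _ = _ := by ring

/-- The evolution operator `exp(t Φ(ξ))` on the Fourier side. -/
def Coeffs.flow (c : Coeffs n m) (t : ℝ) (ξ : Rn n) : Cm m →L[ℂ] Cm m :=
  NormedSpace.exp (t • c.gen ξ)

lemma Coeffs.flow_zero (c : Coeffs n m) (ξ : Rn n) : c.flow 0 ξ = 1 := by
  have h : (0 : ℝ) • c.gen ξ = 0 := zero_smul ℝ (c.gen ξ)
  rw [Coeffs.flow, h, NormedSpace.exp_zero]

lemma Coeffs.continuous_flow (c : Coeffs n m) :
    Continuous fun p : ℝ × Rn n => c.flow p.1 p.2 := by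
  have h := c.continuous_gen
  let _ : NormedAlgebra ℚ (Cm m →L[ℂ] Cm m) := NormedAlgebra.restrictScalars ℚ ℂ _
  have : Continuous (NormedSpace.exp : (Cm m →L[ℂ] Cm m) → (Cm m →L[ℂ] Cm m)) :=
    NormedSpace.exp_continuous
  exact this.comp (continuous_fst.smul (h.comp continuous_snd))

lemma Coeffs.hasDerivAt_flow_apply (c : Coeffs n m) (ξ : Rn n) (x : Cm m) (t : ℝ) :
    HasDerivAt (fun s => c.flow s ξ x) (c.gen ξ (c.flow t ξ x)) t := by
  have h := hasDerivAt_exp_smul_const' (𝕂 := ℝ) (c.gen ξ) t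
  exact (ContinuousLinearMap.apply ℂ (Cm m) x |>.restrictScalars ℝ).hasFDerivAt.comp_hasDerivAt t h

/-- Pointwise decay of the evolution operator, of regularity-loss type. -/
theorem Coeffs.Dissipative.exists_norm_flow_le (hn : 1 ≤ n) {c : Coeffs n m}
    (hc : c.Dissipative) :
    ∃ δ > 0, ∃ M > 0, ∀ ξ t, 0 ≤ t →
      ‖c.flow t ξ‖ ≤ M * Real.exp (-(δ * (‖ξ‖ ^ 2 / (1 + ‖ξ‖ ^ 2) ^ 2) * t)) := by
  obtain ⟨δ, hδ, M, hM, h⟩ := hc.exists_symbol_decay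
  -- The 2π of the Fourier convention makes s = 2π‖ξ‖. Since 1 + s² ≤ (2π)²(1 + ‖ξ‖²), the rate in s
  -- dominates (2π)⁻² times the rate in ‖ξ‖.
  refine ⟨δ / (2 * Real.pi) ^ 2, by positivity, M, hM, fun ξ t ht => ?_⟩
  obtain ⟨ν, hν⟩ : ∃ ν : Metric.sphere (0 : Rn n) 1, ‖ξ‖ • (ν : Rn n) = ξ := by
    -- At ξ = 0 any direction will do, and one exists because n ≥ 1.
    rcases eq_or_ne ξ 0 with rfl | h0
    · refine ⟨⟨EuclideanSpace.single (⟨0, hn⟩ : Fin n) 1, by simp⟩, by simp⟩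
    · have : ‖ξ‖ ≠ 0 := norm_ne_zero_iff.2 h0
      refine ⟨⟨‖ξ‖⁻¹ • ξ, by simp [norm_smul, this]⟩, by simp [smul_smul, this]⟩
  refine ContinuousLinearMap.opNorm_le_bound _ (by positivity) fun x => ?_
  have h1 := h ν (2 * Real.pi * ‖ξ‖) (by positivity) (c.gen ξ) (by
      rw [hc.1.op_A0_comp_gen]
      conv_lhs => rw [← hν, c.symbol_smul, op_smul]
      rw [smul_smul]
      congr 3
      push_cast; ring) (fun s => c.flow s ξ x) (c.hasDerivAt_flow_apply ξ x) t ht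
  simp only [c.flow_zero, one_apply_eq_self] at h1
  refine h1.trans (mul_le_mul_of_nonneg_right (mul_le_mul_of_nonneg_left (Real.exp_le_exp.2
    (neg_le_neg (mul_le_mul_of_nonneg_right ?_ ht))) hM.le) (norm_nonneg _))
  have hpi : 1 ≤ (2 * Real.pi) ^ 2 := by nlinarith [Real.pi_gt_three]
  set r := ‖ξ‖
  have h2 : (1 + (2 * Real.pi * r) ^ 2) ≤ (2 * Real.pi) ^ 2 * (1 + r ^ 2) := by
    rw [mul_pow]; nlinarith
  have h3 : (1 + (2 * Real.pi * r) ^ 2) ^ 2 ≤ ((2 * Real.pi) ^ 2 * (1 + r ^ 2)) ^ 2 :=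
    pow_le_pow_left₀ (by positivity) h2 2
  calc δ / (2 * Real.pi) ^ 2 * (r ^ 2 / (1 + r ^ 2) ^ 2)
      = δ * ((2 * Real.pi * r) ^ 2 / ((2 * Real.pi) ^ 2 * (1 + r ^ 2)) ^ 2) := by
        field_simp
    _ ≤ _ := by gcongr

end HypSys

namespace HypSys

open SchwartzMap FourierTransform LineDeriv

/-! ### Density of test functions in the Schwartz space -/

section TestFunctions

variable {V : Type*} [NormedAddCommGroup V] [InnerProductSpace ℝ V]

/-- A real test function as a complex Schwartz function. -/
def testFun (φ : V → ℝ) (h₁ : ContDiff ℝ ∞ φ) (h₂ : HasCompactSupport φ) : 𝓢(V, ℂ) :=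
  HasCompactSupport.toSchwartzMap (f := fun x => (φ x : ℂ))
    (h₂.comp_left (g := Complex.ofReal) Complex.ofReal_zero) (Complex.ofRealCLM.contDiff.comp h₁)

@[simp] lemma testFun_apply (φ : V → ℝ) (h₁ : ContDiff ℝ ∞ φ) (h₂ : HasCompactSupport φ) (x : V) :
    testFun φ h₁ h₂ x = (φ x : ℂ) := rfl

end TestFunctions

section Density

variable {V : Type*} [NormedAddCommGroup V] [InnerProductSpace ℝ V] [FiniteDimensional ℝ V]

/-- A smooth cutoff equal to `1` near the ball of radius `1`. -/
def cutoff (V : Type*) [NormedAddCommGroup V] [InnerProductSpace ℝ V] [FiniteDimensional ℝ V] :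
    ContDiffBump (0 : V) := ⟨1, 2, one_pos, one_lt_two⟩

/-- The dilated cutoff `x ↦ χ(x / R)`. -/
def cutoffAt (R : ℝ) (x : V) : ℝ := cutoff V (R⁻¹ • x)

lemma contDiff_cutoffAt (R : ℝ) : ContDiff ℝ ∞ (cutoffAt R : V → ℝ) :=
  (cutoff V).contDiff.comp (contDiff_const_smul _)

lemma hasCompactSupport_cutoffAt {R : ℝ} (hR : 0 < R) :
    HasCompactSupport (cutoffAt R : V → ℝ) :=
  (cutoff V).hasCompactSupport.comp_homeomorph (Homeomorph.smulOfNeZero R⁻¹ (by positivity))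

lemma one_sub_cutoffAt_eventuallyEq {R : ℝ} (hR : 0 < R) {x : V} (hx : ‖x‖ < R) :
    (fun y : V => 1 - cutoffAt R y) =ᶠ[𝓝 x] fun _ => 0 := by
  have : ∀ᶠ y : V in 𝓝 x, ‖y‖ < R := continuous_norm.continuousAt.eventually_lt
    continuousAt_const hx
  filter_upwards [this] with y hy
  have h1 : (cutoff V) (R⁻¹ • y) = 1 := by
    apply (cutoff V).one_of_mem_closedBall
    rw [mem_closedBall_zero_iff, norm_smul, norm_inv, Real.norm_of_nonneg hR.le]
    change R⁻¹ * ‖y‖ ≤ 1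
    rw [inv_mul_le_iff₀ hR]; linarith
  simp [cutoffAt, h1]

/-- Each derivative of the dilated cutoff brings a factor R⁻¹ ≤ 1, so the bound at R = 1 holds for
all larger R. -/
lemma exists_bound_iteratedFDeriv_one_sub_cutoffAt (i : ℕ) :
    ∃ M, 0 ≤ M ∧ ∀ R : ℝ, 1 ≤ R → ∀ x : V,
      ‖iteratedFDeriv ℝ i (fun y : V => 1 - cutoffAt R y) x‖ ≤ M := by
  set g : V → ℝ := fun y => 1 - cutoff V y with hg
  have hgs : ContDiff ℝ ∞ g := contDiff_const.sub (cutoff V).contDiff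
  obtain ⟨M, hM⟩ : ∃ M, ∀ x, ‖iteratedFDeriv ℝ i g x‖ ≤ M := by
    have h1 : Continuous (fun x => iteratedFDeriv ℝ i (cutoff V) x) :=
      ((cutoff V).contDiff (n := ⊤)).continuous_iteratedFDeriv (mod_cast le_top)
    obtain ⟨M, hM⟩ := h1.bounded_above_of_compact_support
      ((cutoff V).hasCompactSupport.iteratedFDeriv i)
    refine ⟨1 + M, fun x => ?_⟩
    have h2 : iteratedFDeriv ℝ i g x =
        iteratedFDeriv ℝ i (fun _ : V => (1 : ℝ)) x - iteratedFDeriv ℝ i (cutoff V) x := by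
      rw [hg]
      exact iteratedFDeriv_sub_apply contDiff_const.contDiffAt
        ((cutoff V).contDiff.contDiffAt)
    rw [h2]
    refine (norm_sub_le _ _).trans (add_le_add ?_ (hM x))
    rcases Nat.eq_zero_or_pos i with rfl | hi
    · simp
    · simp [iteratedFDeriv_const_of_ne hi.ne']
  refine ⟨M, (norm_nonneg _).trans (hM 0), fun R hR x => ?_⟩
  have h3 : (fun y : V => 1 - cutoffAt R y) = fun y => g (R⁻¹ • y) := rfl
  rw [h3, iteratedFDeriv_comp_const_smul _ (hgs.of_le (mod_cast le_top)), norm_smul, norm_pow,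
    norm_inv, Real.norm_of_nonneg (by linarith)]
  have h4 : R⁻¹ ^ i ≤ 1 := pow_le_one₀ (by positivity) (inv_le_one_of_one_le₀ hR)
  calc _ ≤ 1 * ‖iteratedFDeriv ℝ i g (R⁻¹ • x)‖ :=
        mul_le_mul_of_nonneg_right h4 (norm_nonneg _)
    _ ≤ M := by rw [one_mul]; exact hM _

/-- The truncation `χ(x / R) ψ(x)` of a Schwartz function. -/
def truncate {R : ℝ} (hR : 0 < R) (ψ : 𝓢(V, ℂ)) : 𝓢(V, ℂ) :=
  HasCompactSupport.toSchwartzMap (f := fun x => cutoffAt R x • ψ x)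
    ((hasCompactSupport_cutoffAt hR).smul_right) ((contDiff_cutoffAt R).smul (ψ.smooth ⊤))

/-- The truncation error vanishes for ‖x‖ < R. Elsewhere a factor R is at most ‖x‖, so one more
power of decay of ψ gains 1 / R. -/
lemma exists_seminorm_sub_truncate_le (k j : ℕ) (ψ : 𝓢(V, ℂ)) :
    ∃ C, ∀ R : ℝ, ∀ hR : 1 ≤ R,
      SchwartzMap.seminorm ℂ k j (truncate (zero_lt_one.trans_le hR) ψ - ψ) ≤ C / R := by
  choose M hM0 hM using exists_bound_iteratedFDeriv_one_sub_cutoffAt (V := V)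
  set C := ∑ i ∈ Finset.range (j + 1), (j.choose i : ℝ) * M i *
    SchwartzMap.seminorm ℂ (k + 1) (j - i) ψ with hC
  have hC0 : 0 ≤ C := Finset.sum_nonneg fun i _ =>
    mul_nonneg (mul_nonneg (by positivity) (hM0 i)) (apply_nonneg _ _)
  refine ⟨C, fun R hR => ?_⟩
  have hR0 : 0 < R := zero_lt_one.trans_le hR
  refine SchwartzMap.seminorm_le_bound ℂ k j _ (by positivity) fun x => ?_
  have h1 : ‖iteratedFDeriv ℝ j (truncate hR0 ψ - ψ) x‖ =
      ‖iteratedFDeriv ℝ j (fun y => (1 - cutoffAt R y) • ψ y) x‖ := by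
    have : ((truncate hR0 ψ - ψ : 𝓢(V, ℂ)) : V → ℂ) =
        -fun y => (1 - cutoffAt R y) • ψ y := by
      ext y
      simp [truncate]
      ring
    rw [this, iteratedFDeriv_neg_apply, norm_neg]
  rw [h1]
  rcases lt_or_ge ‖x‖ R with hx | hx
  · have h2 : (fun y => (1 - cutoffAt R y) • ψ y) =ᶠ[𝓝 x] fun _ => (0 : ℂ) := by
      filter_upwards [one_sub_cutoffAt_eventuallyEq hR0 hx] with y hy
      rw [hy, zero_smul]
    have h3 := (h2.iteratedFDeriv ℝ j).eq_of_nhds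
    rw [h3]
    simp only [iteratedFDeriv_fun_zero, Pi.zero_apply, norm_zero, mul_zero]
    positivity
  · have h2 := norm_iteratedFDeriv_smul_le (𝕜 := ℝ) (f := fun y : V => 1 - cutoffAt R y)
      (g := ψ) (N := ∞) (contDiff_const.sub (contDiff_cutoffAt R)) (ψ.smooth ⊤) x (n := j)
      (mod_cast le_top)
    rw [le_div_iff₀ hR0]
    calc ‖x‖ ^ k * ‖iteratedFDeriv ℝ j (fun y => (1 - cutoffAt R y) • ψ y) x‖ * R
        ≤ ‖x‖ ^ k * (∑ i ∈ Finset.range (j + 1), (j.choose i : ℝ) *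
          ‖iteratedFDeriv ℝ i (fun y : V => 1 - cutoffAt R y) x‖ *
          ‖iteratedFDeriv ℝ (j - i) ψ x‖) * ‖x‖ := by gcongr
      _ = ∑ i ∈ Finset.range (j + 1), (j.choose i : ℝ) *
          ‖iteratedFDeriv ℝ i (fun y : V => 1 - cutoffAt R y) x‖ *
          (‖x‖ ^ (k + 1) * ‖iteratedFDeriv ℝ (j - i) ψ x‖) := by
          rw [Finset.mul_sum, Finset.sum_mul]
          refine Finset.sum_congr rfl fun i _ => ?_
          ring
      _ ≤ C := by
          refine Finset.sum_le_sum fun i _ => ?_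
          refine mul_le_mul (mul_le_mul_of_nonneg_left (hM i R hR x) (by positivity))
            (SchwartzMap.le_seminorm ℂ _ _ ψ x) (by positivity)
            (mul_nonneg (by positivity) (hM0 i))

lemma tendsto_truncate (ψ : 𝓢(V, ℂ)) :
    Tendsto (fun N : ℕ => truncate (Nat.cast_add_one_pos N : (0 : ℝ) < N + 1) ψ) atTop (𝓝 ψ) := by
  rw [(schwartz_withSeminorms ℂ V ℂ).tendsto_nhds_atTop]
  rintro ⟨k, j⟩ ε hε
  obtain ⟨C, hC⟩ := exists_seminorm_sub_truncate_le k j ψ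
  have h1 : Tendsto (fun N : ℕ => C * (1 / ((N : ℝ) + 1))) atTop (𝓝 0) := by
    simpa using tendsto_one_div_add_atTop_nhds_zero_nat.const_mul C
  obtain ⟨N0, hN0⟩ := (h1.eventually_lt_const hε).exists_forall_of_atTop
  refine ⟨N0, fun N hN => ?_⟩
  have h2 := hC (N + 1) (by linarith [Nat.cast_nonneg (α := ℝ) N])
  refine lt_of_le_of_lt h2 ?_
  rw [div_eq_mul_one_div]
  exact hN0 N hN

/-- A continuous functional on the Schwartz space that vanishes on real test functions is zero. -/
lemma eq_zero_of_testFun {F : Type*} [NormedAddCommGroup F] [NormedSpace ℂ F]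
    (T : 𝓢(V, ℂ) → F) (hT : Continuous T) (hadd : ∀ f g, T (f + g) = T f + T g)
    (hsmul : ∀ (a : ℂ) f, T (a • f) = a • T f)
    (h : ∀ φ h₁ h₂, T (testFun φ h₁ h₂) = 0) (ψ : 𝓢(V, ℂ)) : T ψ = 0 := by
  have h0 : ∀ N : ℕ, T (truncate (Nat.cast_add_one_pos N : (0 : ℝ) < N + 1) ψ) = 0 := by
    intro N
    have hR : (0 : ℝ) < N + 1 := Nat.cast_add_one_pos N
    have hc := hasCompactSupport_cutoffAt (V := V) hR
    have hs := contDiff_cutoffAt (V := V) (N + 1)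
    -- Test functions are real, so the truncation is split into its real and imaginary parts.
    have e : truncate hR ψ =
        testFun (fun x => cutoffAt (N + 1) x * (ψ x).re)
          (hs.mul (Complex.reCLM.contDiff.comp (ψ.smooth ⊤))) hc.mul_right +
        Complex.I • testFun (fun x => cutoffAt (N + 1) x * (ψ x).im)
          (hs.mul (Complex.imCLM.contDiff.comp (ψ.smooth ⊤))) hc.mul_right := by
      ext x
      simp only [truncate, HasCompactSupport.toSchwartzMap_toFun, _root_.add_apply,
        _root_.smul_apply, testFun_apply, Complex.ofReal_mul, Complex.real_smul, smul_eq_mul]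
      conv_lhs => rw [← Complex.re_add_im (ψ x)]
      ring
    rw [e, hadd, hsmul, h, h, smul_zero, add_zero]
  have h1 := (hT.tendsto ψ).comp (tendsto_truncate ψ)
  exact tendsto_nhds_unique h1 (by simp only [Function.comp_def, h0]; exact tendsto_const_nhds)

end Density

end HypSys

namespace HypSys

open SchwartzMap FourierTransform LineDeriv

variable {n m : ℕ}

/-! ### The Fourier transform of functions -/

lemma ae_eq_of_testFun {f g : Rn n → Cm m} (hf : LocallyIntegrable f volume)
    (hg : LocallyIntegrable g volume)
    (h : ∀ φ h₁ h₂, ∫ x, testFun φ h₁ h₂ x • f x = ∫ x, testFun φ h₁ h₂ x • g x) :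
    f =ᵐ[volume] g := by
  refine ae_eq_of_integral_contDiff_smul_eq hf hg fun φ h₁ h₂ => ?_
  simpa using h φ h₁ h₂

/-- `u` is the Fourier transform of `f` in the sense of tempered distributions. -/
def IsFourierPair (f u : Rn n → Cm m) : Prop :=
  ∀ φ : 𝓢(Rn n, ℂ), ∫ x, φ x • f x = ∫ ξ, (𝓕⁻ φ) ξ • u ξ

/-- The inverse Fourier transform in `L²`. -/
def invFourier {u : Rn n → Cm m} (hu : MemLp u 2 volume) : Rn n → Cm m :=
  ((𝓕⁻ (hu.toLp u) : Lp (Cm m) 2 (volume : Measure (Rn n))) : Rn n → Cm m)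

lemma memLp_invFourier {u : Rn n → Cm m} (hu : MemLp u 2 volume) :
    MemLp (invFourier hu) 2 volume := Lp.memLp _

lemma norm_fourierInv_Lp (f : Lp (Cm m) 2 (volume : Measure (Rn n))) : ‖𝓕⁻ f‖ = ‖f‖ :=
  (Lp.fourierTransformₗᵢ (Rn n) (Cm m)).symm.norm_map f

lemma eLpNorm_invFourier {u : Rn n → Cm m} (hu : MemLp u 2 volume) :
    eLpNorm (invFourier hu) 2 volume = eLpNorm u 2 volume := by
  have h := norm_fourierInv_Lp (hu.toLp u)
  rw [Lp.norm_def, Lp.norm_def, ENNReal.toReal_eq_toReal_iff' (Lp.eLpNorm_ne_top _)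
    (Lp.eLpNorm_ne_top _)] at h
  rw [invFourier, h]
  exact eLpNorm_congr_ae hu.coeFn_toLp

lemma invFourier_congr {u v : Rn n → Cm m} (hu : MemLp u 2 volume) (hv : MemLp v 2 volume)
    (h : u =ᵐ[volume] v) : invFourier hu = invFourier hv := by
  rw [invFourier, invFourier, (MemLp.toLp_eq_toLp_iff hu hv).2 h]

lemma invFourier_add {u v : Rn n → Cm m} (hu : MemLp u 2 volume) (hv : MemLp v 2 volume) :
    invFourier (hu.add hv) =ᵐ[volume] invFourier hu + invFourier hv := by
  rw [invFourier, MemLp.toLp_add, fourierInv_add]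
  exact Lp.coeFn_add _ _

lemma invFourier_sub {u v : Rn n → Cm m} (hu : MemLp u 2 volume) (hv : MemLp v 2 volume) :
    invFourier (hu.sub hv) =ᵐ[volume] invFourier hu - invFourier hv := by
  have : 𝓕⁻ (hu.toLp u - hv.toLp v) = 𝓕⁻ (hu.toLp u) - 𝓕⁻ (hv.toLp v) :=
    map_sub (Lp.fourierTransformₗᵢ (Rn n) (Cm m)).symm _ _
  rw [invFourier, MemLp.toLp_sub hu hv, this]
  exact Lp.coeFn_sub _ _

lemma fourierPair_Lp (u : Lp (Cm m) 2 (volume : Measure (Rn n))) :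
    IsFourierPair ((𝓕⁻ u : Lp (Cm m) 2 (volume : Measure (Rn n))) : Rn n → Cm m) u := by
  intro φ
  have h := DFunLike.congr_fun (Lp.fourierInv_toTemperedDistribution_eq u) φ
  rw [TemperedDistribution.fourierInv_apply, Lp.toTemperedDistribution_apply,
    Lp.toTemperedDistribution_apply] at h
  exact h.symm

lemma fourierPair_invFourier {u : Rn n → Cm m} (hu : MemLp u 2 volume) :
    IsFourierPair (invFourier hu) u := by
  intro φ
  rw [invFourier, fourierPair_Lp]
  refine integral_congr_ae ?_
  filter_upwards [hu.coeFn_toLp] with x hx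
  rw [hx]

lemma integrable_schwartz_smul {p : ℝ≥0∞} (hp : 1 ≤ p) {f : Rn n → Cm m}
    (hf : MemLp f p volume) (φ : 𝓢(Rn n, ℂ)) : Integrable (fun x => φ x • f x) volume := by
  have h1 : MemLp φ (1 - p⁻¹)⁻¹ volume := φ.memLp _ _
  have : ENNReal.HolderConjugate (1 - p⁻¹)⁻¹ p := by
    rw [ENNReal.holderConjugate_iff, inv_inv]
    exact tsub_add_cancel_of_le (ENNReal.inv_le_one.2 hp)
  exact memLp_one_iff_integrable.1 (hf.smul h1)

lemma continuous_integral_schwartz_smul {p : ℝ≥0∞} (hp : 1 ≤ p) {f : Rn n → Cm m}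
    (hf : MemLp f p volume) : Continuous fun φ : 𝓢(Rn n, ℂ) => ∫ x, φ x • f x := by
  have : Fact (1 ≤ p) := ⟨hp⟩
  have h : (fun φ : 𝓢(Rn n, ℂ) => ∫ x, φ x • f x) =
      fun φ => Lp.toTemperedDistribution (hf.toLp f) φ := by
    ext1 φ
    rw [Lp.toTemperedDistribution_apply]
    refine integral_congr_ae ?_
    filter_upwards [hf.coeFn_toLp] with x hx
    rw [hx]
  rw [h]
  exact (Lp.toTemperedDistribution (hf.toLp f)).continuous

/-- `u` is the sum of a bounded and a square integrable function. -/
def BddAddL2 (u : Rn n → Cm m) : Prop :=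
  ∃ u₁ u₂ : Rn n → Cm m, MemLp u₁ ⊤ volume ∧ MemLp u₂ 2 volume ∧ u = u₁ + u₂

lemma BddAddL2.locallyIntegrable {u : Rn n → Cm m} (hu : BddAddL2 u) :
    LocallyIntegrable u volume := by
  obtain ⟨u₁, u₂, h1, h2, rfl⟩ := hu
  exact (h1.locallyIntegrable le_top).add (h2.locallyIntegrable (by norm_num))

lemma BddAddL2.memLp_indicator {u : Rn n → Cm m} (hu : BddAddL2 u) {s : Set (Rn n)}
    (hs : MeasurableSet s) (hs' : volume s ≠ ⊤) : MemLp (s.indicator u) 2 volume := by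
  obtain ⟨u₁, u₂, h1, h2, rfl⟩ := hu
  rw [Set.indicator_add']
  refine MemLp.add ?_ (h2.indicator hs)
  rw [memLp_indicator_iff_restrict hs]
  have : IsFiniteMeasure (volume.restrict s) := ⟨by simpa using hs'.lt_top⟩
  exact (h1.restrict s).mono_exponent le_top

lemma integral_fourierInv_smul_eq_fourierInv {u : Rn n → Cm m} (hu : Integrable u volume)
    (φ : 𝓢(Rn n, ℂ)) : ∫ x, φ x • 𝓕⁻ u x = ∫ ξ, (𝓕⁻ φ) ξ • u ξ := by
  have h := VectorFourier.integral_bilin_fourierIntegral_eq_flip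
    (ContinuousLinearMap.lsmul ℂ ℂ : ℂ →L[ℂ] Cm m →L[ℂ] Cm m) (L := -innerₗ (Rn n)) (μ := volume)
    (ν := volume) Real.continuous_fourierChar (continuous_inner.neg) φ.integrable hu
  have e : (-innerₗ (Rn n)).flip = -innerₗ (Rn n) := by
    ext x y; simp [real_inner_comm]
  rw [e] at h
  rw [SchwartzMap.fourierInv_coe]
  exact h.symm

lemma integral_fourier_smul_eq_fourier {f : Rn n → Cm m} (hf : Integrable f volume)
    (φ : 𝓢(Rn n, ℂ)) : ∫ x, φ x • f x = ∫ ξ, (𝓕⁻ φ) ξ • 𝓕 f ξ := by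
  have h := VectorFourier.integral_bilin_fourierIntegral_eq_flip
    (ContinuousLinearMap.lsmul ℂ ℂ : ℂ →L[ℂ] Cm m →L[ℂ] Cm m) (L := innerₗ (Rn n)) (μ := volume)
    (ν := volume) Real.continuous_fourierChar continuous_inner (𝓕⁻ φ).integrable hf
  rw [flip_innerₗ] at h
  have e : 𝓕 (𝓕⁻ φ) = φ := fourier_fourierInv_eq φ
  conv_lhs => rw [← e, SchwartzMap.fourier_coe]
  exact h

lemma continuous_fourier_of_integrable {f : Rn n → Cm m} (hf : Integrable f volume) :
    Continuous (𝓕 f) :=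
  VectorFourier.fourierIntegral_continuous Real.continuous_fourierChar continuous_inner hf

lemma continuous_fourierInv_of_integrable {f : Rn n → Cm m} (hf : Integrable f volume) :
    Continuous (𝓕⁻ f) := by
  have : 𝓕⁻ f = fun x => 𝓕 f (-x) := by ext1 x; exact Real.fourierInv_eq_fourier_neg f x
  rw [this]
  exact (continuous_fourier_of_integrable hf).comp continuous_neg

lemma norm_fourier_le (f : Rn n → Cm m) (x : Rn n) : ‖𝓕 f x‖ ≤ ∫ y, ‖f y‖ := by
  rw [Real.fourier_eq]
  refine (norm_integral_le_integral_norm _).trans_eq ?_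
  simp

/-- The Plancherel extension and the absolutely convergent integral define the same distribution, so
they agree almost everywhere. -/
lemma invFourier_ae_eq {u : Rn n → Cm m} (hu : MemLp u 2 volume) (hu1 : Integrable u volume) :
    invFourier hu =ᵐ[volume] 𝓕⁻ u := by
  refine ae_eq_of_testFun ((memLp_invFourier hu).locallyIntegrable (by norm_num))
    (continuous_fourierInv_of_integrable hu1).locallyIntegrable fun φ h₁ h₂ => ?_
  rw [fourierPair_invFourier hu, integral_fourierInv_smul_eq_fourierInv hu1]

lemma IsFourierPair.ae_eq_invFourier {f u : Rn n → Cm m} (h : IsFourierPair f u)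
    (hf : LocallyIntegrable f volume) (hu : MemLp u 2 volume) :
    f =ᵐ[volume] invFourier hu := by
  refine ae_eq_of_testFun hf ((memLp_invFourier hu).locallyIntegrable (by norm_num))
    fun φ h₁ h₂ => ?_
  rw [fourierPair_invFourier hu, h]

/-- Interpolation between `L²` and `L^∞`. -/
lemma eLpNorm_le_of_two_of_top {α F : Type*} [MeasurableSpace α] {μ : Measure α}
    [NormedAddCommGroup F] {g : α → F} {p V a : ℝ≥0∞}
    (hg : AEStronglyMeasurable g μ) (hp : 2 ≤ p) (h2 : eLpNorm g 2 μ ≤ a) (htop : eLpNorm g ∞ μ ≤ V ^ (1 / 2 : ℝ) * a) :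
    eLpNorm g p μ ≤ V ^ (1 / 2 - (p⁻¹).toReal) * a := by
  rcases eq_or_ne p ∞ with rfl | hpt
  · simpa using htop
  have hp0 : p ≠ 0 := fun h => by simp [h] at hp
  set P := p.toReal with hP
  have hP2 : 2 ≤ P := by
    have := ENNReal.toReal_mono hpt hp
    simpa using this
  have hP0 : 0 < P := by linarith
  rw [ENNReal.toReal_inv]
  have h2' : ∫⁻ x, ‖g x‖ₑ ^ (2 : ℝ) ∂μ ≤ a ^ (2 : ℝ) := by
    rw [eLpNorm_eq_lintegral_rpow_enorm_toReal (by norm_num) (by norm_num)] at h2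
    have := ENNReal.rpow_le_rpow h2 (by norm_num : (0 : ℝ) ≤ 2)
    rw [← ENNReal.rpow_mul] at this
    simpa using this
  have hb : ∀ᵐ x ∂μ, ‖g x‖ₑ ≤ V ^ (1 / 2 : ℝ) * a := by
    rw [eLpNorm_exponent_top] at htop
    filter_upwards [enorm_ae_le_eLpNormEssSup g μ] with x hx
    exact hx.trans htop
  rw [eLpNorm_eq_lintegral_rpow_enorm_toReal hp0 hpt]
  have h3 : ∫⁻ x, ‖g x‖ₑ ^ P ∂μ ≤ (V ^ (1 / 2 : ℝ) * a) ^ (P - 2) * a ^ (2 : ℝ) := by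
    calc ∫⁻ x, ‖g x‖ₑ ^ P ∂μ ≤ ∫⁻ x, (V ^ (1 / 2 : ℝ) * a) ^ (P - 2) * ‖g x‖ₑ ^ (2 : ℝ) ∂μ := by
          refine lintegral_mono_ae ?_
          filter_upwards [hb] with x hx
          have : P = (P - 2) + 2 := by ring
          conv_lhs => rw [this, ENNReal.rpow_add_of_nonneg _ _ (by linarith) (by norm_num)]
          gcongr
      _ ≤ _ := by
          rw [lintegral_const_mul'' _ (hg.enorm.pow_const _)]
          gcongr
  calc _ ≤ ((V ^ (1 / 2 : ℝ) * a) ^ (P - 2) * a ^ (2 : ℝ)) ^ (1 / P) :=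
        ENNReal.rpow_le_rpow h3 (by positivity)
    _ = V ^ (1 / 2 - P⁻¹) * a := by
        rw [ENNReal.mul_rpow_of_nonneg _ _ (by linarith : 0 ≤ P - 2), mul_assoc,
          ← ENNReal.rpow_add_of_nonneg _ _ (by linarith) (by norm_num),
          ENNReal.mul_rpow_of_nonneg _ _ (by positivity), ← ENNReal.rpow_mul, ← ENNReal.rpow_mul,
          ← ENNReal.rpow_mul]
        congr 1
        · congr 1; field_simp
        · rw [show (P - 2 + 2) * (1 / P) = 1 by field_simp; ring, ENNReal.rpow_one]

end HypSys

namespace HypSys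

open SchwartzMap FourierTransform LineDeriv

variable {n m : ℕ}

/-! ### Bernstein inequalities -/

lemma enorm_fourierInv_le (f : Rn n → Cm m) (x : Rn n) : ‖𝓕⁻ f x‖ₑ ≤ eLpNorm f 1 volume := by
  rw [Real.fourierInv_eq, eLpNorm_one_eq_lintegral_enorm]
  refine (enorm_integral_le_lintegral_enorm _).trans_eq ?_
  refine lintegral_congr fun y => ?_
  rw [← ofReal_norm, ← ofReal_norm]
  simp

lemma eLpNorm_one_le_of_support {u : Rn n → Cm m} (hu : MemLp u 2 volume) {s : Set (Rn n)}
    (hs : MeasurableSet s) (h0 : ∀ x ∉ s, u x = 0) :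
    eLpNorm u 1 volume ≤ volume s ^ (1 / 2 : ℝ) * eLpNorm u 2 volume := by
  have e : s.indicator u = u := by
    ext1 x
    by_cases hx : x ∈ s
    · rw [Set.indicator_of_mem hx]
    · rw [Set.indicator_of_notMem hx, h0 x hx]
  have h := eLpNorm_le_eLpNorm_mul_rpow_measure_univ (μ := volume.restrict s) (f := u)
    (p := 1) (q := 2) (by norm_num) hu.1.restrict
  rw [← eLpNorm_indicator_eq_eLpNorm_restrict hs, ← eLpNorm_indicator_eq_eLpNorm_restrict hs, e,
    Measure.restrict_apply_univ, mul_comm] at h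
  convert h using 3
  norm_num

lemma integrable_of_support {u : Rn n → Cm m} (hu : MemLp u 2 volume) {s : Set (Rn n)}
    (hs : MeasurableSet s) (hs' : volume s ≠ ⊤) (h0 : ∀ x ∉ s, u x = 0) : Integrable u volume := by
  rw [← memLp_one_iff_integrable]
  refine ⟨hu.1, (eLpNorm_one_le_of_support hu hs h0).trans_lt ?_⟩
  exact ENNReal.mul_lt_top (ENNReal.rpow_lt_top_of_nonneg (by norm_num) hs') hu.2

/-- Plancherel gives the `L²` bound. Cauchy–Schwarz on the support bounds the `L¹` norm of u, hence
the supremum of its inverse transform; interpolation gives the exponents in between. -/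
lemma eLpNorm_invFourier_le_of_support {u : Rn n → Cm m} (hu : MemLp u 2 volume) {s : Set (Rn n)}
    (hs : MeasurableSet s) (hs' : volume s ≠ ⊤) (h0 : ∀ x ∉ s, u x = 0) {p : ℝ≥0∞} (hp : 2 ≤ p) :
    eLpNorm (invFourier hu) p volume ≤
      volume s ^ (1 / 2 - (p⁻¹).toReal) * eLpNorm u 2 volume := by
  refine eLpNorm_le_of_two_of_top (memLp_invFourier hu).1 hp (eLpNorm_invFourier hu).le ?_
  rw [eLpNorm_congr_ae (invFourier_ae_eq hu (integrable_of_support hu hs hs' h0)),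
    eLpNorm_exponent_top]
  refine eLpNormEssSup_le_of_ae_enorm_bound (ae_of_all _ fun x => ?_)
  exact (enorm_fourierInv_le u x).trans (eLpNorm_one_le_of_support hu hs h0)

/-- Split at height 1: the set where f is large has finite measure, so f is integrable there; where
f is at most 1, its square is at most its q-th power. -/
lemma exists_add_memLp_one_two {f : Rn n → Cm m} {q : ℝ≥0∞} (hq1 : 1 ≤ q) (hq2 : q ≤ 2)
    (hf : MemLp f q volume) :
    ∃ f₁ f₂ : Rn n → Cm m, Integrable f₁ volume ∧ MemLp f₂ 2 volume ∧ f =ᵐ[volume] f₁ + f₂ := by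
  have hqt : q ≠ ⊤ := fun h => by simp [h] at hq2
  have hq0 : q ≠ 0 := fun h => by simp [h] at hq1
  set g := hf.1.mk f with hgdef
  have hgm : StronglyMeasurable g := hf.1.stronglyMeasurable_mk
  have hfg : f =ᵐ[volume] g := hf.1.ae_eq_mk
  have hg : MemLp g q volume := (memLp_congr_ae hfg).1 hf
  set S : Set (Rn n) := {x | 1 ≤ ‖g x‖₊} with hS
  have hSm : MeasurableSet S := measurableSet_le measurable_const hgm.nnnorm.measurable
  have hSfin : volume S < ⊤ := by
    have := hg.meas_ge_lt_top hq0 hqt (ε := 1) one_ne_zero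
    simpa [hS] using this
  refine ⟨S.indicator g, Sᶜ.indicator g, ?_, ?_, ?_⟩
  · rw [integrable_indicator_iff hSm]
    have : IsFiniteMeasure (volume.restrict S) := ⟨by simpa using hSfin⟩
    exact memLp_one_iff_integrable.1 ((hg.restrict S).mono_exponent hq1)
  · refine ⟨(hgm.indicator hSm.compl).aestronglyMeasurable, ?_⟩
    rw [eLpNorm_lt_top_iff_lintegral_rpow_enorm_lt_top (by norm_num) (by norm_num)]
    refine lt_of_le_of_lt (lintegral_mono fun x => ?_)
      ((eLpNorm_lt_top_iff_lintegral_rpow_enorm_lt_top hq0 hqt).1 hg.2)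
    by_cases hx : x ∈ S
    · simp [Set.indicator_of_notMem (show x ∉ Sᶜ by simpa using hx)]
    · rw [Set.indicator_of_mem (show x ∈ Sᶜ from hx)]
      have h1 : ‖g x‖ₑ ≤ 1 := by
        have : ‖g x‖₊ < 1 := not_le.1 hx
        rw [enorm_eq_nnnorm]; exact_mod_cast this.le
      exact ENNReal.rpow_le_rpow_of_exponent_ge h1 (ENNReal.toReal_mono (by norm_num) hq2)
  · rwa [Set.indicator_self_add_compl]

lemma integral_inner_fourier_eq {f u : Rn n → Cm m} (hf : Integrable f volume)
    (hu : Integrable u volume) :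
    ∫ ξ, inner ℂ (𝓕 f ξ) (u ξ) = ∫ x, inner ℂ (f x) (𝓕⁻ u x) := by
  have h := VectorFourier.integral_sesq_fourierIntegral_eq_neg_flip
    (innerSL ℂ : Cm m →L⋆[ℂ] Cm m →L[ℂ] ℂ) (L := innerₗ (Rn n)) (μ := volume)
    (ν := volume) Real.continuous_fourierChar continuous_inner hf hu
  rw [flip_innerₗ] at h
  exact h

lemma eLpNorm_inner_le {f g : Rn n → Cm m} {p q : ℝ≥0∞} [ENNReal.HolderConjugate p q]
    (hf : AEStronglyMeasurable f volume) (hg : AEStronglyMeasurable g volume) :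
    eLpNorm (fun x => inner ℂ (f x) (g x)) 1 volume ≤
      eLpNorm f p volume * eLpNorm g q volume := by
  have h := eLpNorm_le_eLpNorm_mul_eLpNorm_of_nnnorm (p := p) (q := q) (r := 1) hf hg
    (fun x y => inner ℂ x y) 1 (ae_of_all _ fun x => by
      rw [one_mul]; exact nnnorm_inner_le_nnnorm _ _)
  simpa using h

lemma integrable_inner_of_holder {f g : Rn n → Cm m} {p q : ℝ≥0∞} [ENNReal.HolderConjugate p q]
    (hf : MemLp f p volume) (hg : MemLp g q volume) :
    Integrable (fun x => inner ℂ (f x) (g x)) volume :=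
  memLp_one_iff_integrable.1 ⟨hf.1.inner hg.1,
    (eLpNorm_inner_le hf.1 hg.1).trans_lt (ENNReal.mul_lt_top hf.2 hg.2)⟩

lemma integral_inner_self {f : Rn n → Cm m} (hf : MemLp f 2 volume) :
    ∫ x, inner ℂ (f x) (f x) = (((eLpNorm f 2 volume).toReal ^ 2 : ℝ) : ℂ) := by
  have h := inner_self_eq_norm_sq_to_K (𝕜 := ℂ) (hf.toLp f)
  rw [L2.inner_def, Lp.norm_toLp] at h
  rw [Complex.ofReal_pow]
  refine Eq.trans (integral_congr_ae ?_) h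
  filter_upwards [hf.coeFn_toLp] with x hx
  rw [hx]

/-- For `1 ≤ q ≤ 2` every `f ∈ L^q` has a Fourier transform which is a locally square integrable
function; its `L²` norm on sets of finite measure is controlled by the `L^q` norm of `f`. -/
theorem exists_fourierPair {f : Rn n → Cm m} {q : ℝ≥0∞} (hq1 : 1 ≤ q) (hq2 : q ≤ 2)
    (hf : MemLp f q volume) :
    ∃ u : Rn n → Cm m, IsFourierPair f u ∧ BddAddL2 u ∧
      ∀ s : Set (Rn n), MeasurableSet s → volume s ≠ ⊤ →
        eLpNorm (s.indicator u) 2 volume ≤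
          volume s ^ ((q⁻¹).toReal - 1 / 2) * eLpNorm f q volume := by
  obtain ⟨f₁, f₂, h1, h2, hf12⟩ := exists_add_memLp_one_two hq1 hq2 hf
  set F₂ : Lp (Cm m) 2 (volume : Measure (Rn n)) := 𝓕 (h2.toLp f₂) with hF₂
  have hF₂' : 𝓕⁻ F₂ = h2.toLp f₂ := fourierInv_fourier_eq _
  have hu1 : MemLp (𝓕 f₁) ⊤ volume :=
    memLp_top_of_bound (continuous_fourier_of_integrable h1).aestronglyMeasurable
      (∫ y, ‖f₁ y‖) (ae_of_all _ (norm_fourier_le f₁))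
  have hbdd : BddAddL2 (𝓕 f₁ + ⇑F₂) := ⟨𝓕 f₁, F₂, hu1, Lp.memLp _, rfl⟩
  refine ⟨𝓕 f₁ + ⇑F₂, ?_, hbdd, ?_⟩
  · intro φ
    have e1 : ∫ x, φ x • f x = ∫ x, (φ x • f₁ x + φ x • f₂ x) := by
      refine integral_congr_ae ?_
      filter_upwards [hf12] with x hx
      rw [hx, Pi.add_apply, smul_add]
    have e2 : ∫ x, φ x • f₂ x = ∫ ξ, (𝓕⁻ φ) ξ • F₂ ξ := by
      rw [← fourierPair_Lp F₂ φ, hF₂']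
      refine integral_congr_ae ?_
      filter_upwards [h2.coeFn_toLp] with x hx
      rw [hx]
    rw [e1, integral_add (integrable_schwartz_smul le_rfl (memLp_one_iff_integrable.2 h1) φ)
      (integrable_schwartz_smul (by norm_num) h2 φ), e2, integral_fourier_smul_eq_fourier h1,
      ← integral_add (integrable_schwartz_smul le_top hu1 _)
      (integrable_schwartz_smul (by norm_num) (Lp.memLp F₂) _)]
    simp only [Pi.add_apply, smul_add]
  · intro s hs hs'
    -- Duality replaces Hausdorff–Young: pair u with its own restriction ψ to s. Parseval turns ‖ψ‖²
    -- in `L²` into the pairing of f with g, the inverse transform of ψ. Hölder and the Bernstein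
    -- bound of g in the conjugate exponent give the claim times one factor ‖ψ‖, cancelled at the
    -- end.
    set u := 𝓕 f₁ + ⇑F₂ with hu
    set ψ := s.indicator u with hψ
    have hψ2 : MemLp ψ 2 volume := hbdd.memLp_indicator hs hs'
    have h0 : ∀ x ∉ s, ψ x = 0 := fun x hx => Set.indicator_of_notMem hx _
    have hψ1 : Integrable ψ volume := integrable_of_support hψ2 hs hs' h0
    set g := invFourier hψ2 with hg
    have hg1 : g =ᵐ[volume] 𝓕⁻ ψ := invFourier_ae_eq hψ2 hψ1
    set a := eLpNorm ψ 2 volume with ha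
    have hat : a ≠ ⊤ := hψ2.2.ne
    have i1 : ∫ ξ, inner ℂ (𝓕 f₁ ξ) (ψ ξ) = ∫ x, inner ℂ (f₁ x) (g x) := by
      rw [integral_inner_fourier_eq h1 hψ1]
      refine integral_congr_ae ?_
      filter_upwards [hg1] with x hx
      rw [hx]
    have i2 : ∫ ξ, inner ℂ (F₂ ξ) (ψ ξ) = ∫ x, inner ℂ (f₂ x) (g x) := by
      have h := Lp.inner_fourier_eq (h2.toLp f₂) (𝓕⁻ (hψ2.toLp ψ))
      rw [fourier_fourierInv_eq, L2.inner_def, L2.inner_def] at h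
      have e1 : ∫ ξ, inner ℂ (F₂ ξ) (ψ ξ) = ∫ ξ, inner ℂ (F₂ ξ) ((hψ2.toLp ψ : Rn n → Cm m) ξ) := by
        refine integral_congr_ae ?_
        filter_upwards [hψ2.coeFn_toLp] with x hx
        rw [hx]
      rw [e1]
      refine h.trans (integral_congr_ae ?_)
      filter_upwards [h2.coeFn_toLp] with x hx
      rw [hx]; rfl
    have hgp : ∀ p : ℝ≥0∞, 2 ≤ p → eLpNorm g p volume ≤
        volume s ^ (1 / 2 - (p⁻¹).toReal) * a :=
      fun p hp => eLpNorm_invFourier_le_of_support hψ2 hs hs' h0 hp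
    have hgm : AEStronglyMeasurable g volume := (memLp_invFourier hψ2).1
    have hgtop : MemLp g ⊤ volume := by
      refine ⟨hgm, (hgp ⊤ le_top).trans_lt (ENNReal.mul_lt_top
        (ENNReal.rpow_lt_top_of_nonneg (by norm_num) hs') hat.lt_top)⟩
    have key : ∫ x, inner ℂ (f x) (g x) = ((a.toReal ^ 2 : ℝ) : ℂ) := by
      have e1 : ∫ x, inner ℂ (f x) (g x) =
          ∫ x, (inner ℂ (f₁ x) (g x) + inner ℂ (f₂ x) (g x)) := by
        refine integral_congr_ae ?_
        filter_upwards [hf12] with x hx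
        rw [hx, Pi.add_apply, inner_add_left]
      rw [e1, integral_add (integrable_inner_of_holder (memLp_one_iff_integrable.2 h1) hgtop)
        (integrable_inner_of_holder h2 (memLp_invFourier hψ2)), ← i1, ← i2,
        ← integral_add (integrable_inner_of_holder hu1 (memLp_one_iff_integrable.2 hψ1))
        (integrable_inner_of_holder (Lp.memLp F₂) hψ2), ← integral_inner_self hψ2]
      refine integral_congr_ae (ae_of_all _ fun ξ => ?_)
      by_cases hξ : ξ ∈ s
      · simp only [hψ, Set.indicator_of_mem hξ, hu, Pi.add_apply, inner_add_left]
      · simp [h0 ξ hξ]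
    have hconj : ENNReal.HolderConjugate q (1 - q⁻¹)⁻¹ := by
      rw [ENNReal.holderConjugate_iff, inv_inv]
      exact add_tsub_cancel_of_le (ENNReal.inv_le_one.2 hq1)
    have hq' : 2 ≤ (1 - q⁻¹)⁻¹ := by
      rw [ENNReal.le_inv_iff_le_inv]
      have : (2 : ℝ≥0∞)⁻¹ ≤ q⁻¹ := ENNReal.inv_le_inv.2 hq2
      calc 1 - q⁻¹ ≤ 1 - 2⁻¹ := tsub_le_tsub_left this _
        _ = 2⁻¹ := ENNReal.one_sub_inv_two
    have hexp : 1 / 2 - (((1 - q⁻¹)⁻¹)⁻¹).toReal = (q⁻¹).toReal - 1 / 2 := by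
      rw [inv_inv, ENNReal.toReal_sub_of_le (ENNReal.inv_le_one.2 hq1) ENNReal.one_ne_top,
        ENNReal.toReal_one]
      ring
    have hmain : a ^ 2 ≤ eLpNorm f q volume * (volume s ^ ((q⁻¹).toReal - 1 / 2) * a) := by
      have k1 : a ^ 2 = ‖∫ x, inner ℂ (f x) (g x)‖ₑ := by
        rw [key, ← ofReal_norm, Complex.norm_real, Real.norm_of_nonneg (by positivity),
          ENNReal.ofReal_pow ENNReal.toReal_nonneg, ENNReal.ofReal_toReal hat]
      rw [k1]
      refine (enorm_integral_le_lintegral_enorm _).trans ?_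
      rw [← eLpNorm_one_eq_lintegral_enorm]
      refine (eLpNorm_inner_le (p := q) (q := (1 - q⁻¹)⁻¹) hf.1 hgm).trans ?_
      have := hgp _ hq'
      rw [hexp] at this
      gcongr
    rcases eq_or_ne a 0 with h0a | h0a
    · rw [h0a]; exact zero_le
    · rw [sq, ← mul_assoc, mul_comm (eLpNorm f q volume)] at hmain
      exact (ENNReal.mul_le_mul_iff_left h0a hat).1 hmain

end HypSys

namespace HypSys

open SchwartzMap FourierTransform LineDeriv

variable {n m k : ℕ}

/-! ### Weak derivatives on the Fourier side -/

/-- The symbol `∏ᵢ 2πi ξ_{α i}` of the partial derivative `∂_{α 0} ⋯ ∂_{α (k-1)}`. -/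
def mono (α : Fin k → Fin n) (ξ : Rn n) : ℂ :=
  ∏ i, ((2 * Real.pi * Complex.I : ℂ) * (ξ (α i) : ℂ))

lemma continuous_mono (α : Fin k → Fin n) : Continuous (mono α) := by
  unfold mono
  fun_prop

lemma norm_mono_le (α : Fin k → Fin n) (ξ : Rn n) : ‖mono α ξ‖ ≤ (2 * Real.pi) ^ k * ‖ξ‖ ^ k := by
  rw [mono, norm_prod, ← mul_pow]
  calc ∏ i, ‖(2 * Real.pi * Complex.I : ℂ) * (ξ (α i) : ℂ)‖ ≤ ∏ _i : Fin k, 2 * Real.pi * ‖ξ‖ := by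
        refine Finset.prod_le_prod (fun _ _ => norm_nonneg _) fun i _ => ?_
        rw [norm_mul]
        have h1 : ‖(2 * Real.pi * Complex.I : ℂ)‖ = 2 * Real.pi := by
          simp [abs_of_pos Real.pi_pos]
        rw [h1, Complex.norm_real]
        exact mul_le_mul_of_nonneg_left (PiLp.norm_apply_le ξ _) (by positivity)
    _ = _ := by simp

/-- The full gradient of order `k` has the symbol `(2π|ξ|)^k`. -/
lemma sum_norm_mono_sq (k : ℕ) (ξ : Rn n) :
    ∑ α : Fin k → Fin n, ‖mono α ξ‖ ^ 2 = ((2 * Real.pi) ^ k * ‖ξ‖ ^ k) ^ 2 := by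
  have h1 : ∀ α : Fin k → Fin n, ‖mono α ξ‖ ^ 2 = ∏ i, ((2 * Real.pi) ^ 2 * ξ (α i) ^ 2) := by
    intro α
    rw [mono, norm_prod, ← Finset.prod_pow]
    refine Finset.prod_congr rfl fun i _ => ?_
    rw [norm_mul, mul_pow]
    congr 1
    · simp [abs_of_pos Real.pi_pos]
    · simp
  simp only [h1]
  have h2 : ∑ α : Fin k → Fin n, ∏ i, ((2 * Real.pi) ^ 2 * ξ (α i) ^ 2) =
      (∑ j, (2 * Real.pi) ^ 2 * ξ j ^ 2) ^ k := by
    have := Finset.sum_pow' (Finset.univ : Finset (Fin n))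
      (fun j => (2 * Real.pi) ^ 2 * ξ j ^ 2) k
    rw [this, Fintype.piFinset_univ]
  rw [h2, ← Finset.mul_sum, ← EuclideanSpace.real_norm_sq_eq, ← mul_pow, ← mul_pow, ← pow_mul,
    ← pow_mul, mul_comm k 2]

/-- The ℓ² norm of the symbols of order k equals (2π)^k ‖ξ‖^k and is at most their ℓ¹ norm. Control
of all derivatives of one order thus becomes a power weight in frequency. -/
lemma norm_pow_le_sum_norm_mono (k : ℕ) (ξ : Rn n) :
    ‖ξ‖ ^ k ≤ ∑ α : Fin k → Fin n, ‖mono α ξ‖ := by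
  have h1 : ((2 * Real.pi) ^ k * ‖ξ‖ ^ k) ^ 2 ≤ (∑ α : Fin k → Fin n, ‖mono α ξ‖) ^ 2 := by
    rw [← sum_norm_mono_sq]
    exact Finset.sum_sq_le_sq_sum_of_nonneg fun _ _ => norm_nonneg _
  have h2 := (le_abs_self _).trans
    (abs_le_of_sq_le_sq h1 (Finset.sum_nonneg fun _ _ => norm_nonneg _))
  refine le_trans ?_ h2
  have : 1 ≤ (2 * Real.pi) ^ k := one_le_pow₀ (by nlinarith [Real.pi_gt_three])
  nlinarith [pow_nonneg (norm_nonneg ξ) k]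

lemma fourierInv_iteratedLineDerivOp (φ : 𝓢(Rn n, ℂ)) (α : Fin k → Fin n) (ξ : Rn n) :
    (𝓕⁻ (∂^{dirs α} φ)) ξ = (-1) ^ k * mono α ξ * (𝓕⁻ φ) ξ := by
  induction k with
  | zero => simp [mono]
  | succ k ih =>
    have ht : Fin.tail (dirs α) = dirs (Fin.tail α) := rfl
    rw [iteratedLineDerivOp_succ_left, ht, fourierInv_lineDerivOp_eq]
    have hg : (inner ℝ · (dirs α 0) : Rn n → ℝ).HasTemperateGrowth := by fun_prop
    have h0 : inner ℝ ξ (dirs α 0) = ξ (α 0) := by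
      simp [dirs, EuclideanSpace.inner_single_right]
    rw [_root_.smul_apply, SchwartzMap.smulLeftCLM_apply_apply hg, ih, h0, mono, mono,
      Fin.prod_univ_succ]
    simp only [Complex.real_smul, smul_eq_mul, Fin.tail]
    ring

/-! ### Passage between real and complex vector values -/

/-- Complexification `ℝᵐ → ℂᵐ`. -/
def cx (m : ℕ) : Rn m →ₗᵢ[ℝ] Cm m where
  toFun v := WithLp.toLp 2 fun i => (v i : ℂ)
  map_add' u v := by ext i; simp
  map_smul' r v := by ext i; simp
  norm_map' v := by simp [EuclideanSpace.norm_eq]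

/-- The real part `ℂᵐ → ℝᵐ`. -/
def rePart (m : ℕ) : Cm m →L[ℝ] Rn m :=
  LinearMap.mkContinuous
    { toFun := fun v => WithLp.toLp 2 fun i => (v i).re
      map_add' := fun u v => by ext i; simp
      map_smul' := fun r v => by ext i; simp } 1 fun v => by
    rw [one_mul, EuclideanSpace.norm_eq, EuclideanSpace.norm_eq]
    refine Real.sqrt_le_sqrt (Finset.sum_le_sum fun i _ => ?_)
    exact pow_le_pow_left₀ (norm_nonneg _) (Complex.abs_re_le_norm _) 2

@[simp] lemma cx_apply (v : Rn m) (i : Fin m) : cx m v i = (v i : ℂ) := rfl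

@[simp] lemma rePart_apply (v : Cm m) (i : Fin m) : rePart m v i = (v i).re := rfl

@[simp] lemma rePart_cx (v : Rn m) : rePart m (cx m v) = v := by ext i; simp

lemma norm_rePart_le (v : Cm m) : ‖rePart m v‖ ≤ ‖v‖ := by
  rw [EuclideanSpace.norm_eq, EuclideanSpace.norm_eq]
  refine Real.sqrt_le_sqrt (Finset.sum_le_sum fun i _ => ?_)
  exact pow_le_pow_left₀ (norm_nonneg _) (Complex.abs_re_le_norm _) 2

lemma cx_smul (r : ℝ) (v : Rn m) : cx m (r • v) = (r : ℂ) • cx m v := by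
  ext i; simp

lemma rePart_ofReal_smul (r : ℝ) (v : Cm m) : rePart m ((r : ℂ) • v) = r • rePart m v := by
  ext i; simp

lemma eLpNorm_cx (f : Rn n → Rn m) (p : ℝ≥0∞) :
    eLpNorm (fun x => cx m (f x)) p volume = eLpNorm f p volume :=
  eLpNorm_congr_norm_ae (ae_of_all _ fun _ => (cx m).norm_map _)

lemma memLp_cx {f : Rn n → Rn m} {p : ℝ≥0∞} (hf : MemLp f p volume) :
    MemLp (fun x => cx m (f x)) p volume :=
  ⟨(cx m).continuous.comp_aestronglyMeasurable hf.1, by rw [eLpNorm_cx]; exact hf.2⟩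

lemma eLpNorm_rePart_le (f : Rn n → Cm m) (p : ℝ≥0∞) :
    eLpNorm (fun x => rePart m (f x)) p volume ≤ eLpNorm f p volume :=
  eLpNorm_mono fun _ => norm_rePart_le _

lemma memLp_rePart {f : Rn n → Cm m} {p : ℝ≥0∞} (hf : MemLp f p volume) :
    MemLp (fun x => rePart m (f x)) p volume :=
  ⟨(rePart m).continuous.comp_aestronglyMeasurable hf.1, (eLpNorm_rePart_le f p).trans_lt hf.2⟩

lemma iteratedLineDerivOp_testFun (α : Fin k → Fin n) (φ : Rn n → ℝ) (h₁ : ContDiff ℝ ∞ φ)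
    (h₂ : HasCompactSupport φ) (x : Rn n) :
    (∂^{dirs α} (testFun φ h₁ h₂)) x = ((iteratedFDeriv ℝ k φ x (dirs α) : ℝ) : ℂ) := by
  rw [SchwartzMap.iteratedLineDerivOp_eq_iteratedFDeriv]
  have h := Complex.ofRealCLM.iteratedFDeriv_comp_left (f := φ) (x := x) (i := k)
    (h₁.contDiffAt) (mod_cast le_top)
  have e : (testFun φ h₁ h₂ : Rn n → ℂ) = Complex.ofRealCLM ∘ φ := rfl
  rw [e, h]
  rfl

lemma integral_ofReal_smul_cx (φ : Rn n → ℝ) (f : Rn n → Rn m) :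
    ∫ x, (φ x : ℂ) • cx m (f x) = cx m (∫ x, φ x • f x) := by
  rw [← (cx m).integral_comp_comm]
  simp only [cx_smul]

/-- A weak derivative may be tested against Schwartz functions. -/
lemma IsWeakPartial.integral_schwartz {α : Fin k → Fin n} {f g : Rn n → Rn m}
    (h : IsWeakPartial α f g) {p q : ℝ≥0∞} (hp : 1 ≤ p) (hq : 1 ≤ q) (hf : MemLp f p volume)
    (hg : MemLp g q volume) (φ : 𝓢(Rn n, ℂ)) :
    ∫ x, (∂^{dirs α} φ) x • cx m (f x) = (-1 : ℂ) ^ k • ∫ x, φ x • cx m (g x) := by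
  have hf' := memLp_cx hf
  have hg' := memLp_cx hg
  rw [← sub_eq_zero]
  refine eq_zero_of_testFun (fun φ : 𝓢(Rn n, ℂ) => (∫ x, (∂^{dirs α} φ) x • cx m (f x)) -
    (-1 : ℂ) ^ k • (∫ x, φ x • cx m (g x))) ?_ ?_ ?_ ?_ φ
  · have h1 : Continuous fun φ : 𝓢(Rn n, ℂ) => ∂^{dirs α} φ :=
      continuous_iteratedLineDerivOp (dirs α)
    have h2 : Continuous fun φ : 𝓢(Rn n, ℂ) => (-1 : ℂ) ^ k • (∫ x, φ x • cx m (g x)) :=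
      (continuous_const_smul ((-1 : ℂ) ^ k)).comp (continuous_integral_schwartz_smul hq hg')
    exact ((continuous_integral_schwartz_smul hp hf').comp h1).sub h2
  · intro φ ψ
    simp only [iteratedLineDerivOp_add, _root_.add_apply, add_smul]
    rw [integral_add (integrable_schwartz_smul hp hf' _) (integrable_schwartz_smul hp hf' _),
      integral_add (integrable_schwartz_smul hq hg' _) (integrable_schwartz_smul hq hg' _),
      smul_add]
    abel
  · intro a φ
    simp only [iteratedLineDerivOp_smul, _root_.smul_apply, smul_assoc, integral_smul]
    rw [smul_sub, smul_comm]
  · intro φ h₁ h₂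
    simp only [iteratedLineDerivOp_testFun, testFun_apply, integral_ofReal_smul_cx, h.2.2 φ h₁ h₂]
    rw [cx_smul]
    simp

lemma locallyIntegrable_smul_of_continuous {u : Rn n → Cm m} (hu : LocallyIntegrable u volume)
    {a : Rn n → ℂ} (ha : Continuous a) : LocallyIntegrable (fun x => a x • u x) volume := by
  rw [locallyIntegrable_iff] at hu ⊢
  intro K hK
  exact (hu K hK).continuousOn_smul ha.continuousOn hK

/-- The Fourier transform of a weak derivative. -/
lemma IsWeakPartial.fourier_ae_eq {α : Fin k → Fin n} {f g : Rn n → Rn m}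
    (h : IsWeakPartial α f g) {p q : ℝ≥0∞} (hp : 1 ≤ p) (hq : 1 ≤ q) (hf : MemLp f p volume)
    (hg : MemLp g q volume) {u v : Rn n → Cm m} (hu : IsFourierPair (fun x => cx m (f x)) u)
    (hv : IsFourierPair (fun x => cx m (g x)) v) (hu' : BddAddL2 u) (hv' : BddAddL2 v) :
    v =ᵐ[volume] fun ξ => mono α ξ • u ξ := by
  refine ae_eq_of_testFun hv'.locallyIntegrable
    (locallyIntegrable_smul_of_continuous hu'.locallyIntegrable (continuous_mono α))
    fun φ h₁ h₂ => ?_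
  set ψ := testFun φ h₁ h₂
  -- Testing with `𝓕 ψ` leaves ψ itself on the frequency side. This function need not have compact
  -- support, hence the need for Schwartz test functions.
  have h1 := h.integral_schwartz hp hq hf hg (𝓕 ψ)
  rw [hu, hv, fourierInv_fourier_eq] at h1
  simp only [fourierInv_iteratedLineDerivOp, fourierInv_fourier_eq, mul_smul, integral_smul] at h1
  have h2 := (smul_right_injective (Cm m) (r := (-1 : ℂ) ^ k) (by simp)) h1
  rw [← h2]
  refine integral_congr_ae (ae_of_all _ fun ξ => ?_)
  exact smul_comm _ _ _

/-- Differentiation of an `L²` function on the Fourier side, tested against Schwartz functions. -/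
lemma integral_iteratedLineDerivOp_smul_invFourier {α : Fin k → Fin n} {u : Rn n → Cm m}
    (hu : MemLp u 2 volume) (hαu : MemLp (fun ξ => mono α ξ • u ξ) 2 volume) (φ : 𝓢(Rn n, ℂ)) :
    ∫ x, (∂^{dirs α} φ) x • invFourier hu x = (-1 : ℂ) ^ k • ∫ x, φ x • invFourier hαu x := by
  rw [fourierPair_invFourier hu, fourierPair_invFourier hαu, ← integral_smul]
  refine integral_congr_ae (ae_of_all _ fun ξ => ?_)
  simp only [fourierInv_iteratedLineDerivOp, smul_smul]
  congr 1
  ring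

lemma integral_smul_rePart {f : Rn n → Cm m} {φ : Rn n → ℝ}
    (h : Integrable (fun x => (φ x : ℂ) • f x) volume) :
    ∫ x, φ x • rePart m (f x) = rePart m (∫ x, (φ x : ℂ) • f x) := by
  rw [← (rePart m).integral_comp_comm h]
  simp only [rePart_ofReal_smul]

/-- The real part of an `L²` function with `(2πiξ)^α û ∈ L²` has a weak derivative. -/
lemma isWeakPartial_rePart_invFourier {α : Fin k → Fin n} {u : Rn n → Cm m}
    (hu : MemLp u 2 volume) (hαu : MemLp (fun ξ => mono α ξ • u ξ) 2 volume) :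
    IsWeakPartial α (fun x => rePart m (invFourier hu x))
      (fun x => rePart m (invFourier hαu x)) := by
  refine ⟨(memLp_rePart (memLp_invFourier hu)).locallyIntegrable (by norm_num),
    (memLp_rePart (memLp_invFourier hαu)).locallyIntegrable (by norm_num), fun φ h₁ h₂ => ?_⟩
  have h := integral_iteratedLineDerivOp_smul_invFourier hu hαu (testFun φ h₁ h₂)
  have i1 := integrable_schwartz_smul (by norm_num) (memLp_invFourier hu)
    (∂^{dirs α} (testFun φ h₁ h₂))
  have i2 := integrable_schwartz_smul (by norm_num) (memLp_invFourier hαu) (testFun φ h₁ h₂)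
  simp only [iteratedLineDerivOp_testFun, testFun_apply] at h i1 i2
  rw [integral_smul_rePart i1, integral_smul_rePart i2, h, ← rePart_ofReal_smul]
  simp

/-- Weak derivatives are unique. -/
lemma IsWeakPartial.ae_eq {α : Fin k → Fin n} {f g g' : Rn n → Rn m}
    (h : IsWeakPartial α f g) (h' : IsWeakPartial α f g') : g =ᵐ[volume] g' := by
  refine ae_eq_of_integral_contDiff_smul_eq h.2.1 h'.2.1 fun φ h₁ h₂ => ?_
  have h1 := (h.2.2 φ h₁ h₂).symm.trans (h'.2.2 φ h₁ h₂)
  exact (smul_right_injective (Rn m) (r := (-1 : ℝ) ^ k) (by simp)) h1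

lemma IsWeakPartial.partialNorm_eq {α : Fin k → Fin n} {f g : Rn n → Rn m}
    (h : IsWeakPartial α f g) (p : ℝ≥0∞) : partialNorm α p f = eLpNorm g p volume :=
  le_antisymm (iInf₂_le g h) (le_iInf₂ fun _ h' => (eLpNorm_congr_ae (h.ae_eq h')).le)

end HypSys

namespace HypSys

/-! ### Dyadic sums -/

/-- With truncated subtraction the exponent is |j - J|, so the sum is at most two geometric series.
-/
lemma sum_pow_dist_le {b : ℝ} (hb0 : 0 ≤ b) (hb1 : b < 1) (J N : ℕ) :
    ∑ j ∈ Finset.range N, b ^ ((j - J) + (J - j)) ≤ 2 / (1 - b) := by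
  have hgeo : ∀ K : ℕ, ∑ j ∈ Finset.range K, b ^ j ≤ 1 / (1 - b) := fun K => by
    rw [one_div, ← tsum_geometric_of_lt_one hb0 hb1]
    exact (summable_geometric_of_lt_one hb0 hb1).sum_le_tsum _ fun _ _ => by positivity
  calc ∑ j ∈ Finset.range N, b ^ ((j - J) + (J - j))
      ≤ ∑ j ∈ Finset.range (J + N), b ^ ((j - J) + (J - j)) :=
        Finset.sum_le_sum_of_subset_of_nonneg (Finset.range_mono (Nat.le_add_left _ _))
          fun _ _ _ => by positivity
    _ = ∑ j ∈ Finset.range J, b ^ ((j - J) + (J - j)) + ∑ j ∈ Finset.range N, b ^ j := by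
        rw [Finset.sum_range_add]
        congr 1
        refine Finset.sum_congr rfl fun j _ => ?_
        congr 1; omega
    _ ≤ ∑ j ∈ Finset.range J, b ^ j + ∑ j ∈ Finset.range N, b ^ j := by
        gcongr ?_ + _
        rw [← Finset.sum_range_reflect]
        refine Finset.sum_le_sum fun j hj => ?_
        have := Finset.mem_range.1 hj
        exact pow_le_pow_of_le_one hb0 hb1.le (by omega)
    _ ≤ 1 / (1 - b) + 1 / (1 - b) := add_le_add (hgeo _) (hgeo _)
    _ = _ := by ring

/-- `Σ_j 2^{-εj} e^{-δ t 4^{-j}} = O((1+t)^{-ε/2})`. -/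
lemma exists_dyadic_sum_le {ε δ : ℝ} (hε : 0 < ε) (hδ : 0 < δ) :
    ∃ C > 0, ∀ t : ℝ, 0 ≤ t →
      ∑' j : ℕ, ENNReal.ofReal ((2 : ℝ) ^ (-(ε * j)) * Real.exp (-(δ * t * (4 : ℝ)⁻¹ ^ j))) ≤
        ENNReal.ofReal (C * (1 + t) ^ (-(ε / 2))) := by
  set a : ℝ := (2 : ℝ) ^ (-ε) with ha
  have ha0 : 0 < a := by positivity
  have ha1 : a < 1 := Real.rpow_lt_one_of_one_lt_of_neg one_lt_two (by linarith)
  -- For j = J - i the weight exceeds a^J by the factor a⁻ⁱ. Polynomial decay of order K of the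
  -- exponential, with a 4^K ≥ 2, compensates this and leaves 2⁻ⁱ.
  obtain ⟨K, hK⟩ := pow_unbounded_of_one_lt (2 / a) (by norm_num : (1 : ℝ) < 4)
  have hK' : 2 ≤ a * 4 ^ K := by rw [div_lt_iff₀ ha0] at hK; linarith
  set b := max a (1 / 2) with hb
  have hb0 : 0 ≤ b := ha0.le.trans (le_max_left _ _)
  have hb1 : b < 1 := max_lt ha1 (by norm_num)
  set C₁ := max 1 (Real.exp δ * (K.factorial / δ ^ K)) with hC₁
  have hC₁0 : 0 < C₁ := lt_max_of_lt_left one_pos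
  have h1b : 0 < 1 - b := by linarith
  refine ⟨C₁ * (2 / (1 - b)) / a, by positivity, fun t ht => ?_⟩
  -- J is the transition index 4^J ~ 1 + t, at which a^J ~ (1 + t)^(-ε/2). Terms decay geometrically
  -- on both sides of it.
  obtain ⟨J, hJ1, hJ2⟩ := exists_nat_pow_near (by linarith : 1 ≤ 1 + t) (by norm_num : (1 : ℝ) < 4)
  have hpow : ∀ i : ℕ, ((4 : ℝ) ^ i) ^ (-(ε / 2)) = a ^ i := fun i => by
    rw [ha, ← Real.rpow_natCast, ← Real.rpow_natCast, ← Real.rpow_mul (by norm_num),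
      ← Real.rpow_mul (by norm_num), show (4 : ℝ) = 2 ^ (2 : ℝ) by norm_num,
      ← Real.rpow_mul (by norm_num)]
    congr 1; ring
  have hlow : a ^ J ≤ (1 + t) ^ (-(ε / 2)) / a := by
    rw [le_div_iff₀ ha0, ← pow_succ, ← hpow]
    exact Real.rpow_le_rpow_of_nonpos (by linarith) hJ2.le (by linarith)
  have hterm : ∀ j : ℕ, (2 : ℝ) ^ (-(ε * j)) * Real.exp (-(δ * t * (4 : ℝ)⁻¹ ^ j)) ≤
      C₁ * a ^ J * b ^ ((j - J) + (J - j)) := by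
    intro j
    have e1 : (2 : ℝ) ^ (-(ε * j)) = a ^ j := by
      rw [ha, ← Real.rpow_natCast, ← Real.rpow_mul (by norm_num)]
      congr 1; ring
    rw [e1]
    rcases le_or_gt J j with h | h
    · obtain ⟨i, rfl⟩ := Nat.exists_eq_add_of_le h
      have e2 : (J + i - J) + (J - (J + i)) = i := by omega
      rw [e2]
      have h3 : Real.exp (-(δ * t * (4 : ℝ)⁻¹ ^ (J + i))) ≤ 1 :=
        Real.exp_le_one_iff.2 (neg_nonpos.2 (by positivity))
      calc a ^ (J + i) * Real.exp (-(δ * t * (4 : ℝ)⁻¹ ^ (J + i))) ≤ a ^ (J + i) * 1 := by gcongr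
        _ = 1 * a ^ J * a ^ i := by rw [pow_add]; ring
        _ ≤ C₁ * a ^ J * b ^ i := by
            gcongr
            · exact le_max_left _ _
            · exact le_max_left _ _
    · obtain ⟨i, rfl⟩ := Nat.exists_eq_add_of_le h.le
      have e2 : (j - (j + i)) + (j + i - j) = i := by omega
      rw [e2]
      have h3 : (4 : ℝ) ^ i - 1 ≤ t * (4 : ℝ)⁻¹ ^ j := by
        have h4 : (4 : ℝ) ^ (j + i) * (4 : ℝ)⁻¹ ^ j = 4 ^ i := by
          rw [pow_add, inv_pow]; field_simp
        have h5 : (4 : ℝ)⁻¹ ^ j ≤ 1 := pow_le_one₀ (by norm_num) (by norm_num)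
        have h6 : (4 : ℝ) ^ (j + i) * (4 : ℝ)⁻¹ ^ j ≤ (1 + t) * (4 : ℝ)⁻¹ ^ j := by gcongr
        linarith
      -- The factor e^δ pays for the difference between t and 1 + t.
      have h4 : Real.exp (-(δ * t * (4 : ℝ)⁻¹ ^ j)) ≤ Real.exp δ * Real.exp (-(δ * 4 ^ i)) := by
        rw [← Real.exp_add, Real.exp_le_exp]
        nlinarith
      have h5 : Real.exp (-(δ * 4 ^ i)) ≤ K.factorial / δ ^ K * ((4 ^ K : ℝ)⁻¹) ^ i := by
        have h6 := Real.pow_div_factorial_le_exp (x := δ * 4 ^ i) (by positivity) K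
        rw [Real.exp_neg]
        have h7 : K.factorial / δ ^ K * ((4 ^ K : ℝ)⁻¹) ^ i =
            ((δ * 4 ^ i) ^ K / (K.factorial : ℝ))⁻¹ := by
          rw [inv_div, mul_pow, inv_pow, ← pow_mul, ← pow_mul, mul_comm i K]
          field_simp
        rw [h7]
        exact inv_anti₀ (by positivity) h6
      have h6 : a ^ j * ((4 ^ K : ℝ)⁻¹) ^ i ≤ a ^ (j + i) * (1 / 2) ^ i := by
        rw [pow_add, mul_assoc, ← mul_pow]
        gcongr
        rw [inv_le_iff_one_le_mul₀ (by positivity)]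
        linarith
      calc a ^ j * Real.exp (-(δ * t * (4 : ℝ)⁻¹ ^ j))
          ≤ a ^ j * (Real.exp δ * (K.factorial / δ ^ K * ((4 ^ K : ℝ)⁻¹) ^ i)) := by
            gcongr
            exact h4.trans (by gcongr)
        _ = Real.exp δ * (K.factorial / δ ^ K) * (a ^ j * ((4 ^ K : ℝ)⁻¹) ^ i) := by ring
        _ ≤ C₁ * (a ^ (j + i) * b ^ i) := by
            refine mul_le_mul (le_max_right _ _) (h6.trans ?_) (by positivity) hC₁0.le
            exact mul_le_mul_of_nonneg_left
              (pow_le_pow_left₀ (by norm_num) (le_max_right _ _) _) (by positivity)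
        _ = _ := by ring
  refine ENNReal.tsum_le_of_sum_range_le fun N => ?_
  rw [← ENNReal.ofReal_sum_of_nonneg fun _ _ => by positivity]
  refine ENNReal.ofReal_le_ofReal ?_
  calc _ ≤ ∑ j ∈ Finset.range N, C₁ * a ^ J * b ^ ((j - J) + (J - j)) :=
        Finset.sum_le_sum fun j _ => hterm j
    _ = C₁ * a ^ J * ∑ j ∈ Finset.range N, b ^ ((j - J) + (J - j)) := by rw [Finset.mul_sum]
    _ ≤ C₁ * ((1 + t) ^ (-(ε / 2)) / a) * (2 / (1 - b)) := by
        gcongr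
        exact sum_pow_dist_le hb0 hb1 J N
    _ = _ := by ring

end HypSys

namespace HypSys

open SchwartzMap FourierTransform LineDeriv

variable {n m k : ℕ}

/-! ### Dominated convergence and decompositions in `L²` -/

lemma tendsto_eLpNorm_two_of_dominated {α E ι : Type*} [MeasurableSpace α] {μ : Measure α}
    [NormedAddCommGroup E] {l : Filter ι} [l.IsCountablyGenerated] {F : ι → α → E} {f : α → E}
    {g : α → ℝ} (hF : ∀ᶠ i in l, AEStronglyMeasurable (F i) μ) (hf : AEStronglyMeasurable f μ)
    (hg : MemLp g 2 μ) (hb : ∀ᶠ i in l, ∀ᵐ x ∂μ, ‖F i x - f x‖ ≤ g x)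
    (hlim : ∀ᵐ x ∂μ, Tendsto (fun i => F i x) l (𝓝 (f x))) :
    Tendsto (fun i => eLpNorm (F i - f) 2 μ) l (𝓝 0) := by
  have h1 : Tendsto (fun i => ∫⁻ x, ‖F i x - f x‖ₑ ^ (2 : ℝ) ∂μ) l (𝓝 (∫⁻ _, 0 ∂μ)) := by
    refine tendsto_lintegral_filter_of_dominated_convergence' (fun x => ‖g x‖ₑ ^ (2 : ℝ)) ?_ ?_ ?_ ?_
    · filter_upwards [hF] with i hi
      exact (hi.sub hf).enorm.pow_const _
    · filter_upwards [hb] with i hi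
      filter_upwards [hi] with x hx
      gcongr
      rw [← ofReal_norm, ← ofReal_norm]
      exact ENNReal.ofReal_le_ofReal (hx.trans (le_abs_self _))
    · have := (eLpNorm_lt_top_iff_lintegral_rpow_enorm_lt_top (by norm_num) (by norm_num)).1 hg.2
      simpa using this.ne
    · filter_upwards [hlim] with x hx
      have h2 : Tendsto (fun i => ‖F i x - f x‖ₑ) l (𝓝 0) := by
        have := (hx.sub_const (f x)).enorm
        simpa using this
      have := (ENNReal.continuous_rpow_const (y := 2)).tendsto 0 |>.comp h2
      simpa [Function.comp_def] using this
  have h2 := (ENNReal.continuous_rpow_const (y := (1 / 2 : ℝ))).tendsto _ |>.comp h1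
  simp only [lintegral_zero] at h2
  rw [ENNReal.zero_rpow_of_pos (by norm_num)] at h2
  refine h2.congr fun i => ?_
  rw [eLpNorm_eq_lintegral_rpow_enorm_toReal (by norm_num) (by norm_num)]
  simp

/-- The union of the first `N` members of a sequence of sets. -/
def firstUnion {α : Type*} (Ω : ℕ → Set α) (N : ℕ) : Set α := ⋃ j ∈ Finset.range N, Ω j

lemma mem_firstUnion {α : Type*} {Ω : ℕ → Set α} {N : ℕ} {x : α} :
    x ∈ firstUnion Ω N ↔ ∃ j < N, x ∈ Ω j := by
  simp [firstUnion]

lemma measurableSet_firstUnion {α : Type*} [MeasurableSpace α] {Ω : ℕ → Set α}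
    (hΩ : ∀ j, MeasurableSet (Ω j)) (N : ℕ) : MeasurableSet (firstUnion Ω N) :=
  Finset.measurableSet_biUnion _ fun j _ => hΩ j

lemma indicator_firstUnion_succ {α E : Type*} [AddCommMonoid E] {Ω : ℕ → Set α}
    (hd : Pairwise (Function.onFun Disjoint Ω)) (N : ℕ) (u : α → E) :
    (firstUnion Ω (N + 1)).indicator u =
      (firstUnion Ω N).indicator u + (Ω N).indicator u := by
  have h1 : firstUnion Ω (N + 1) = firstUnion Ω N ∪ Ω N := by
    ext x
    simp only [Set.mem_union, mem_firstUnion, Order.lt_add_one_iff, le_iff_lt_or_eq]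
    constructor
    · rintro ⟨j, hj | rfl, hx⟩
      · exact Or.inl ⟨j, hj, hx⟩
      · exact Or.inr hx
    · rintro (⟨j, hj, hx⟩ | hx)
      · exact ⟨j, Or.inl hj, hx⟩
      · exact ⟨N, Or.inr rfl, hx⟩
  have h2 : Disjoint (firstUnion Ω N) (Ω N) := by
    simp only [firstUnion, Set.disjoint_iUnion_left]
    intro j hj
    exact hd (Finset.mem_range.1 hj).ne
  rw [h1, Set.indicator_union_of_disjoint h2]
  rfl

lemma tendsto_indicator_firstUnion {α E : Type*} [AddCommMonoid E] [TopologicalSpace E]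
    {Ω : ℕ → Set α} {u : α → E} {x : α} (hx : u x ≠ 0 → ∃ j, x ∈ Ω j) :
    Tendsto (fun N => (firstUnion Ω N).indicator u x) atTop (𝓝 (u x)) := by
  by_cases h0 : u x = 0
  · rw [h0]
    refine tendsto_const_nhds.congr fun N => ?_
    rw [Set.indicator_apply_eq_zero.2 fun _ => h0]
  · obtain ⟨j, hj⟩ := hx h0
    refine tendsto_const_nhds.congr' ?_
    filter_upwards [eventually_gt_atTop j] with N hN
    rw [Set.indicator_of_mem (mem_firstUnion.2 ⟨j, hN, hj⟩)]

lemma eLpNorm_two_le_of_firstUnion {Ω : ℕ → Set (Rn n)} (hΩ : ∀ j, MeasurableSet (Ω j))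
    {u : Rn n → Cm m} (hu : AEStronglyMeasurable u volume)
    (hs : ∀ᵐ x, u x ≠ 0 → ∃ j, x ∈ Ω j) {B : ℝ≥0∞}
    (hB : ∀ N, eLpNorm ((firstUnion Ω N).indicator u) 2 volume ≤ B) :
    eLpNorm u 2 volume ≤ B := by
  refine (Lp.eLpNorm_lim_le_liminf_eLpNorm
    (fun N => hu.indicator (measurableSet_firstUnion hΩ N)) u ?_).trans ?_
  · filter_upwards [hs] with x hx
    exact tendsto_indicator_firstUnion hx
  · exact (liminf_le_liminf (Eventually.of_forall hB)).trans (by simp)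

lemma eLpNorm_firstUnion_le {Ω : ℕ → Set (Rn n)} (hΩ : ∀ j, MeasurableSet (Ω j))
    (hd : Pairwise (Function.onFun Disjoint Ω)) {u : Rn n → Cm m}
    (hu : AEStronglyMeasurable u volume) (N : ℕ) :
    eLpNorm ((firstUnion Ω N).indicator u) 2 volume ≤
      ∑ j ∈ Finset.range N, eLpNorm ((Ω j).indicator u) 2 volume := by
  induction N with
  | zero => simp [firstUnion]
  | succ N ih =>
    rw [indicator_firstUnion_succ hd, Finset.sum_range_succ]
    exact (eLpNorm_add_le (hu.indicator (measurableSet_firstUnion hΩ N)) (hu.indicator (hΩ N))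
      (by norm_num)).trans (add_le_add_left ih _)

lemma eLpNorm_invFourier_firstUnion_le {Ω : ℕ → Set (Rn n)} (hΩ : ∀ j, MeasurableSet (Ω j))
    (hd : Pairwise (Function.onFun Disjoint Ω)) (hfin : ∀ j, volume (Ω j) ≠ ⊤) {u : Rn n → Cm m}
    (hu : MemLp u 2 volume) {p : ℝ≥0∞} (hp : 2 ≤ p) (N : ℕ) :
    eLpNorm (invFourier (hu.indicator (measurableSet_firstUnion hΩ N))) p volume ≤
      ∑ j ∈ Finset.range N,
        volume (Ω j) ^ (1 / 2 - (p⁻¹).toReal) * eLpNorm ((Ω j).indicator u) 2 volume := by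
  induction N with
  | zero =>
    have h := eLpNorm_invFourier_le_of_support (hu.indicator (measurableSet_firstUnion hΩ 0))
      MeasurableSet.empty (by simp) (fun x _ => by simp [firstUnion]) hp
    refine h.trans ?_
    simp [firstUnion]
  | succ N ih =>
    rw [Finset.sum_range_succ]
    have e := (invFourier_congr (hu.indicator (measurableSet_firstUnion hΩ (N + 1)))
      ((hu.indicator (measurableSet_firstUnion hΩ N)).add (hu.indicator (hΩ N)))
      (indicator_firstUnion_succ hd N u).eventuallyEq)
    rw [e, eLpNorm_congr_ae (invFourier_add (hu.indicator (measurableSet_firstUnion hΩ N))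
      (hu.indicator (hΩ N)))]
    refine (eLpNorm_add_le (memLp_invFourier _).1 (memLp_invFourier _).1
      (le_trans (by norm_num) hp)).trans (add_le_add ih ?_)
    exact eLpNorm_invFourier_le_of_support (hu.indicator (hΩ N)) (hΩ N) (hfin N)
      (fun x hx => Set.indicator_of_notMem hx _) hp

/-- The partial sums over shells converge only in `L²`; a subsequence converges almost everywhere,
and Fatou's lemma carries the `L^p` bound to the limit. -/
lemma eLpNorm_invFourier_le_tsum {Ω : ℕ → Set (Rn n)} (hΩ : ∀ j, MeasurableSet (Ω j))
    (hd : Pairwise (Function.onFun Disjoint Ω)) (hfin : ∀ j, volume (Ω j) ≠ ⊤) {u : Rn n → Cm m}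
    (hu : MemLp u 2 volume) (hs : ∀ᵐ x, u x ≠ 0 → ∃ j, x ∈ Ω j) {p : ℝ≥0∞} (hp : 2 ≤ p) :
    eLpNorm (invFourier hu) p volume ≤
      ∑' j, volume (Ω j) ^ (1 / 2 - (p⁻¹).toReal) * eLpNorm ((Ω j).indicator u) 2 volume := by
  set U : ℕ → Rn n → Cm m :=
    fun N => invFourier (hu.indicator (measurableSet_firstUnion hΩ N)) with hU
  have h1 : Tendsto (fun N => eLpNorm (U N - invFourier hu) 2 volume) atTop (𝓝 0) := by
    have h2 := tendsto_eLpNorm_two_of_dominated (l := atTop)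
      (F := fun N => (firstUnion Ω N).indicator u) (f := u) (g := fun x => ‖u x‖)
      (Eventually.of_forall fun N => hu.1.indicator (measurableSet_firstUnion hΩ N)) hu.1 hu.norm
      (Eventually.of_forall fun N => ae_of_all _ fun x => by
        by_cases hx : x ∈ firstUnion Ω N
        · simp [Set.indicator_of_mem hx]
        · simp [Set.indicator_of_notMem hx])
      (by filter_upwards [hs] with x hx; exact tendsto_indicator_firstUnion hx)
    refine h2.congr fun N => ?_
    rw [hU, ← eLpNorm_congr_ae (invFourier_sub (hu.indicator (measurableSet_firstUnion hΩ N)) hu),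
      eLpNorm_invFourier]
  obtain ⟨ns, hns, hae⟩ := (tendstoInMeasure_of_tendsto_eLpNorm (by norm_num)
    (fun N => (memLp_invFourier _).1) (memLp_invFourier hu).1 h1).exists_seq_tendsto_ae
  refine (Lp.eLpNorm_lim_le_liminf_eLpNorm (fun N => (memLp_invFourier _).1) _ hae).trans ?_
  refine (liminf_le_liminf (Eventually.of_forall fun N =>
    (eLpNorm_invFourier_firstUnion_le hΩ hd hfin hu hp (ns N)).trans
      (ENNReal.sum_le_tsum _))).trans (by simp)

/-! ### Functions controlled on dyadic shells -/

/-- `u` lives on the disjoint sets `Ω j` of measure at most `ν 2^{dj}`, on which it is dominated by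
`2^{-wj} e^{-δt4^{-j}} ∑ |v_b|`, where the `v_b` behave like Fourier transforms of functions in
`L^q` with norms `N_b`. -/
structure DyadicControl {B : Type*} [Fintype B] (d ν M δ w t : ℝ) (q : ℝ≥0∞) (Ω : ℕ → Set (Rn n))
    (u : Rn n → Cm m) (v : B → Rn n → Cm m) (N : B → ℝ≥0∞) : Prop where
  meas : ∀ j, MeasurableSet (Ω j)
  disj : Pairwise (Function.onFun Disjoint Ω)
  vol : ∀ j, volume (Ω j) ≤ ENNReal.ofReal (ν * (2 : ℝ) ^ (d * j))
  aesm : AEStronglyMeasurable u volume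
  supp : ∀ᵐ x, u x ≠ 0 → ∃ j, x ∈ Ω j
  bound : ∀ᵐ x, ∀ j, x ∈ Ω j →
    ‖u x‖ ≤ M * ((2 : ℝ) ^ (-(w * j)) * Real.exp (-(δ * t * (4 : ℝ)⁻¹ ^ j))) * ∑ b, ‖v b x‖
  aesm' : ∀ b, AEStronglyMeasurable (v b) volume
  norm_le : ∀ b, ∀ s : Set (Rn n), MeasurableSet s → volume s ≠ ⊤ →
    eLpNorm (s.indicator (v b)) 2 volume ≤ volume s ^ ((q⁻¹).toReal - 1 / 2) * N b

lemma eLpNorm_indicator_le_sum {B : Type*} [Fintype B] {s : Set (Rn n)} (hs : MeasurableSet s)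
    {u : Rn n → Cm m} {v : B → Rn n → Cm m} {a : ℝ}
    (hb : ∀ᵐ x, x ∈ s → ‖u x‖ ≤ a * ∑ b, ‖v b x‖)
    (hv : ∀ b, AEStronglyMeasurable (v b) volume) :
    eLpNorm (s.indicator u) 2 volume ≤
      ENNReal.ofReal a * ∑ b, eLpNorm (s.indicator (v b)) 2 volume := by
  have h1 : eLpNorm (s.indicator u) 2 volume ≤
      ENNReal.ofReal a * eLpNorm (∑ b, fun x => ‖s.indicator (v b) x‖) 2 volume := by
    refine eLpNorm_le_mul_eLpNorm_of_ae_le_mul ?_ 2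
    filter_upwards [hb] with x hx
    rw [Finset.sum_apply, Real.norm_of_nonneg (Finset.sum_nonneg fun _ _ => norm_nonneg _)]
    by_cases hxs : x ∈ s
    · simp only [Set.indicator_of_mem hxs]
      exact hx hxs
    · simp [Set.indicator_of_notMem hxs]
  refine h1.trans ?_
  gcongr
  refine (eLpNorm_sum_le (fun b _ => ((hv b).indicator hs).norm) (by norm_num)).trans ?_
  simp only [eLpNorm_norm, le_refl]

lemma inv_toReal_le_half {p : ℝ≥0∞} (hp : 2 ≤ p) : (p⁻¹).toReal ≤ 1 / 2 := by
  have := ENNReal.toReal_mono (by simp) (ENNReal.inv_le_inv.2 hp)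
  simpa using this

lemma half_le_inv_toReal {q : ℝ≥0∞} (hq1 : 1 ≤ q) (hq : q ≤ 2) : 1 / 2 ≤ (q⁻¹).toReal := by
  have := ENNReal.toReal_mono (by simpa using (lt_of_lt_of_le one_pos hq1).ne')
    (ENNReal.inv_le_inv.2 hq)
  simpa using this

namespace DyadicControl

variable {B : Type*} [Fintype B] {d ν M δ w t : ℝ} {q : ℝ≥0∞} {Ω : ℕ → Set (Rn n)}
  {u : Rn n → Cm m} {v : B → Rn n → Cm m} {N : B → ℝ≥0∞}

lemma vol_ne_top (h : DyadicControl d ν M δ w t q Ω u v N) (j : ℕ) : volume (Ω j) ≠ ⊤ :=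
  ((h.vol j).trans_lt ENNReal.ofReal_lt_top).ne

/-- The Bernstein exponent 1/2 - 1/p and the Fourier exponent 1/q - 1/2 add up to 1/q - 1/p, and the
measure of the shell supplies the power of 2ʲ. -/
lemma eLpNorm_shell_le (h : DyadicControl d ν M δ w t q Ω u v N) (hν : 0 ≤ ν) (hM : 0 ≤ M)
    {p : ℝ≥0∞} (hp : 2 ≤ p) (hq1 : 1 ≤ q) (hq : q ≤ 2) (j : ℕ) :
    volume (Ω j) ^ (1 / 2 - (p⁻¹).toReal) * eLpNorm ((Ω j).indicator u) 2 volume ≤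
      ENNReal.ofReal (M * ν ^ ((q⁻¹).toReal - (p⁻¹).toReal)) * (∑ b, N b) *
      ENNReal.ofReal ((2 : ℝ) ^ (-((w - d * ((q⁻¹).toReal - (p⁻¹).toReal)) * j)) *
        Real.exp (-(δ * t * (4 : ℝ)⁻¹ ^ j))) := by
  have hP := inv_toReal_le_half hp
  have hQ := half_le_inv_toReal hq1 hq
  set e := (q⁻¹).toReal - (p⁻¹).toReal with he
  set a := M * ((2 : ℝ) ^ (-(w * j)) * Real.exp (-(δ * t * (4 : ℝ)⁻¹ ^ j))) with ha
  have ha0 : 0 ≤ a := by positivity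
  have h1 := eLpNorm_indicator_le_sum (h.meas j) (h.bound.mono fun x hx => hx j) h.aesm'
  calc _ ≤ volume (Ω j) ^ (1 / 2 - (p⁻¹).toReal) * (ENNReal.ofReal a *
        ∑ b, volume (Ω j) ^ ((q⁻¹).toReal - 1 / 2) * N b) := by
        gcongr
        refine h1.trans ?_
        gcongr with b
        exact h.norm_le b _ (h.meas j) (h.vol_ne_top j)
    _ = ENNReal.ofReal a * (volume (Ω j) ^ e * ∑ b, N b) := by
        rw [← Finset.mul_sum, mul_left_comm, ← mul_assoc (volume (Ω j) ^ _),
          ← ENNReal.rpow_add_of_nonneg _ _ (by linarith) (by linarith),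
          show 1 / 2 - (p⁻¹).toReal + ((q⁻¹).toReal - 1 / 2) = e by rw [he]; ring]
    _ ≤ ENNReal.ofReal a * (ENNReal.ofReal (ν * (2 : ℝ) ^ (d * j)) ^ e * ∑ b, N b) := by
        gcongr
        · linarith
        · exact h.vol j
    _ = ENNReal.ofReal (a * (ν * (2 : ℝ) ^ (d * j)) ^ e) * ∑ b, N b := by
        rw [ENNReal.ofReal_rpow_of_nonneg (by positivity) (by linarith), ENNReal.ofReal_mul ha0,
          mul_assoc]
    _ = _ := by
        rw [mul_right_comm (ENNReal.ofReal _), ← ENNReal.ofReal_mul (by positivity)]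
        congr 2
        rw [Real.mul_rpow hν (by positivity), ← Real.rpow_mul (by norm_num), ha,
          show -((w - d * e) * j) = -(w * j) + d * j * e by ring, Real.rpow_add (by norm_num)]
        ring

/-- At the endpoint the series over shells would diverge, but the measure exponent is zero, so all
shells can be treated at once. -/
lemma eLpNorm_two_le (h : DyadicControl d ν M δ 0 t 2 Ω u v N) (hM : 0 ≤ M) (hδ : 0 ≤ δ)
    (ht : 0 ≤ t) : eLpNorm u 2 volume ≤ ENNReal.ofReal M * ∑ b, N b := by
  refine eLpNorm_two_le_of_firstUnion h.meas h.aesm h.supp fun K => ?_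
  have hm := measurableSet_firstUnion h.meas K
  refine (eLpNorm_indicator_le_sum hm (a := M) ?_ h.aesm').trans ?_
  · filter_upwards [h.bound] with x hx hxK
    obtain ⟨j, _, hj⟩ := mem_firstUnion.1 hxK
    refine (hx j hj).trans ?_
    have h1 : Real.exp (-(δ * t * (4 : ℝ)⁻¹ ^ j)) ≤ 1 :=
      Real.exp_le_one_iff.2 (neg_nonpos.2 (by positivity))
    have h2 : 0 ≤ ∑ b, ‖v b x‖ := Finset.sum_nonneg fun _ _ => norm_nonneg _
    simp only [zero_mul, neg_zero, Real.rpow_zero, one_mul]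
    gcongr
    exact mul_le_of_le_one_right hM h1
  · gcongr with b
    have hfin : volume (firstUnion Ω K) ≠ ⊤ :=
      (measure_biUnion_lt_top (Finset.finite_toSet _) fun j _ => (h.vol_ne_top j).lt_top).ne
    refine (h.norm_le b _ hm hfin).trans_eq ?_
    norm_num

end DyadicControl

/-- The basic decay estimate for functions controlled on dyadic shells. -/
theorem exists_dyadicControl_bound {d ν M δ w : ℝ} (hν : 0 ≤ ν) (hM : 0 ≤ M) (hδ : 0 < δ)
    {p q : ℝ≥0∞} (hp : 2 ≤ p) (hq1 : 1 ≤ q) (hq : q ≤ 2)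
    (h : 0 < w - d * ((q⁻¹).toReal - (p⁻¹).toReal) ∨ (p = 2 ∧ q = 2 ∧ w = 0)) :
    ∃ C > 0, ∀ t : ℝ, 0 ≤ t → ∀ {n m : ℕ} {B : Type} [Fintype B] {Ω : ℕ → Set (Rn n)}
      {u : Rn n → Cm m} {v : B → Rn n → Cm m} {N : B → ℝ≥0∞},
      DyadicControl d ν M δ w t q Ω u v N →
      (p = 2 → eLpNorm u 2 volume ≤
        ENNReal.ofReal (C * (1 + t) ^ (-((w - d * ((q⁻¹).toReal - (p⁻¹).toReal)) / 2))) *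
          ∑ b, N b) ∧
      ∀ hu : MemLp u 2 volume, eLpNorm (invFourier hu) p volume ≤
        ENNReal.ofReal (C * (1 + t) ^ (-((w - d * ((q⁻¹).toReal - (p⁻¹).toReal)) / 2))) *
          ∑ b, N b := by
  rcases h with hε | ⟨rfl, rfl, rfl⟩
  · set e := (q⁻¹).toReal - (p⁻¹).toReal with he
    obtain ⟨C, hC, hsum⟩ := exists_dyadic_sum_le hε hδ
    -- The added 1 keeps the constant positive when M or ν vanishes.
    refine ⟨(M * ν ^ e + 1) * C, by positivity, fun t ht n m B _ Ω u v N h => ?_⟩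
    have key : ∑' j, volume (Ω j) ^ (1 / 2 - (p⁻¹).toReal) *
        eLpNorm ((Ω j).indicator u) 2 volume ≤
        ENNReal.ofReal ((M * ν ^ e + 1) * C * (1 + t) ^ (-((w - d * e) / 2))) * ∑ b, N b := by
      refine (ENNReal.tsum_le_tsum fun j => h.eLpNorm_shell_le hν hM hp hq1 hq j).trans ?_
      rw [ENNReal.tsum_mul_left, mul_right_comm, mul_assoc ((M * ν ^ e + 1)),
        ENNReal.ofReal_mul (show 0 ≤ M * ν ^ e + 1 by positivity)]
      gcongr
      · linarith
      · exact hsum t ht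
    refine ⟨?_, fun hu => (eLpNorm_invFourier_le_tsum h.meas h.disj h.vol_ne_top hu h.supp
      hp).trans key⟩
    -- This clause does not presuppose that u is square integrable, so it can be used to prove that
    -- it is.
    rintro rfl
    refine le_trans ?_ key
    refine eLpNorm_two_le_of_firstUnion h.meas h.aesm h.supp fun K => ?_
    refine (eLpNorm_firstUnion_le h.meas h.disj h.aesm K).trans ?_
    refine le_trans (Finset.sum_le_sum fun j _ => ?_) (ENNReal.sum_le_tsum (Finset.range K))
    norm_num
  · refine ⟨M + 1, by positivity, fun t ht n m B _ Ω u v N h => ?_⟩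
    have key : eLpNorm u 2 volume ≤ ENNReal.ofReal ((M + 1) *
        (1 + t) ^ (-((0 - d * (((2 : ℝ≥0∞)⁻¹).toReal - ((2 : ℝ≥0∞)⁻¹).toReal)) / 2))) *
          ∑ b, N b := by
      refine (h.eLpNorm_two_le hM hδ.le ht).trans ?_
      gcongr
      simp
    exact ⟨fun _ => key, fun hu => (eLpNorm_invFourier hu).trans_le key⟩

end HypSys

namespace HypSys

open SchwartzMap FourierTransform LineDeriv

variable {n m k : ℕ}

/-! ### Low and high frequencies -/

lemma two_rpow_mul_natCast (a j : ℕ) : (2 : ℝ) ^ ((a : ℝ) * j) = ((2 : ℝ) ^ j) ^ a := by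
  rw [mul_comm, ← Nat.cast_mul, Real.rpow_natCast, pow_mul]

lemma two_rpow_neg_mul_natCast (a j : ℕ) :
    (2 : ℝ) ^ (-((a : ℝ) * j)) = ((1 / 2 : ℝ) ^ j) ^ a := by
  rw [Real.rpow_neg (by norm_num), two_rpow_mul_natCast, one_div, inv_pow, inv_pow]

lemma volume_ball_le (n : ℕ) {r : ℝ} (hr : 0 < r) :
    volume (Metric.ball (0 : Rn n) r) ≤
      ENNReal.ofReal ((volume (Metric.ball (0 : Rn n) 1)).toReal * r ^ n) := by
  rw [Measure.addHaar_ball_of_pos _ _ hr, finrank_euclideanSpace_fin,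
    ENNReal.ofReal_mul ENNReal.toReal_nonneg, ENNReal.ofReal_toReal measure_ball_lt_top.ne, mul_comm]

/-- The shells `2^{-(j+1)} ≤ |ξ| < 2^{-j}`. -/
def lowShell (n j : ℕ) : Set (Rn n) := {ξ | (1 / 2 : ℝ) ^ (j + 1) ≤ ‖ξ‖ ∧ ‖ξ‖ < (1 / 2 : ℝ) ^ j}

/-- The shells `2^j ≤ |ξ| < 2^{j+1}`. -/
def highShell (n j : ℕ) : Set (Rn n) := {ξ | (2 : ℝ) ^ j ≤ ‖ξ‖ ∧ ‖ξ‖ < (2 : ℝ) ^ (j + 1)}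

lemma measurableSet_lowShell (n j : ℕ) : MeasurableSet (lowShell n j) :=
  (measurableSet_le measurable_const measurable_norm).inter
    (measurableSet_lt measurable_norm measurable_const)

lemma measurableSet_highShell (n j : ℕ) : MeasurableSet (highShell n j) :=
  (measurableSet_le measurable_const measurable_norm).inter
    (measurableSet_lt measurable_norm measurable_const)

lemma pairwise_disjoint_lowShell (n : ℕ) : Pairwise (Function.onFun Disjoint (lowShell n)) := by
  refine (pairwise_disjoint_on _).2 fun i j hij => Set.disjoint_left.2 fun ξ hi hj => ?_
  have : (1 / 2 : ℝ) ^ j ≤ (1 / 2) ^ (i + 1) :=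
    pow_le_pow_of_le_one (by norm_num) (by norm_num) hij
  linarith [hi.1, hj.2]

lemma pairwise_disjoint_highShell (n : ℕ) : Pairwise (Function.onFun Disjoint (highShell n)) := by
  refine (pairwise_disjoint_on _).2 fun i j hij => Set.disjoint_left.2 fun ξ hi hj => ?_
  have : (2 : ℝ) ^ (i + 1) ≤ 2 ^ j := pow_le_pow_right₀ (by norm_num) hij
  linarith [hi.2, hj.1]

lemma exists_mem_lowShell {ξ : Rn n} (h0 : ξ ≠ 0) (h1 : ‖ξ‖ < 1) : ∃ j, ξ ∈ lowShell n j := by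
  obtain ⟨j, hj1, hj2⟩ := exists_nat_pow_near_of_lt_one (norm_pos_iff.2 h0) h1.le
    (by norm_num : (0 : ℝ) < 1 / 2) (by norm_num)
  rcases hj2.lt_or_eq with h | h
  · exact ⟨j, hj1.le, h⟩
  · cases j with
    | zero => simp at h; exact absurd h h1.ne
    | succ j =>
      refine ⟨j, h.ge, ?_⟩
      rw [h]
      exact pow_lt_pow_right_of_lt_one₀ (by norm_num) (by norm_num) (Nat.lt_succ_self j)

lemma exists_mem_highShell {ξ : Rn n} (h1 : 1 ≤ ‖ξ‖) : ∃ j, ξ ∈ highShell n j :=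
  exists_nat_pow_near h1 one_lt_two

/-- Inside the unit ball the rate is comparable to ‖ξ‖² ~ 4⁻ʲ. The factor 16 is chosen to fit the
high shells as well. -/
lemma lowShell_decay {j : ℕ} {ξ : Rn n} (h : ξ ∈ lowShell n j) :
    (4 : ℝ)⁻¹ ^ j / 16 ≤ ‖ξ‖ ^ 2 / (1 + ‖ξ‖ ^ 2) ^ 2 := by
  have h1 : ‖ξ‖ ^ 2 ≤ 1 := pow_le_one₀ (norm_nonneg _)
    (h.2.le.trans (pow_le_one₀ (by norm_num) (by norm_num)))
  have h2 : (4 : ℝ)⁻¹ ^ j / 4 ≤ ‖ξ‖ ^ 2 := by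
    have := pow_le_pow_left₀ (by positivity) h.1 2
    calc (4 : ℝ)⁻¹ ^ j / 4 = ((1 / 2 : ℝ) ^ (j + 1)) ^ 2 := by
          rw [← pow_mul, mul_comm, pow_mul, pow_succ]; norm_num; ring
      _ ≤ _ := this
  rw [le_div_iff₀ (by positivity)]
  have h3 : (1 + ‖ξ‖ ^ 2) ^ 2 ≤ 4 := by nlinarith [sq_nonneg ‖ξ‖]
  have h4 : 0 < (4 : ℝ)⁻¹ ^ j := by positivity
  nlinarith

lemma highShell_decay {j : ℕ} {ξ : Rn n} (h : ξ ∈ highShell n j) :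
    (4 : ℝ)⁻¹ ^ j / 16 ≤ ‖ξ‖ ^ 2 / (1 + ‖ξ‖ ^ 2) ^ 2 := by
  have h1 : 1 ≤ ‖ξ‖ ^ 2 := one_le_pow₀ ((one_le_pow₀ one_le_two).trans h.1)
  have h2 : (4 : ℝ)⁻¹ ^ j * ‖ξ‖ ^ 2 ≤ 4 := by
    have := pow_le_pow_left₀ (norm_nonneg _) h.2.le 2
    calc (4 : ℝ)⁻¹ ^ j * ‖ξ‖ ^ 2 ≤ (4 : ℝ)⁻¹ ^ j * ((2 : ℝ) ^ (j + 1)) ^ 2 := by gcongr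
      _ = 4 := by
          rw [← pow_mul, mul_comm (j + 1), pow_mul, pow_succ, ← mul_assoc]
          norm_num [← mul_pow]
  rw [le_div_iff₀ (by positivity)]
  set a := (4 : ℝ)⁻¹ ^ j
  have h4 : 0 < a := by positivity
  have h3 : (1 + ‖ξ‖ ^ 2) ^ 2 ≤ 4 * (‖ξ‖ ^ 2 * ‖ξ‖ ^ 2) := by nlinarith
  calc a / 16 * (1 + ‖ξ‖ ^ 2) ^ 2 ≤ a / 16 * (4 * (‖ξ‖ ^ 2 * ‖ξ‖ ^ 2)) := by gcongr
    _ = (a * ‖ξ‖ ^ 2) * (‖ξ‖ ^ 2 / 4) := by ring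
    _ ≤ 4 * (‖ξ‖ ^ 2 / 4) := by gcongr
    _ = _ := by ring

lemma exp_decay_le {δ t a b : ℝ} (hδ : 0 < δ) (ht : 0 ≤ t) (h : a / 16 ≤ b) :
    Real.exp (-(δ * b) * t) ≤ Real.exp (-(δ / 16 * t * a)) := by
  rw [Real.exp_le_exp]
  have := mul_le_mul_of_nonneg_left h (mul_nonneg hδ.le ht)
  linarith

lemma eq_two_of_inv_toReal_eq {p : ℝ≥0∞} (h : (p⁻¹).toReal = 1 / 2) : p = 2 := by
  have h1 : p⁻¹ = 2⁻¹ := by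
    have : (p⁻¹).toReal = ((2 : ℝ≥0∞)⁻¹).toReal := by rw [h]; norm_num
    refine (ENNReal.toReal_eq_toReal_iff' (fun h0 => ?_) (by simp)).1 this
    rw [h0] at h; norm_num at h
  exact inv_injective h1

/-- Decay of the low frequencies. -/
theorem exists_lowFreq_bound (hn : 1 ≤ n) (m k : ℕ) {M δ : ℝ} (hM : 0 ≤ M) (hδ : 0 < δ)
    {p q : ℝ≥0∞} (hp : 2 ≤ p) (hq1 : 1 ≤ q) (hq : q ≤ 2) :
    ∃ C > 0, ∀ t : ℝ, 0 ≤ t → ∀ {u v : Rn n → Cm m} {N : ℝ≥0∞},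
      AEStronglyMeasurable u volume → AEStronglyMeasurable v volume →
      (∀ s : Set (Rn n), MeasurableSet s → volume s ≠ ⊤ →
        eLpNorm (s.indicator v) 2 volume ≤ volume s ^ ((q⁻¹).toReal - 1 / 2) * N) →
      (∀ᵐ ξ, ‖u ξ‖ ≤ M * Real.exp (-(δ * (‖ξ‖ ^ 2 / (1 + ‖ξ‖ ^ 2) ^ 2)) * t) * ‖ξ‖ ^ k * ‖v ξ‖) →
      (p = 2 → eLpNorm ((Metric.ball 0 1).indicator u) 2 volume ≤
        ENNReal.ofReal (C * (1 + t) ^ (-gamma2 n q p - (k : ℝ) / 2)) * N) ∧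
      ∀ hu : MemLp ((Metric.ball 0 1).indicator u) 2 volume, eLpNorm (invFourier hu) p volume ≤
        ENNReal.ofReal (C * (1 + t) ^ (-gamma2 n q p - (k : ℝ) / 2)) * N := by
  have hP := inv_toReal_le_half hp
  have hQ := half_le_inv_toReal hq1 hq
  have hn' : (1 : ℝ) ≤ n := by exact_mod_cast hn
  -- The gain k + n(1/q - 1/p) vanishes only if k = 0 and p = q; since q ≤ 2 ≤ p, both exponents are
  -- then 2.
  have hcase : 0 < (k : ℝ) - (-(n : ℝ)) * ((q⁻¹).toReal - (p⁻¹).toReal) ∨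
      (p = 2 ∧ q = 2 ∧ (k : ℝ) = 0) := by
    by_cases h1 : (q⁻¹).toReal - (p⁻¹).toReal = 0
    · rcases Nat.eq_zero_or_pos k with h2 | h2
      · exact Or.inr ⟨eq_two_of_inv_toReal_eq (by linarith), eq_two_of_inv_toReal_eq (by linarith),
          by exact_mod_cast h2⟩
      · left
        rw [h1, mul_zero, sub_zero]
        exact_mod_cast h2
    · left
      have h2 : 0 < (q⁻¹).toReal - (p⁻¹).toReal := lt_of_le_of_ne (by linarith) (Ne.symm h1)
      have : (0 : ℝ) ≤ k := by positivity
      nlinarith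
  obtain ⟨C, hC, hb⟩ := exists_dyadicControl_bound (d := -(n : ℝ)) (w := k)
    (ν := (volume (Metric.ball (0 : Rn n) 1)).toReal) ENNReal.toReal_nonneg hM
    (by positivity : 0 < δ / 16) hp hq1 hq hcase
  refine ⟨C, hC, fun t ht u v N hu hv hN hb' => ?_⟩
  have hdc : DyadicControl (B := Unit) (-(n : ℝ)) (volume (Metric.ball (0 : Rn n) 1)).toReal M
      (δ / 16) k t q (lowShell n) ((Metric.ball 0 1).indicator u) (fun _ => v) (fun _ => N) := by
    refine ⟨measurableSet_lowShell n, pairwise_disjoint_lowShell n, fun j => ?_,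
      hu.indicator measurableSet_ball, ?_, ?_, fun _ => hv, fun _ => hN⟩
    · refine le_trans (measure_mono fun ξ hξ => ?_) ((volume_ball_le n (by positivity :
        (0 : ℝ) < (1 / 2) ^ j)).trans_eq ?_)
      · simpa using hξ.2
      · rw [neg_mul, two_rpow_neg_mul_natCast]
    · have : Nonempty (Fin n) := ⟨⟨0, hn⟩⟩
      -- The origin lies in no shell; it is a null set because n ≥ 1.
      have h0 : ∀ᵐ ξ : Rn n, ξ ≠ 0 := by
        simp [ae_iff]
      filter_upwards [h0] with ξ hξ h
      have hm := Set.mem_of_indicator_ne_zero h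
      exact exists_mem_lowShell hξ (by simpa using hm)
    · filter_upwards [hb'] with ξ hξ j hj
      have h1 : ‖(Metric.ball 0 1).indicator u ξ‖ ≤ ‖u ξ‖ := norm_indicator_le_norm_self _ _
      refine h1.trans (hξ.trans ?_)
      rw [two_rpow_neg_mul_natCast]
      have h2 := exp_decay_le hδ ht (lowShell_decay hj)
      have h3 : ‖ξ‖ ^ k ≤ ((1 / 2 : ℝ) ^ j) ^ k := pow_le_pow_left₀ (norm_nonneg _) hj.2.le k
      simp only [Finset.univ_unique, Finset.sum_const, Finset.card_singleton, one_smul]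
      rw [mul_assoc M, mul_comm (Real.exp _) (‖ξ‖ ^ k)]
      gcongr
  have := hb t ht hdc
  have e : -(((k : ℝ) - (-(n : ℝ)) * ((q⁻¹).toReal - (p⁻¹).toReal)) / 2) =
      -gamma2 n q p - (k : ℝ) / 2 := by rw [gamma2]; ring
  rw [e] at this
  simpa using this

/-- Decay of the high frequencies, with a loss of `ℓ` derivatives. -/
theorem exists_highFreq_bound (n m k ℓ : ℕ) {M δ : ℝ} (hM : 0 ≤ M) (hδ : 0 < δ)
    {p r : ℝ≥0∞} (hp : 2 ≤ p) (hr1 : 1 ≤ r) (hr : r ≤ 2)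
    (hℓ : (n : ℝ) * ((r⁻¹).toReal - (p⁻¹).toReal) < (ℓ : ℝ) ∨ (p = 2 ∧ r = 2)) :
    ∃ C > 0, ∀ t : ℝ, 0 ≤ t → ∀ {B : Type} [Fintype B] {u : Rn n → Cm m} {h : Rn n → ℝ}
      {v : B → Rn n → Cm m} {N : B → ℝ≥0∞},
      AEStronglyMeasurable u volume → (∀ b, AEStronglyMeasurable (v b) volume) →
      (∀ b, ∀ s : Set (Rn n), MeasurableSet s → volume s ≠ ⊤ →
        eLpNorm (s.indicator (v b)) 2 volume ≤ volume s ^ ((r⁻¹).toReal - 1 / 2) * N b) →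
      (∀ᵐ ξ, ‖u ξ‖ ≤ M * Real.exp (-(δ * (‖ξ‖ ^ 2 / (1 + ‖ξ‖ ^ 2) ^ 2)) * t) * ‖ξ‖ ^ k * h ξ) →
      (∀ᵐ ξ, 0 ≤ h ξ ∧ ‖ξ‖ ^ (k + ℓ) * h ξ ≤ ∑ b, ‖v b ξ‖) →
      (p = 2 → eLpNorm ((Metric.ball 0 1)ᶜ.indicator u) 2 volume ≤
        ENNReal.ofReal (C * (1 + t) ^ (-(ℓ : ℝ) / 2 + gamma2 n r p)) * ∑ b, N b) ∧
      ∀ hu : MemLp ((Metric.ball 0 1)ᶜ.indicator u) 2 volume, eLpNorm (invFourier hu) p volume ≤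
        ENNReal.ofReal (C * (1 + t) ^ (-(ℓ : ℝ) / 2 + gamma2 n r p)) * ∑ b, N b := by
  have hcase : 0 < (ℓ : ℝ) - (n : ℝ) * ((r⁻¹).toReal - (p⁻¹).toReal) ∨
      (p = 2 ∧ r = 2 ∧ (ℓ : ℝ) = 0) := by
    rcases hℓ with h | ⟨rfl, rfl⟩
    · left; linarith
    · rcases Nat.eq_zero_or_pos ℓ with h2 | h2
      · exact Or.inr ⟨rfl, rfl, by exact_mod_cast h2⟩
      · left
        rw [sub_self, mul_zero, sub_zero]
        exact_mod_cast h2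
  set κ := (volume (Metric.ball (0 : Rn n) 1)).toReal with hκ
  have hκ0 : 0 ≤ κ := ENNReal.toReal_nonneg
  obtain ⟨C, hC, hb⟩ := exists_dyadicControl_bound (d := n) (w := ℓ)
    -- The factor 2ⁿ arises because the outer radius of the shell is 2^(j+1).
    (ν := κ * 2 ^ n) (by positivity) hM (by positivity : 0 < δ / 16) hp hr1 hr hcase
  refine ⟨C, hC, fun t ht B _ u h v N hu hv hN hb' hh => ?_⟩
  have hdc : DyadicControl (n : ℝ) (κ * 2 ^ n) M
      (δ / 16) ℓ t r (highShell n) ((Metric.ball 0 1)ᶜ.indicator u) v N := by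
    refine ⟨measurableSet_highShell n, pairwise_disjoint_highShell n, fun j => ?_,
      hu.indicator measurableSet_ball.compl, ?_, ?_, hv, hN⟩
    · refine le_trans (measure_mono fun ξ hξ => ?_) ((volume_ball_le n (by positivity :
        (0 : ℝ) < 2 ^ (j + 1))).trans_eq ?_)
      · simpa using hξ.2
      · rw [two_rpow_mul_natCast, pow_succ, mul_pow, mul_assoc, mul_comm (2 ^ n : ℝ)]
    · refine ae_of_all _ fun ξ h => ?_
      have hm := Set.mem_of_indicator_ne_zero h
      exact exists_mem_highShell (by simpa using hm)
    · filter_upwards [hb', hh] with ξ hξ hξh j hj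
      have h1 : ‖(Metric.ball 0 1)ᶜ.indicator u ξ‖ ≤ ‖u ξ‖ := norm_indicator_le_norm_self _ _
      refine h1.trans (hξ.trans ?_)
      rw [two_rpow_neg_mul_natCast]
      have h2 := exp_decay_le hδ ht (highShell_decay hj)
      have h0 : 0 < (2 : ℝ) ^ j := by positivity
      -- Here regularity becomes decay: on the shell ‖ξ‖^ℓ ≥ 2^(jℓ), so the ℓ additional derivatives
      -- of the data yield the weight 2^(-ℓj).
      have h3 : ‖ξ‖ ^ k * h ξ ≤ ((1 / 2 : ℝ) ^ j) ^ ℓ * ∑ b, ‖v b ξ‖ := by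
        have h4 : ((2 : ℝ) ^ j) ^ ℓ ≤ ‖ξ‖ ^ ℓ := pow_le_pow_left₀ h0.le hj.1 ℓ
        have h5 : ‖ξ‖ ^ k * h ξ * ((2 : ℝ) ^ j) ^ ℓ ≤ ∑ b, ‖v b ξ‖ := by
          refine le_trans ?_ hξh.2
          rw [pow_add, mul_right_comm]
          have := hξh.1
          gcongr
        rw [one_div, inv_pow, inv_pow, mul_comm (_⁻¹), ← div_eq_mul_inv,
          le_div_iff₀ (by positivity)]
        exact h5
      have h6 : 0 ≤ ‖ξ‖ ^ k * h ξ := mul_nonneg (by positivity) hξh.1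
      calc _ = M * (Real.exp (-(δ * (‖ξ‖ ^ 2 / (1 + ‖ξ‖ ^ 2) ^ 2)) * t) * (‖ξ‖ ^ k * h ξ)) := by
            ring
        _ ≤ M * (Real.exp (-(δ / 16 * t * (4 : ℝ)⁻¹ ^ j)) *
            (((1 / 2 : ℝ) ^ j) ^ ℓ * ∑ b, ‖v b ξ‖)) := by gcongr
        _ = _ := by ring
  have := hb t ht hdc
  have e : -(((ℓ : ℝ) - (n : ℝ) * ((r⁻¹).toReal - (p⁻¹).toReal)) / 2) =
      -(ℓ : ℝ) / 2 + gamma2 n r p := by rw [gamma2]; ring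
  rw [e] at this
  exact this

end HypSys

namespace HypSys

open SchwartzMap FourierTransform LineDeriv

variable {n m k : ℕ}

/-! ### Testing on the Fourier side -/

lemma rePart_op (X : Matrix (Fin m) (Fin m) ℝ) (v : Cm m) :
    rePart m (op X v) = Matrix.toEuclideanLin X (rePart m v) := by
  ext i
  simp [op_apply, toC, Matrix.mulVec, dotProduct, Matrix.toLpLin_apply]

lemma op_cx (X : Matrix (Fin m) (Fin m) ℝ) (v : Rn m) :
    op X (cx m v) = cx m (Matrix.toEuclideanLin X v) := by
  ext i
  simp [op_apply, toC, Matrix.mulVec, dotProduct, Matrix.toLpLin_apply]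

lemma fourierInv_lineDerivOp_single (φ : 𝓢(Rn n, ℂ)) (j : Fin n) (ξ : Rn n) :
    (𝓕⁻ (∂_{EuclideanSpace.single j (1 : ℝ)} φ)) ξ =
      -((2 * Real.pi * Complex.I : ℂ) * (ξ j : ℂ)) * (𝓕⁻ φ) ξ := by
  have hg : (inner ℝ · (EuclideanSpace.single j (1 : ℝ)) : Rn n → ℝ).HasTemperateGrowth := by
    fun_prop
  rw [fourierInv_lineDerivOp_eq, _root_.smul_apply, SchwartzMap.smulLeftCLM_apply_apply hg]
  simp [EuclideanSpace.inner_single_right]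
  ring

lemma contDiff_fderiv_apply {φ : Rn n → ℝ} (h₁ : ContDiff ℝ ∞ φ) (v : Rn n) :
    ContDiff ℝ ∞ fun x => fderiv ℝ φ x v :=
  (h₁.fderiv_right (m := ∞) (by norm_num)).clm_apply contDiff_const

lemma hasCompactSupport_fderiv_apply {φ : Rn n → ℝ} (h₂ : HasCompactSupport φ) (v : Rn n) :
    HasCompactSupport fun x => fderiv ℝ φ x v :=
  h₂.fderiv_apply ℝ v

lemma testFun_fderiv {φ : Rn n → ℝ} (h₁ : ContDiff ℝ ∞ φ) (h₂ : HasCompactSupport φ) (v : Rn n) :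
    testFun (fun x => fderiv ℝ φ x v) (contDiff_fderiv_apply h₁ v)
      (hasCompactSupport_fderiv_apply h₂ v) = ∂_{v} (testFun φ h₁ h₂) := by
  ext x
  rw [SchwartzMap.lineDerivOp_apply_eq_fderiv]
  have hd : DifferentiableAt ℝ φ x := h₁.differentiable (by simp) x
  have e : (testFun φ h₁ h₂ : Rn n → ℂ) = Complex.ofRealCLM ∘ φ := rfl
  rw [e, (Complex.ofRealCLM.hasFDerivAt.comp x hd.hasFDerivAt).fderiv]
  rfl

lemma integral_smul_toEuclideanLin_rePart (X : Matrix (Fin m) (Fin m) ℝ) {φ : Rn n → ℝ}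
    (h₁ : ContDiff ℝ ∞ φ) (h₂ : HasCompactSupport φ) {u : Rn n → Cm m}
    (hu : MemLp u 2 volume) :
    ∫ x, φ x • Matrix.toEuclideanLin X (rePart m (invFourier hu x)) =
      rePart m (op X (∫ ξ, (𝓕⁻ (testFun φ h₁ h₂)) ξ • u ξ)) := by
  have hi := integrable_schwartz_smul (by norm_num) (memLp_invFourier hu) (testFun φ h₁ h₂)
  rw [← fourierPair_invFourier hu, ← (op X).integral_comp_comm hi]
  have hi' := (op X).integrable_comp hi
  simp only [map_smul, testFun_apply] at hi' ⊢
  rw [← integral_smul_rePart hi']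
  simp only [rePart_op]

/-! ### The evolution on the Fourier side -/

namespace Coeffs

variable {c : Coeffs n m} {M : ℝ} {u : Rn n → Cm m}

/-- `e^{t gen(ξ)} u(ξ)`. -/
def evolve (c : Coeffs n m) (u : Rn n → Cm m) (t : ℝ) (ξ : Rn n) : Cm m := c.flow t ξ (u ξ)

lemma aestronglyMeasurable_clm_apply {T : Rn n → Cm m →L[ℂ] Cm m} (hT : Continuous T)
    (hu : AEStronglyMeasurable u volume) :
    AEStronglyMeasurable (fun ξ => T ξ (u ξ)) volume := by
  have h : Continuous fun p : (Cm m →L[ℂ] Cm m) × Cm m => p.1 p.2 := by fun_prop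
  exact h.comp_aestronglyMeasurable (hT.aestronglyMeasurable.prodMk hu)

lemma aestronglyMeasurable_evolve (c : Coeffs n m) (hu : AEStronglyMeasurable u volume) (t : ℝ) :
    AEStronglyMeasurable (c.evolve u t) volume :=
  aestronglyMeasurable_clm_apply (c.continuous_flow.comp (by fun_prop : Continuous fun ξ => (t, ξ)))
    hu

lemma norm_evolve_le (hM : ∀ ξ t, 0 ≤ t → ‖c.flow t ξ‖ ≤ M) {t : ℝ} (ht : 0 ≤ t) (ξ : Rn n) :
    ‖c.evolve u t ξ‖ ≤ M * ‖u ξ‖ :=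
  (c.flow t ξ).le_of_opNorm_le (hM ξ t ht) _

lemma memLp_evolve (hM : ∀ ξ t, 0 ≤ t → ‖c.flow t ξ‖ ≤ M) (hu : MemLp u 2 volume) {t : ℝ}
    (ht : 0 ≤ t) : MemLp (c.evolve u t) 2 volume :=
  hu.of_le_mul (c.aestronglyMeasurable_evolve hu.1 t) (ae_of_all _ (norm_evolve_le hM ht))

lemma evolve_zero (c : Coeffs n m) (u : Rn n → Cm m) : c.evolve u 0 = u := by
  ext1 ξ
  rw [evolve, flow_zero]
  rfl

lemma tendsto_evolve (hM : ∀ ξ t, 0 ≤ t → ‖c.flow t ξ‖ ≤ M) (hu : MemLp u 2 volume) {t : ℝ}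
    (ht : 0 ≤ t) :
    Tendsto (fun s => eLpNorm (c.evolve u s - c.evolve u t) 2 volume) (𝓝[Set.Ici 0] t) (𝓝 0) := by
  refine tendsto_eLpNorm_two_of_dominated (g := fun ξ => M * ‖u ξ‖ + M * ‖u ξ‖)
    (Eventually.of_forall fun s => c.aestronglyMeasurable_evolve hu.1 s)
    (c.aestronglyMeasurable_evolve hu.1 t) ((hu.norm.const_mul M).add (hu.norm.const_mul M)) ?_ ?_
  · filter_upwards [self_mem_nhdsWithin] with s hs
    refine ae_of_all _ fun ξ => (norm_sub_le _ _).trans ?_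
    exact add_le_add (norm_evolve_le hM hs ξ) (norm_evolve_le hM ht ξ)
  · refine ae_of_all _ fun ξ => ?_
    have h1 : Continuous fun s => c.evolve u s ξ := by
      have := c.continuous_flow.comp (by fun_prop : Continuous fun s : ℝ => (s, ξ))
      exact this.clm_apply continuous_const
    exact h1.continuousAt.continuousWithinAt

/-- A factor ‖ξ‖ is paid for by first derivatives of ψ, which are again Schwartz functions. -/
lemma norm_le_one_add_sum_mono (ψ : 𝓢(Rn n, ℂ)) (ξ : Rn n) (v : Cm m) :
    (1 + ‖ξ‖) * ‖(𝓕⁻ ψ) ξ • v‖ ≤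
      ‖(𝓕⁻ ψ) ξ • v‖ + ∑ α : Fin 1 → Fin n, ‖(𝓕⁻ (∂^{dirs α} ψ)) ξ • v‖ := by
  have h1 := norm_pow_le_sum_norm_mono 1 ξ
  rw [pow_one] at h1
  have h2 : ∑ α : Fin 1 → Fin n, ‖(𝓕⁻ (∂^{dirs α} ψ)) ξ • v‖ =
      (∑ α : Fin 1 → Fin n, ‖mono α ξ‖) * ‖(𝓕⁻ ψ) ξ • v‖ := by
    rw [Finset.sum_mul]
    refine Finset.sum_congr rfl fun α _ => ?_
    rw [fourierInv_iteratedLineDerivOp, mul_smul, mul_smul]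
    simp [norm_smul]
  rw [h2, add_mul, one_mul]
  gcongr

/-- Differentiation under the integral: the linear growth of the generator moves to the test
function, leaving an integrable bound uniform in s > 0. -/
lemma hasDerivAt_integral_evolve (hM : ∀ ξ t, 0 ≤ t → ‖c.flow t ξ‖ ≤ M) (hu : MemLp u 2 volume)
    (ψ : 𝓢(Rn n, ℂ)) {t : ℝ} (ht : 0 < t) :
    Integrable (fun ξ => (𝓕⁻ ψ) ξ • c.gen ξ (c.evolve u t ξ)) volume ∧
    HasDerivAt (fun s => ∫ ξ, (𝓕⁻ ψ) ξ • c.evolve u s ξ)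
      (∫ ξ, (𝓕⁻ ψ) ξ • c.gen ξ (c.evolve u t ξ)) t := by
  obtain ⟨C, hC, hgen⟩ := c.exists_norm_gen_le
  have hM0 : 0 ≤ M := (norm_nonneg _).trans (hM 0 0 le_rfl)
  have hψ : ∀ η : 𝓢(Rn n, ℂ), AEStronglyMeasurable η volume :=
    fun η => η.continuous.aestronglyMeasurable
  refine hasDerivAt_integral_of_dominated_loc_of_deriv_le (s := Set.Ioi 0)
    (F' := fun s ξ => (𝓕⁻ ψ) ξ • c.gen ξ (c.evolve u s ξ))
    (bound := fun ξ => C * M * (‖(𝓕⁻ ψ) ξ • u ξ‖ +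
      ∑ α : Fin 1 → Fin n, ‖(𝓕⁻ (∂^{dirs α} ψ)) ξ • u ξ‖)) (Ioi_mem_nhds ht)
    (Eventually.of_forall fun s => (hψ _).smul (c.aestronglyMeasurable_evolve hu.1 s))
    (integrable_schwartz_smul (by norm_num) (memLp_evolve hM hu ht.le) _)
    ((hψ _).smul (aestronglyMeasurable_clm_apply c.continuous_gen
      (c.aestronglyMeasurable_evolve hu.1 t))) ?_ ?_ ?_
  · refine ae_of_all _ fun ξ s hs => ?_
    rw [norm_smul]
    calc ‖(𝓕⁻ ψ) ξ‖ * ‖c.gen ξ (c.evolve u s ξ)‖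
        ≤ ‖(𝓕⁻ ψ) ξ‖ * (C * (1 + ‖ξ‖) * (M * ‖u ξ‖)) := by
          gcongr
          refine ((c.gen ξ).le_of_opNorm_le (hgen ξ) _).trans ?_
          gcongr
          exact norm_evolve_le hM (le_of_lt hs) ξ
      _ = C * M * ((1 + ‖ξ‖) * ‖(𝓕⁻ ψ) ξ • u ξ‖) := by rw [norm_smul]; ring
      _ ≤ _ := by
          gcongr
          exact norm_le_one_add_sum_mono ψ ξ (u ξ)
  · refine Integrable.const_mul (Integrable.add ?_ (integrable_finsetSum _ fun α _ => ?_)) _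
    · exact (integrable_schwartz_smul (by norm_num) hu _).norm
    · exact (integrable_schwartz_smul (by norm_num) hu _).norm
  · exact ae_of_all _ fun ξ s _ => (c.hasDerivAt_flow_apply ξ (u ξ) s).const_smul _

/-- The Fourier side of the right-hand side of the equation, tested against `ψ`. -/
lemma CondA.op_A0_integral_gen (hA : c.CondA) {v : Rn n → Cm m} (hv : MemLp v 2 volume)
    (ψ : 𝓢(Rn n, ℂ)) (hi : Integrable (fun ξ => (𝓕⁻ ψ) ξ • c.gen ξ (v ξ)) volume) :
    op c.A0 (∫ ξ, (𝓕⁻ ψ) ξ • c.gen ξ (v ξ)) =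
      (∑ j, op (c.A j) (∫ ξ, (𝓕⁻ (∂_{EuclideanSpace.single j (1 : ℝ)} ψ)) ξ • v ξ)) -
        op c.L (∫ ξ, (𝓕⁻ ψ) ξ • v ξ) := by
  have hint : ∀ η : 𝓢(Rn n, ℂ), Integrable (fun ξ => η ξ • v ξ) volume :=
    integrable_schwartz_smul (by norm_num) hv
  rw [← (op c.A0).integral_comp_comm hi, ← (op c.L).integral_comp_comm (hint _)]
  simp only [← fun j => (op (c.A j)).integral_comp_comm
    (hint (𝓕⁻ (∂_{EuclideanSpace.single j (1 : ℝ)} ψ)))]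
  rw [← integral_finsetSum _ fun j _ => (op (c.A j)).integrable_comp (hint _),
    ← integral_sub (integrable_finsetSum _ fun j _ => (op (c.A j)).integrable_comp (hint _))
      ((op c.L).integrable_comp (hint _))]
  refine integral_congr_ae (ae_of_all _ fun ξ => ?_)
  have h := DFunLike.congr_fun (hA.op_A0_comp_gen ξ) (v ξ)
  simp only [ContinuousLinearMap.comp_apply, _root_.neg_apply, _root_.add_apply,
    _root_.smul_apply, c.op_symbol, _root_.sum_apply] at h
  simp only [map_smul, h, fourierInv_lineDerivOp_single]
  rw [smul_neg, smul_add, neg_add, sub_eq_add_neg, Finset.smul_sum, Finset.smul_sum,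
    ← Finset.sum_neg_distrib]
  congr 1
  refine Finset.sum_congr rfl fun j _ => ?_
  rw [smul_smul, smul_smul, ← neg_smul]
  congr 1
  push_cast
  ring

/-- The real solution with the Fourier transform `e^{t gen} u`. -/
def solution (c : Coeffs n m) {u : Rn n → Cm m}
    (hu : ∀ t : ℝ, MemLp (c.evolve u (max t 0)) 2 volume) (t : ℝ) (x : Rn n) : Rn m :=
  rePart m (invFourier (hu t) x)

/-- Parseval moves every term of the weak equation to the Fourier side, where it is the ODE of the
flow; real coefficients let the real part pass through. Time is clamped at 0 because the flow is
bounded only forwards. -/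
lemma CondA.isSolution_solution (hA : c.CondA) (hM : ∀ ξ t, 0 ≤ t → ‖c.flow t ξ‖ ≤ M)
    (hu : MemLp u 2 volume) (hu' : ∀ t : ℝ, MemLp (c.evolve u (max t 0)) 2 volume)
    {w₀ : Rn n → Rn m} (hw₀ : (fun x => cx m (w₀ x)) =ᵐ[volume] invFourier hu) :
    c.IsSolution w₀ (c.solution hu') := by
  refine ⟨fun t _ => memLp_rePart (memLp_invFourier _), fun t ht => ?_, ?_, ?_⟩
  · refine tendsto_of_tendsto_of_tendsto_of_le_of_le' tendsto_const_nhds (tendsto_evolve hM hu ht)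
      (Eventually.of_forall fun _ => zero_le) ?_
    filter_upwards [self_mem_nhdsWithin] with s hs
    have e1 : c.evolve u s - c.evolve u t = c.evolve u (max s 0) - c.evolve u (max t 0) := by
      rw [max_eq_left hs, max_eq_left ht]
    rw [e1, ← eLpNorm_invFourier ((hu' s).sub (hu' t)),
      eLpNorm_congr_ae (invFourier_sub (hu' s) (hu' t))]
    refine le_trans (le_of_eq ?_) (eLpNorm_rePart_le _ _)
    congr 1
  · filter_upwards [hw₀] with x hx
    have e : invFourier (hu' 0) = invFourier hu := by
      refine invFourier_congr _ _ ?_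
      rw [max_self, evolve_zero]
    rw [solution, e, ← hx, rePart_cx]
  · intro φ h₁ h₂ t ht
    obtain ⟨hi, hd⟩ := hasDerivAt_integral_evolve hM hu (testFun φ h₁ h₂) ht
    have key := (((rePart m).comp ((op c.A0).restrictScalars ℝ)).hasFDerivAt.comp_hasDerivAt t hd)
    have hmt : max t 0 = t := max_eq_left ht.le
    have e1 := hA.op_A0_integral_gen (memLp_evolve hM hu ht.le) _ hi
    have hval : (∑ j, ∫ x, (fderiv ℝ φ x (EuclideanSpace.single j (1 : ℝ))) •
          Matrix.toEuclideanLin (c.A j) (c.solution hu' t x))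
        - ∫ x, φ x • Matrix.toEuclideanLin c.L (c.solution hu' t x) =
        rePart m (op c.A0 (∫ ξ, (𝓕⁻ (testFun φ h₁ h₂)) ξ • c.gen ξ (c.evolve u t ξ))) := by
      rw [e1, map_sub, map_sum]
      congr 1
      · refine Finset.sum_congr rfl fun j _ => ?_
        simp only [solution]
        rw [integral_smul_toEuclideanLin_rePart _ (contDiff_fderiv_apply h₁ _)
          (hasCompactSupport_fderiv_apply h₂ _), testFun_fderiv h₁ h₂]
        simp only [hmt]
      · simp only [solution]
        rw [integral_smul_toEuclideanLin_rePart _ h₁ h₂]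
        simp only [hmt]
    rw [hval]
    refine key.congr_of_eventuallyEq ?_
    filter_upwards [Ioi_mem_nhds ht] with s hs
    simp only [solution]
    rw [integral_smul_toEuclideanLin_rePart _ h₁ h₂, max_eq_left (le_of_lt hs)]
    rfl

end Coeffs

end HypSys

namespace HypSys

open SchwartzMap FourierTransform LineDeriv

variable {n m k : ℕ}

/-! ### Uniqueness -/

/-- The pairing `f ↦ ∫ φ f` of `L²` functions with a Schwartz function. -/
def pairing (φ : 𝓢(Rn n, ℂ)) : Lp (Cm m) 2 (volume : Measure (Rn n)) →L[ℂ] Cm m :=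
  (PointwiseConvergenceCLM.evalCLM (RingHom.id ℂ) (Cm m) φ) ∘L
    Lp.toTemperedDistributionCLM (Cm m) volume 2

lemma pairing_apply (φ : 𝓢(Rn n, ℂ)) (f : Lp (Cm m) 2 (volume : Measure (Rn n))) :
    pairing φ f = ∫ x, φ x • f x :=
  Lp.toTemperedDistribution_apply f φ

lemma pairing_eq_integral_fourier (φ : 𝓢(Rn n, ℂ)) (f : Lp (Cm m) 2 (volume : Measure (Rn n))) :
    pairing φ f = ∫ ξ, (𝓕⁻ φ) ξ •
      ((𝓕 f : Lp (Cm m) 2 (volume : Measure (Rn n))) : Rn n → Cm m) ξ := by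
  have h := fourierPair_Lp (𝓕 f : Lp (Cm m) 2 (volume : Measure (Rn n))) φ
  rw [fourierInv_fourier_eq] at h
  rw [pairing_apply, h]

lemma continuous_pairing (f : Lp (Cm m) 2 (volume : Measure (Rn n))) :
    Continuous fun φ : 𝓢(Rn n, ℂ) => pairing φ f := by
  simp only [pairing_apply]
  exact continuous_integral_schwartz_smul (by norm_num) (Lp.memLp f)

lemma pairing_add (φ ψ : 𝓢(Rn n, ℂ)) (f : Lp (Cm m) 2 (volume : Measure (Rn n))) :
    pairing (φ + ψ) f = pairing φ f + pairing ψ f :=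
  map_add (Lp.toTemperedDistribution f) φ ψ

lemma pairing_smul (a : ℂ) (φ : 𝓢(Rn n, ℂ)) (f : Lp (Cm m) 2 (volume : Measure (Rn n))) :
    pairing (a • φ) f = a • pairing φ f :=
  map_smul (Lp.toTemperedDistribution f) a φ

lemma op_pairing_toLp (X : Matrix (Fin m) (Fin m) ℝ) {φ : Rn n → ℝ}
    (h₁ : ContDiff ℝ ∞ φ) (h₂ : HasCompactSupport φ) {f : Rn n → Rn m} (hf : MemLp f 2 volume) :
    op X (pairing (testFun φ h₁ h₂) ((memLp_cx hf).toLp _)) =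
      cx m (∫ x, φ x • Matrix.toEuclideanLin X (f x)) := by
  have e : ∫ x, testFun φ h₁ h₂ x • (memLp_cx hf).toLp _ x =
      ∫ x, testFun φ h₁ h₂ x • cx m (f x) := by
    refine integral_congr_ae ?_
    filter_upwards [(memLp_cx hf).coeFn_toLp] with x hx
    rw [hx]
  rw [pairing_apply, e, ← (op X).integral_comp_comm
    (integrable_schwartz_smul (by norm_num) (memLp_cx hf) _), ← integral_ofReal_smul_cx]
  simp only [map_smul, op_cx, testFun_apply]

namespace Coeffs

variable {c : Coeffs n m}

/-- The spatial part of the equation, tested against `φ`. -/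
def weakRhs (c : Coeffs n m) (φ : 𝓢(Rn n, ℂ)) :
    Lp (Cm m) 2 (volume : Measure (Rn n)) →L[ℂ] Cm m :=
  (∑ j, op (c.A j) ∘L pairing (∂_{EuclideanSpace.single j (1 : ℝ)} φ)) - op c.L ∘L pairing φ

lemma weakRhs_apply (c : Coeffs n m) (φ : 𝓢(Rn n, ℂ))
    (f : Lp (Cm m) 2 (volume : Measure (Rn n))) :
    c.weakRhs φ f = (∑ j, op (c.A j) (pairing (∂_{EuclideanSpace.single j (1 : ℝ)} φ) f)) -
      op c.L (pairing φ f) := by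
  simp [weakRhs, _root_.sum_apply]

/-- A stationary weak identity may be tested against Schwartz functions. -/
lemma op_A0_pairing_eq_weakRhs {f g : Lp (Cm m) 2 (volume : Measure (Rn n))}
    (h : ∀ φ h₁ h₂, op c.A0 (pairing (testFun φ h₁ h₂) f) = c.weakRhs (testFun φ h₁ h₂) g)
    (φ : 𝓢(Rn n, ℂ)) : op c.A0 (pairing φ f) = c.weakRhs φ g := by
  rw [← sub_eq_zero]
  refine eq_zero_of_testFun (fun φ => op c.A0 (pairing φ f) - c.weakRhs φ g) ?_ ?_ ?_ ?_ φ
  · simp only [weakRhs_apply]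
    refine ((op c.A0).continuous.comp (continuous_pairing f)).sub (Continuous.sub
      (continuous_finsetSum _ fun j _ => (op (c.A j)).continuous.comp ((continuous_pairing g).comp
        (continuous_lineDerivOp _))) ((op c.L).continuous.comp (continuous_pairing g)))
  · intro φ ψ
    simp only [weakRhs_apply, lineDerivOp_add, pairing_add, map_add, Finset.sum_add_distrib]
    abel
  · intro a φ
    simp only [weakRhs_apply, lineDerivOp_smul, pairing_smul, map_smul, ← Finset.smul_sum,
      smul_sub]
  · intro φ h₁ h₂
    rw [h φ h₁ h₂, sub_self]

lemma locallyIntegrable_gen_apply (c : Coeffs n m) {v : Rn n → Cm m} (hv : MemLp v 2 volume) :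
    LocallyIntegrable (fun ξ => c.gen ξ (v ξ)) volume := by
  obtain ⟨C, hC, hgen⟩ := c.exists_norm_gen_le
  have h1 := locallyIntegrable_smul_of_continuous (hv.locallyIntegrable (by norm_num))
    (a := fun ξ => ((C * (1 + ‖ξ‖) : ℝ) : ℂ)) (by fun_prop)
  refine h1.mono (aestronglyMeasurable_clm_apply c.continuous_gen hv.1) (ae_of_all _ fun ξ => ?_)
  refine ((c.gen ξ).le_of_opNorm_le (hgen ξ) _).trans_eq ?_
  rw [norm_smul, Complex.norm_real, Real.norm_of_nonneg (by positivity)]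

lemma CondA.op_A0_injective (hA : c.CondA) : Function.Injective (op c.A0) := by
  have h : op c.A0⁻¹ ∘L op c.A0 = ContinuousLinearMap.id ℂ _ := by
    rw [← op_mul, mul_eq_one_comm.1 hA.A0_mul_inv, op_one]
  exact Function.LeftInverse.injective (g := op c.A0⁻¹) fun x => DFunLike.congr_fun h x

/-- Testing with `𝓕 ψ` puts a compactly supported function on the frequency side, so the generator
need only be locally integrable against the transform. Injectivity of A⁰ then removes that factor.
-/
lemma CondA.fourier_ae_eq_gen (hA : c.CondA) {f g : Lp (Cm m) 2 (volume : Measure (Rn n))}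
    (h : ∀ φ : 𝓢(Rn n, ℂ), op c.A0 (pairing φ f) = c.weakRhs φ g) :
    ((𝓕 f : Lp (Cm m) 2 (volume : Measure (Rn n))) : Rn n → Cm m) =ᵐ[volume]
      fun ξ => c.gen ξ (((𝓕 g : Lp (Cm m) 2 (volume : Measure (Rn n))) : Rn n → Cm m) ξ) := by
  set V : Lp (Cm m) 2 (volume : Measure (Rn n)) := 𝓕 f with hV
  set Y : Lp (Cm m) 2 (volume : Measure (Rn n)) := 𝓕 g with hY
  have hloc := c.locallyIntegrable_gen_apply (Lp.memLp Y)
  refine ae_eq_of_testFun ((Lp.memLp V).locallyIntegrable (by norm_num)) hloc fun φ h₁ h₂ => ?_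
  set ψ := testFun φ h₁ h₂ with hψ
  have e : 𝓕⁻ (𝓕 ψ) = ψ := fourierInv_fourier_eq ψ
  have hi : Integrable (fun ξ => (𝓕⁻ (𝓕 ψ)) ξ • c.gen ξ (Y ξ)) volume := by
    rw [e]
    refine hloc.integrable_smul_left_of_hasCompactSupport ψ.continuous ?_
    exact h₂.comp_left (g := Complex.ofReal) Complex.ofReal_zero
  have h1 := h (𝓕 ψ)
  simp only [weakRhs_apply, pairing_eq_integral_fourier] at h1
  rw [← hV, ← hY, ← hA.op_A0_integral_gen (Lp.memLp Y) (𝓕 ψ) hi, e] at h1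
  exact hA.op_A0_injective h1

/-- A continuous curve in `L²` which starts at zero and solves the equation weakly vanishes. -/
theorem CondA.eq_zero_of_weak (hA : c.CondA) {D : ℝ → Lp (Cm m) 2 (volume : Measure (Rn n))}
    (hD : Continuous D) (hD0 : D 0 = 0)
    (heq : ∀ φ h₁ h₂ t, 0 < t → HasDerivAt (fun s => op c.A0 (pairing (testFun φ h₁ h₂) (D s)))
      (c.weakRhs (testFun φ h₁ h₂) (D t)) t) {t : ℝ} (ht : 0 ≤ t) : D t = 0 := by
  obtain ⟨C, hC, hgen⟩ := c.exists_norm_gen_le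
  -- D is differentiable in time only weakly, but its primitive U is continuously differentiable in
  -- `L²`, and the integrated equation is a relation between D(t) and U(t) at a single time.
  set U : ℝ → Lp (Cm m) 2 (volume : Measure (Rn n)) := fun t => ∫ s in (0 : ℝ)..t, D s with hU
  have hU0 : U 0 = 0 := intervalIntegral.integral_same
  have hUd : ∀ t, HasDerivAt U (D t) t := fun t =>
    intervalIntegral.integral_hasDerivAt_right (hD.intervalIntegrable _ _)
      (hD.stronglyMeasurableAtFilter _ _) hD.continuousAt
  have hUc : Continuous U := continuous_iff_continuousAt.2 fun t => (hUd t).continuousAt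
  have step1 : ∀ t, 0 ≤ t → ∀ φ h₁ h₂,
      op c.A0 (pairing (testFun φ h₁ h₂) (D t)) = c.weakRhs (testFun φ h₁ h₂) (U t) := by
    intro t ht φ h₁ h₂
    set h : ℝ → Cm m := fun s =>
      op c.A0 (pairing (testFun φ h₁ h₂) (D s)) - c.weakRhs (testFun φ h₁ h₂) (U s) with hh
    have hc : Continuous h :=
      ((op c.A0).continuous.comp ((pairing _).continuous.comp hD)).sub
        ((c.weakRhs _).continuous.comp hUc)
    have hd : ∀ s, 0 < s → HasDerivAt h 0 s := by
      intro s hs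
      have h2 : HasDerivAt (fun s => c.weakRhs (testFun φ h₁ h₂) (U s))
          (c.weakRhs (testFun φ h₁ h₂) (D s)) s :=
        ((c.weakRhs (testFun φ h₁ h₂)).restrictScalars ℝ).hasFDerivAt.comp_hasDerivAt s (hUd s)
      have h3 := (heq φ h₁ h₂ s hs).sub h2
      rw [sub_self] at h3
      exact h3
    have h0 : h 0 = 0 := by simp [hh, hD0, hU0]
    rcases ht.eq_or_lt with rfl | ht
    · exact sub_eq_zero.1 h0
    -- The equation is assumed for positive times only, so constancy is shown on [ε, t] and
    -- continuity at 0 is used as ε tends to 0.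
    have hconst : ∀ᶠ ε in 𝓝[>] (0 : ℝ), h ε = h t := by
      filter_upwards [Ioo_mem_nhdsGT ht] with ε hε
      exact (constant_of_has_deriv_right_zero hc.continuousOn
        (fun s hs => (hd s (hε.1.trans_le hs.1)).hasDerivWithinAt) t
        (Set.right_mem_Icc.2 hε.2.le)).symm
    have h3 : Tendsto h (𝓝[>] 0) (𝓝 (h 0)) := hc.continuousAt.continuousWithinAt
    have h4 := tendsto_nhds_unique (h3.congr' hconst) tendsto_const_nhds
    rw [h0] at h4
    exact sub_eq_zero.1 h4.symm
  have step2 : ∀ t, 0 ≤ t → ((𝓕 (D t) : Lp (Cm m) 2 (volume : Measure (Rn n))) : Rn n → Cm m)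
      =ᵐ[volume] fun ξ =>
        c.gen ξ (((𝓕 (U t) : Lp (Cm m) 2 (volume : Measure (Rn n))) : Rn n → Cm m) ξ) :=
    fun t ht => hA.fourier_ae_eq_gen (op_A0_pairing_eq_weakRhs (step1 t ht))
  set 𝔉 := (Lp.fourierTransformₗᵢ (Rn n) (Cm m)).toContinuousLinearEquiv.toContinuousLinearMap
  -- On a ball of radius R the generator is bounded by C(1 + R), so the restricted transform
  -- satisfies |y'| ≤ C(1 + R)|y| with y(0) = 0, and Grönwall's inequality applies.
  have step3 : ∀ R : ℕ, ∀ᵐ ξ, ξ ∈ Metric.ball (0 : Rn n) R →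
      ((𝓕 (U t) : Lp (Cm m) 2 (volume : Measure (Rn n))) : Rn n → Cm m) ξ = 0 := by
    intro R
    set P := (LpToLpRestrictCLM (Rn n) (Cm m) ℂ volume 2 (Metric.ball (0 : Rn n) R)) with hP
    have hPae : ∀ f : Lp (Cm m) 2 (volume : Measure (Rn n)),
        P f =ᵐ[volume.restrict (Metric.ball (0 : Rn n) R)] f := LpToLpRestrictCLM_coeFn ℂ _
    have hy : ∀ s, HasDerivAt (fun s => P (𝓕 (U s))) (P (𝓕 (D s))) s := fun s =>
      ((P.comp 𝔉).restrictScalars ℝ).hasFDerivAt.comp_hasDerivAt s (hUd s)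
    have hzero := eq_zero_of_abs_deriv_le_mul_abs_self_of_eq_zero_right (a := 0) (b := t)
      (K := C * (1 + R)) (f := fun s => P (𝓕 (U s))) (f' := fun s => P (𝓕 (D s)))
      (fun s _ => (hy s).continuousAt.continuousWithinAt)
      (fun s _ => (hy s).hasDerivWithinAt) ?_ ?_ t (Set.right_mem_Icc.2 ht)
    · have h1 := hPae (𝓕 (U t))
      rw [show P (𝓕 (U t)) = 0 from hzero] at h1
      have h2 := (Lp.coeFn_zero (Cm m) 2 (volume.restrict (Metric.ball (0 : Rn n) R)))
      have h3 := h1.symm.trans h2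
      exact (ae_restrict_iff' measurableSet_ball).1 h3
    · change (P.comp 𝔉) (U 0) = 0
      rw [hU0, map_zero]
    · intro s hs
      refine Lp.norm_le_mul_norm_of_ae_le_mul ?_
      filter_upwards [hPae (𝓕 (U s)), hPae (𝓕 (D s)), ae_restrict_of_ae (step2 s hs.1),
        ae_restrict_mem measurableSet_ball] with ξ h1 h2 h3 h4
      rw [h1, h2, h3]
      refine (c.gen ξ).le_of_opNorm_le ((hgen ξ).trans ?_) _
      have : ‖ξ‖ < R := by simpa using h4
      gcongr
  have hae : ∀ᵐ ξ, ((𝓕 (D t) : Lp (Cm m) 2 (volume : Measure (Rn n))) : Rn n → Cm m) ξ = 0 := by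
    filter_upwards [ae_all_iff.2 step3, step2 t ht] with ξ h1 h2
    obtain ⟨R, hR⟩ := exists_nat_gt ‖ξ‖
    rw [h2, h1 R (by simpa using hR), map_zero]
  have hF : (𝓕 (D t) : Lp (Cm m) 2 (volume : Measure (Rn n))) = 0 :=
    (Lp.eq_zero_iff_ae_eq_zero).2 hae
  have e : 𝓕⁻ (𝓕 (D t) : Lp (Cm m) 2 (volume : Measure (Rn n))) = D t := fourierInv_fourier_eq _
  rw [hF] at e
  rw [← e]
  exact map_zero (Lp.fourierTransformₗᵢ (Rn n) (Cm m)).symm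

variable {w₀ : Rn n → Rn m} {w w' : ℝ → Rn n → Rn m}

/-- A solution as a curve in the complex space `L²`, constant for negative times. -/
def IsSolution.curve (h : c.IsSolution w₀ w) (t : ℝ) : Lp (Cm m) 2 (volume : Measure (Rn n)) :=
  (memLp_cx (h.memLp (max t 0) (le_max_right t 0))).toLp _

lemma IsSolution.op_pairing_curve (h : c.IsSolution w₀ w) (X : Matrix (Fin m) (Fin m) ℝ)
    {φ : Rn n → ℝ} (h₁ : ContDiff ℝ ∞ φ) (h₂ : HasCompactSupport φ) (t : ℝ) :
    op X (pairing (testFun φ h₁ h₂) (h.curve t)) =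
      cx m (∫ x, φ x • Matrix.toEuclideanLin X (w (max t 0) x)) :=
  op_pairing_toLp X h₁ h₂ (h.memLp _ (le_max_right t 0))

lemma IsSolution.continuous_curve (h : c.IsSolution w₀ w) : Continuous h.curve := by
  refine continuous_iff_continuousAt.2 fun t => ?_
  refine (Lp.tendsto_Lp_iff_tendsto_eLpNorm'' _ _ _ _).2 ?_
  have h1 : Tendsto (fun s : ℝ => max s 0) (𝓝 t) (𝓝[Set.Ici 0] (max t 0)) :=
    tendsto_nhdsWithin_iff.2 ⟨(continuous_id.max continuous_const).continuousAt,
      Eventually.of_forall fun s => le_max_right s 0⟩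
  refine ((h.continuous _ (le_max_right t 0)).comp h1).congr fun s => ?_
  rw [Function.comp_apply, ← eLpNorm_cx]
  congr 1
  ext1 x
  simp

lemma IsSolution.hasDerivAt_curve (h : c.IsSolution w₀ w) {φ : Rn n → ℝ} (h₁ : ContDiff ℝ ∞ φ)
    (h₂ : HasCompactSupport φ) {t : ℝ} (ht : 0 < t) :
    HasDerivAt (fun s => op c.A0 (pairing (testFun φ h₁ h₂) (h.curve s)))
      (c.weakRhs (testFun φ h₁ h₂) (h.curve t)) t := by
  have key := (cx m).toContinuousLinearMap.hasFDerivAt.comp_hasDerivAt t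
    (h.equation φ h₁ h₂ t ht)
  have hval : c.weakRhs (testFun φ h₁ h₂) (h.curve t) =
      (cx m) ((∑ j, ∫ x, (fderiv ℝ φ x (EuclideanSpace.single j (1 : ℝ))) •
          Matrix.toEuclideanLin (c.A j) (w t x))
        - ∫ x, φ x • Matrix.toEuclideanLin c.L (w t x)) := by
    rw [weakRhs_apply, map_sub, map_sum]
    simp only [← testFun_fderiv h₁ h₂, h.op_pairing_curve, max_eq_left ht.le]
  rw [hval]
  refine key.congr_of_eventuallyEq ?_
  filter_upwards [Ioi_mem_nhds ht] with s hs
  rw [h.op_pairing_curve, max_eq_left (le_of_lt hs)]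
  rfl

/-- Solutions are unique. -/
theorem CondA.isSolution_unique (hA : c.CondA) (h : c.IsSolution w₀ w) (h' : c.IsSolution w₀ w')
    {t : ℝ} (ht : 0 ≤ t) : w t =ᵐ[volume] w' t := by
  have hz := hA.eq_zero_of_weak (D := fun s => h.curve s - h'.curve s)
    (h.continuous_curve.sub h'.continuous_curve) ?_ ?_ ht
  · have h1 : h.curve t = h'.curve t := sub_eq_zero.1 hz
    rw [IsSolution.curve, IsSolution.curve, MemLp.toLp_eq_toLp_iff, max_eq_left ht] at h1
    filter_upwards [h1] with x hx
    exact (cx m).injective hx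
  · rw [sub_eq_zero, IsSolution.curve, IsSolution.curve, MemLp.toLp_eq_toLp_iff, max_self]
    filter_upwards [h.initial, h'.initial] with x h1 h2
    rw [h1, h2]
  · intro φ h₁ h₂ t ht
    simp only [map_sub]
    exact (h.hasDerivAt_curve h₁ h₂ ht).sub (h'.hasDerivAt_curve h₁ h₂ ht)

end Coeffs

end HypSys

namespace HypSys

open SchwartzMap FourierTransform LineDeriv

variable {n m k : ℕ}

/-! ### The decay estimate -/

lemma eLpNorm_invFourier_le_add_compl {u : Rn n → Cm m} (hu : MemLp u 2 volume) {p : ℝ≥0∞}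
    (hp : 1 ≤ p) {s : Set (Rn n)} (hs : MeasurableSet s) :
    eLpNorm (invFourier hu) p volume ≤ eLpNorm (invFourier (hu.indicator hs)) p volume +
      eLpNorm (invFourier (hu.indicator hs.compl)) p volume := by
  have e := invFourier_congr hu ((hu.indicator hs).add (hu.indicator hs.compl))
    (Set.indicator_self_add_compl s u).symm.eventuallyEq
  rw [e, eLpNorm_congr_ae (invFourier_add (hu.indicator hs) (hu.indicator hs.compl))]
  exact eLpNorm_add_le (memLp_invFourier _).1 (memLp_invFourier _).1 hp

/-- Regularity on the Fourier side: `u` and `|ξ|^k u` are square integrable. -/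
lemma memLp_of_norm_le_one_add_pow {k ℓ : ℕ} {r : ℝ≥0∞} (hr1 : 1 ≤ r) (hr : r ≤ 2)
    (hℓ : (n : ℝ) * ((r⁻¹).toReal - 1 / 2) < (ℓ : ℝ) ∨ r = 2) {B : Type} [Fintype B]
    {u : Rn n → Cm m} {v : B → Rn n → Cm m} {N : B → ℝ≥0∞} (hu : BddAddL2 u)
    (hv : ∀ b, AEStronglyMeasurable (v b) volume) (hN' : ∀ b, N b ≠ ⊤)
    (hN : ∀ b, ∀ s : Set (Rn n), MeasurableSet s → volume s ≠ ⊤ →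
        eLpNorm (s.indicator (v b)) 2 volume ≤ volume s ^ ((r⁻¹).toReal - 1 / 2) * N b)
    (h : ∀ᵐ ξ, ‖ξ‖ ^ (k + ℓ) * ‖u ξ‖ ≤ ∑ b, ‖v b ξ‖) {a : ℝ} (ha : 0 ≤ a) {z : Rn n → Cm m}
    (hz : AEStronglyMeasurable z volume) (hzu : ∀ ξ, ‖z ξ‖ ≤ a * (1 + ‖ξ‖ ^ k) * ‖u ξ‖) :
    MemLp z 2 volume := by
  have hum : AEStronglyMeasurable u volume := hu.locallyIntegrable.aestronglyMeasurable
  have hcase : (n : ℝ) * ((r⁻¹).toReal - ((2 : ℝ≥0∞)⁻¹).toReal) < (ℓ : ℝ) ∨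
      ((2 : ℝ≥0∞) = 2 ∧ r = 2) := by
    have e : ((2 : ℝ≥0∞)⁻¹).toReal = 1 / 2 := by norm_num
    rw [e]
    exact hℓ.imp_right fun h => ⟨rfl, h⟩
  -- The decay estimate is used at t = 0 with p = 2, where it is a pure integrability statement; M =
  -- δ = 1 are arbitrary.
  obtain ⟨C, hC, hb⟩ := exists_highFreq_bound n m k ℓ zero_le_one one_pos (le_refl 2) hr1 hr hcase
  set y : Rn n → Cm m := fun ξ => ((‖ξ‖ ^ k : ℝ) : ℂ) • u ξ with hy
  have hyn : ∀ ξ, ‖y ξ‖ = ‖ξ‖ ^ k * ‖u ξ‖ := fun ξ => by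
    rw [hy, norm_smul, Complex.norm_real, Real.norm_of_nonneg (by positivity)]
  have hym : AEStronglyMeasurable y volume :=
    (by fun_prop : Continuous fun ξ : Rn n => ((‖ξ‖ ^ k : ℝ) : ℂ)).aestronglyMeasurable.smul hum
  have h1 := (hb 0 le_rfl (h := fun ξ => ‖u ξ‖) hym hv hN
    (ae_of_all _ fun ξ => by rw [hyn]; simp)
    (h.mono fun ξ hξ => ⟨norm_nonneg _, hξ⟩)).1 rfl
  have hlow : MemLp ((Metric.ball 0 1).indicator u) 2 volume :=
    hu.memLp_indicator measurableSet_ball measure_ball_lt_top.ne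
  have hhigh : MemLp ((Metric.ball 0 1)ᶜ.indicator y) 2 volume := by
    refine ⟨hym.indicator measurableSet_ball.compl, h1.trans_lt ?_⟩
    exact ENNReal.mul_lt_top ENNReal.ofReal_lt_top
      (ENNReal.sum_lt_top.2 fun b _ => (hN' b).lt_top)
  refine (hlow.norm.add hhigh.norm).of_le_mul (c := 2 * a) hz (ae_of_all _ fun ξ => ?_)
  rw [Pi.add_apply, Real.norm_of_nonneg (by positivity)]
  refine (hzu ξ).trans ?_
  by_cases hξ : ξ ∈ Metric.ball (0 : Rn n) 1
  · rw [Set.indicator_of_mem hξ, Set.indicator_of_notMem (Set.notMem_compl_iff.2 hξ), norm_zero,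
      add_zero]
    have : ‖ξ‖ ^ k ≤ 1 := pow_le_one₀ (norm_nonneg _) (by simpa using hξ : ‖ξ‖ < 1).le
    rw [mul_comm 2 a]
    gcongr
    linarith
  · rw [Set.indicator_of_notMem hξ, Set.indicator_of_mem (Set.mem_compl hξ), norm_zero,
      zero_add, hyn]
    have : 1 ≤ ‖ξ‖ ^ k := one_le_pow₀ (by simpa using hξ)
    calc a * (1 + ‖ξ‖ ^ k) * ‖u ξ‖ ≤ a * (‖ξ‖ ^ k + ‖ξ‖ ^ k) * ‖u ξ‖ := by gcongr
      _ = _ := by ring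

/-- Existence, uniqueness and decay of the solution of the Cauchy problem. -/
theorem Coeffs.Dissipative.exists_unique_solution_decay (hn : 1 ≤ n) {c : Coeffs n m}
    (hc : c.Dissipative)
    (p q r : ℝ≥0∞) (hp : 2 ≤ p) (hq1 : 1 ≤ q) (hq2 : q ≤ 2) (hr1 : 1 ≤ r) (hr2 : r ≤ 2)
    (k ℓ : ℕ)
    (hℓ : (n : ℝ) * ((r⁻¹).toReal - (p⁻¹).toReal) < (ℓ : ℝ) ∨ (p = 2 ∧ r = 2)) :
    ∃ C : ℝ, 0 < C ∧
      ∀ l : ℕ, k + ℓ ≤ l →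
      ∀ w₀ : Rn n → Rn m, MemW l r w₀ → MemLp w₀ q volume →
        ∃ w : ℝ → Rn n → Rn m,
          c.IsSolution w₀ w ∧
          (∀ w' : ℝ → Rn n → Rn m, c.IsSolution w₀ w' →
            ∀ t : ℝ, 0 ≤ t → w' t =ᵐ[volume] w t) ∧
          ∀ t : ℝ, 0 ≤ t →
            derivNorm k p (w t) ≤
              ENNReal.ofReal (C * (1 + t) ^ (-gamma2 n q p - (k : ℝ) / 2)) *
                  eLpNorm w₀ q volume
              + ENNReal.ofReal (C * (1 + t) ^ (-(ℓ : ℝ) / 2 + gamma2 n r p)) *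
                  derivNorm (k + ℓ) r w₀ := by
  obtain ⟨δ, hδ, M, hM, hflow₀⟩ := hc.exists_norm_flow_le hn
  have hflow : ∀ ξ t, 0 ≤ t →
      ‖c.flow t ξ‖ ≤ M * Real.exp (-(δ * (‖ξ‖ ^ 2 / (1 + ‖ξ‖ ^ 2) ^ 2)) * t) := fun ξ t ht => by
    rw [neg_mul]
    exact hflow₀ ξ t ht
  have hA := hc.1
  have hM' : (0 : ℝ) ≤ (2 * Real.pi) ^ k * M := by positivity
  have hflow' : ∀ ξ t, 0 ≤ t → ‖c.flow t ξ‖ ≤ M := fun ξ t ht =>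
    (hflow ξ t ht).trans (mul_le_of_le_one_right hM.le (Real.exp_le_one_iff.2
      (by rw [neg_mul]; exact neg_nonpos.2 (by positivity))))
  obtain ⟨C₁, hC₁, hlow⟩ := exists_lowFreq_bound hn m k hM' hδ hp hq1 hq2
  obtain ⟨C₂, hC₂, hhigh⟩ := exists_highFreq_bound n m k ℓ hM' hδ hp hr1 hr2 hℓ
  set K : ℕ := Fintype.card (Fin k → Fin n) with hK
  -- K counts the derivatives of order k summed on the left-hand side.
  refine ⟨K * (C₁ + C₂) + 1, by positivity, fun l hl w₀ hW hq => ?_⟩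
  -- The data are a priori in `L^q` and `L^r` only. The transform u comes from the `L^q` bound,
  -- those of the derivatives of order k + ℓ come from the `L^r` bound, and `hvu` ties them
  -- together.
  obtain ⟨u, hfu, hbu, hNu⟩ := exists_fourierPair hq1 hq2 (memLp_cx hq)
  choose g hg hgr using hW (k + ℓ) hl
  choose v hgv hbv hNv using fun β => exists_fourierPair hr1 hr2 (memLp_cx (hgr β))
  have hvu : ∀ β, v β =ᵐ[volume] fun ξ => mono β ξ • u ξ := fun β =>
    (hg β).fourier_ae_eq hq1 hr1 hq (hgr β) hfu (hgv β) hbu (hbv β)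
  simp only [eLpNorm_cx] at hNu hNv
  have hum : AEStronglyMeasurable u volume := hbu.locallyIntegrable.aestronglyMeasurable
  have hvm : ∀ β, AEStronglyMeasurable (v β) volume :=
    fun β => (hbv β).locallyIntegrable.aestronglyMeasurable
  have hsum : ∀ᵐ ξ, ‖ξ‖ ^ (k + ℓ) * ‖u ξ‖ ≤ ∑ β, ‖v β ξ‖ := by
    filter_upwards [ae_all_iff.2 hvu] with ξ hξ
    simp only [hξ, norm_smul, ← Finset.sum_mul]
    gcongr
    exact norm_pow_le_sum_norm_mono _ _
  -- Since p ≥ 2, the requirement on ℓ at p implies the one at 2, which is what square integrability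
  -- needs.
  have hℓ' : (n : ℝ) * ((r⁻¹).toReal - 1 / 2) < (ℓ : ℝ) ∨ r = 2 := by
    refine hℓ.imp (fun h => lt_of_le_of_lt ?_ h) fun h => h.2
    gcongr
    exact inv_toReal_le_half hp
  have hreg : ∀ {a : ℝ}, 0 ≤ a → ∀ {z : Rn n → Cm m}, AEStronglyMeasurable z volume →
      (∀ ξ, ‖z ξ‖ ≤ a * (1 + ‖ξ‖ ^ k) * ‖u ξ‖) → MemLp z 2 volume :=
    fun ha z hz hzu => memLp_of_norm_le_one_add_pow hr1 hr2 hℓ' hbu hvm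
      (fun β => (hgr β).2.ne) hNv hsum ha hz hzu
  have hu : MemLp u 2 volume := hreg zero_le_one hum fun ξ => by
    rw [one_mul]
    exact le_mul_of_one_le_left (norm_nonneg _) (by simp)
  have hu' : ∀ t : ℝ, MemLp (c.evolve u (max t 0)) 2 volume :=
    fun t => Coeffs.memLp_evolve hflow' hu (le_max_right t 0)
  have hsol : c.IsSolution w₀ (c.solution hu') := hA.isSolution_solution hflow' hu hu'
    (hfu.ae_eq_invFourier ((memLp_cx hq).locallyIntegrable hq1) hu)
  refine ⟨c.solution hu', hsol, fun w' hw' t ht => hA.isSolution_unique hw' hsol ht,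
    fun t ht => ?_⟩
  have hmt : max t 0 = t := max_eq_left ht
  have hpt : ∀ α : Fin k → Fin n, ∀ ξ, ‖mono α ξ • c.evolve u (max t 0) ξ‖ ≤
      (2 * Real.pi) ^ k * M * Real.exp (-(δ * (‖ξ‖ ^ 2 / (1 + ‖ξ‖ ^ 2) ^ 2)) * t) *
        ‖ξ‖ ^ k * ‖u ξ‖ := fun α ξ => by
    rw [norm_smul, hmt]
    calc ‖mono α ξ‖ * ‖c.evolve u t ξ‖ ≤ ((2 * Real.pi) ^ k * ‖ξ‖ ^ k) *
        (M * Real.exp (-(δ * (‖ξ‖ ^ 2 / (1 + ‖ξ‖ ^ 2) ^ 2)) * t) * ‖u ξ‖) := by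
          gcongr
          · exact norm_mono_le α ξ
          · exact (c.flow t ξ).le_of_opNorm_le (hflow ξ t ht) _
      _ = _ := by ring
  have hαm : ∀ α : Fin k → Fin n,
      AEStronglyMeasurable (fun ξ => mono α ξ • c.evolve u (max t 0) ξ) volume := fun α =>
    (continuous_mono α).aestronglyMeasurable.smul (c.aestronglyMeasurable_evolve hum _)
  have hα : ∀ α : Fin k → Fin n, MemLp (fun ξ => mono α ξ • c.evolve u (max t 0) ξ) 2 volume :=
    fun α => hreg hM' (hαm α) fun ξ => by
      refine (hpt α ξ).trans ?_
      have h1 : Real.exp (-(δ * (‖ξ‖ ^ 2 / (1 + ‖ξ‖ ^ 2) ^ 2)) * t) ≤ 1 :=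
        Real.exp_le_one_iff.2 (by rw [neg_mul]; exact neg_nonpos.2 (by positivity))
      calc _ ≤ (2 * Real.pi) ^ k * M * 1 * ‖ξ‖ ^ k * ‖u ξ‖ := by gcongr
        _ ≤ (2 * Real.pi) ^ k * M * (1 + ‖ξ‖ ^ k) * ‖u ξ‖ := by
          rw [mul_one]
          gcongr
          linarith
  have hpart : ∀ α : Fin k → Fin n, partialNorm α p (c.solution hu' t) ≤
      ENNReal.ofReal (C₁ * (1 + t) ^ (-gamma2 n q p - (k : ℝ) / 2)) * eLpNorm w₀ q volume +
      ENNReal.ofReal (C₂ * (1 + t) ^ (-(ℓ : ℝ) / 2 + gamma2 n r p)) *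
        ∑ β, eLpNorm (g β) r volume := fun α => by
    refine ((isWeakPartial_rePart_invFourier (hu' t) (hα α)).partialNorm_eq p).trans_le ?_
    refine (eLpNorm_rePart_le _ p).trans ?_
    refine (eLpNorm_invFourier_le_add_compl (hα α) (le_trans (by norm_num) hp)
      (measurableSet_ball (x := (0 : Rn n)) (ε := 1))).trans (add_le_add ?_ ?_)
    · exact (hlow t ht (hαm α) hum hNu (ae_of_all _ (hpt α))).2 _
    · exact (hhigh t ht (h := fun ξ => ‖u ξ‖) (hαm α) hvm hNv (ae_of_all _ (hpt α))
        (hsum.mono fun ξ hξ => ⟨norm_nonneg _, hξ⟩)).2 _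
  have hD : derivNorm (k + ℓ) r w₀ = ∑ β, eLpNorm (g β) r volume :=
    Finset.sum_congr rfl fun β _ => (hg β).partialNorm_eq r
  rw [hD, derivNorm]
  refine (Finset.sum_le_sum fun α _ => hpart α).trans ?_
  have hcard : ∀ {C x : ℝ}, C ≤ C₁ + C₂ → 0 ≤ x → (K : ℝ≥0∞) * ENNReal.ofReal (C * x) ≤
      ENNReal.ofReal ((K * (C₁ + C₂) + 1) * x) := fun {C x} hC hx => by
    rw [← ENNReal.ofReal_natCast K, ← ENNReal.ofReal_mul (by positivity), ← mul_assoc]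
    refine ENNReal.ofReal_le_ofReal (mul_le_mul_of_nonneg_right ?_ hx)
    have : (K : ℝ) * C ≤ K * (C₁ + C₂) := by gcongr
    linarith
  rw [Finset.sum_const, Finset.card_univ, nsmul_eq_mul, mul_add, ← mul_assoc, ← mul_assoc]
  gcongr
  · exact hcard (by linarith) (by positivity)
  · exact hcard (by linarith) (by positivity)

end HypSys

end

theorem proposition4p1 {n m : ℕ} (hn : 1 ≤ n) (c : HypSys.Coeffs n m) (hc : c.Dissipative)
    (p q r : ℝ≥0∞) (hp : 2 ≤ p) (hq1 : 1 ≤ q) (hq2 : q ≤ 2) (hr1 : 1 ≤ r) (hr2 : r ≤ 2)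
    (k ℓ : ℕ)
    (hℓ : (n : ℝ) * ((r⁻¹).toReal - (p⁻¹).toReal) < (ℓ : ℝ) ∨ (p = 2 ∧ r = 2)) :
    ∃ C : ℝ, 0 < C ∧
      ∀ l : ℕ, k + ℓ ≤ l →
      ∀ w₀ : HypSys.Rn n → HypSys.Rn m, HypSys.MemW l r w₀ → MemLp w₀ q volume →
        ∃ w : ℝ → HypSys.Rn n → HypSys.Rn m,
          c.IsSolution w₀ w ∧
          (∀ w' : ℝ → HypSys.Rn n → HypSys.Rn m, c.IsSolution w₀ w' →
            ∀ t : ℝ, 0 ≤ t → w' t =ᵐ[volume] w t) ∧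
          ∀ t : ℝ, 0 ≤ t →
            HypSys.derivNorm k p (w t) ≤
              ENNReal.ofReal (C * (1 + t) ^ (-HypSys.gamma2 n q p - (k : ℝ) / 2)) *
                  eLpNorm w₀ q volume
              + ENNReal.ofReal (C * (1 + t) ^ (-(ℓ : ℝ) / 2 + HypSys.gamma2 n r p)) *
                  HypSys.derivNorm (k + ℓ) r w₀ :=
  hc.exists_unique_solution_decay hn p q r hp hq1 hq2 hr1 hr2 k ℓ hℓ
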